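/- **Theorem 4.1.** Let $d\ge 1$ and let $\mathcal P$ be the set of probability vectors $(p_z)_{z\in\mathbb Z^d}$. Let $\Omega=\mathcal P^{\mathbb Z^d}$ be the space of environments $\omega=(\omega_x)_{x\in\mathbb Z^d}$, $\omega_x=(\omega_{x,z})_{z\in\mathbb Z^d}$, with its product $\sigma$-algebra, $\pi_{x,y}(\omega)=\omega_{x,y-x}$, and shifts $(T_z\omega)_x=\omega_{x+z}$. For $\omega\in\Omega$ let $P^\omega_z$ be the law of the Markov chain $(X_n)_{n\ge0}$ on $\mathbb Z^d$ with $X_0=z$ and transition probabilities $\pi_{x,y}(\omega)$. Let $\mathbb P$ be a probability measure on $\Omega$ under which the vectors $(\omega_x)_{x\in\mathbb Z^d}$ are i.i.d., and put $P_0(\cdot)=\int P_0^\omega(\cdot)\,\mathbb P(d\omega)$ with expectation $E_0$. Fix $\hat u\in\mathbb Z^d$ with $P_0\{X_n\cdot\hat u\to\infty\}=1$, and let $\tau_1$ be the first regeneration time, that is, the least $n\ge1$ with $$\sup_{k<n}X_k\cdot\hat u<X_n\cdot\hat u=\inf_{k\ge n}X_k\cdot\hat u .$$ Assume: - (S) there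 is a constant $0<M<\infty$ such that $\mathbb P\{\pi_{0,z}=0\}=1$ whenever $|z|>M$ (Euclidean norm); - (T) $E_0(\tau_1^{p_0})<\infty$ for some real $p_0>4d+1$. For integers $\ell$ let $\mathfrak S_\ell=\sigma\{\omega_x:x\cdot\hat u\ge\ell\}$, let $d_{\rm Var}(\mu,\nu)=\sup_A\{\mu(A)-\nu(A)\}$ (supremum over measurable sets $A$), and let $\Pi(\omega,A)=P_0^\omega\{T_{X_1}\omega\in A\}$ be the transition kernel of the environment seen from the particle. Then there exist a probability measure $\mathbb P_\infty$ on $\Omega$ and a finite constant $C$ such that, with $P_0^\infty(\cdot)=\int P_0^\omega(\cdot)\,\mathbb P_\infty(d\omega)$ and expectation $E_0^\infty$: - (a) for $\mathbb P_\infty$-almost every $\omega$, $\pi_{x,x+z}(\omega)=0$ for all $x,z\in\mathbb Z^d$ with $|z|>M$; - (b) $\mathbb P_\infty$ is invariant for $\Pi$, and ergodic: every measurable $A\subset\Omega$ with $\Pi(\omega,A)=\mathbf 1_A(\omega)$ for $\mathbb P_\infty$-a.e. $\omega$ has $\mathbb P_\infty(A)\in\{0,1\}$; - (c) $d_{\rm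 Var}\bigl(\mathbb P_\infty|_{\mathfrak S_\ell},\mathbb P|_{\mathfrak S_\ell}\bigr)\le C\ell^{1-p_0}$ for all integers $\ell\ge1$; - (d) $E_0^\infty\bigl[\,|\inf_{n\ge0}X_n\cdot\hat u|^p\,\bigr]\le C$ for all real $p$ with $1\le p\le p_0-1$; - (e) $P_0^\infty\{X_n\cdot\hat u\le n^{1/2}\}\le Cn^{-p}$ for all real $p$ with $1\le p\le(p_0-1)/2$ and all integers $n\ge1$. -/

import Mathlib

open MeasureTheory ProbabilityTheory Filter
open scoped ENNReal

namespace RWRE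

/-- Sites of the lattice `ℤ^d`. -/
abbrev Site (d : ℕ) : Type := Fin d → ℤ

/-- Infinite lattice paths `x_{0,∞}`. -/
abbrev Path (d : ℕ) : Type := ℕ → Site d

/-- The Euclidean norm of a lattice vector. -/
noncomputable def euclNorm {d : ℕ} (z : Site d) : ℝ := Real.sqrt (∑ i, (z i : ℝ) ^ 2)

/-- The σ-algebra on the simplex of probability vectors generated by the coordinates
`p ↦ p z`. -/
instance instMeasurableSpaceVec (d : ℕ) : MeasurableSpace (PMF (Site d)) :=
  MeasurableSpace.comap (fun (p : PMF (Site d)) (z : Site d) => p z) MeasurableSpace.pi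

/-- Environments: at each site `x` a probability vector `ω x = (ω_{x,z})_z`, where
`ω_{x,z} = ω x z` is the probability of a jump from `x` to `x + z`.  The space carries the
product σ-algebra. -/
abbrev Env (d : ℕ) : Type := Site d → PMF (Site d)

/-- The natural shift, `(T_z ω)_x = ω_{x+z}`. -/
def shift {d : ℕ} (z : Site d) (ω : Env d) : Env d := fun x => ω (x + z)

/-- One step of the walk in the environment `ω`: from `x` to `y` with probability
`π_{x,y}(ω) = ω_{x,y-x}`. -/
noncomputable def walkKernel {d : ℕ} (ω : Env d) : Kernel (Site d) (Site d) where
  toFun x := ((ω x).map (fun z => x + z)).toMeasure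
  measurable' := measurable_of_countable _

instance instMarkovWalk {d : ℕ} (ω : Env d) : IsMarkovKernel (walkKernel ω) :=
  ⟨fun x => PMF.toMeasure.isProbabilityMeasure ((ω x).map (fun z => x + z))⟩

/-- The same step, as a function of the whole past of the path. -/
noncomputable def historyKernel {d : ℕ} (ω : Env d) (n : ℕ) :
    Kernel (Finset.Iic n → Site d) (Site d) :=
  (walkKernel ω).comap (fun h => h ⟨n, Finset.mem_Iic.2 le_rfl⟩) (measurable_pi_apply _)

instance instMarkovHistory {d : ℕ} (ω : Env d) (n : ℕ) : IsMarkovKernel (historyKernel ω n) := by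
  unfold historyKernel; infer_instance

/-- The quenched path measure `P_z^ω`: the law on path space of the Markov chain started
at `z` with transition probabilities `π_{x,y}(ω)` (Ionescu-Tulcea construction). -/
noncomputable def quenched {d : ℕ} (ω : Env d) (z : Site d) : Measure (Path d) :=
  Kernel.traj (X := fun _ => Site d) (historyKernel ω) 0 (fun _ => z)

instance instProbQuenched {d : ℕ} (ω : Env d) (z : Site d) :
    IsProbabilityMeasure (quenched ω z) := by
  unfold quenched; infer_instance

theorem measurable_weight {d : ℕ} (x z : Site d) : Measurable (fun ω : Env d => ω x z) := by
  have h : Measurable (fun p : PMF (Site d) => (fun z => p z : Site d → ℝ≥0∞)) :=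
    comap_measurable _
  exact (measurable_pi_apply z).comp (h.comp (measurable_pi_apply x))

theorem walkKernel_singleton {d : ℕ} (ω : Env d) (x y : Site d) :
    walkKernel ω x {y} = ω x (y - x) := by
  change ((ω x).map (fun z => x + z)).toMeasure {y} = _
  rw [PMF.toMeasure_apply_singleton _ _ (measurableSet_singleton _), PMF.map_apply,
    tsum_eq_single (y - x)]
  · simp
  · intro z hz
    rw [if_neg]
    rintro rfl
    simp at hz

/-- The finite-dimensional distributions of the walk: `P_z^ω{X_0 = a_0, …, X_n = a_n}` is
`1{a_0 = z} ∏_{i<n} π_{a_i,a_{i+1}}(ω)`. -/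
theorem quenched_cylinder {d : ℕ} (ω : Env d) (z : Site d) (a : Path d) (n : ℕ) :
    quenched ω z {X | ∀ i ≤ n, X i = a i} =
      if a 0 = z then ∏ i ∈ Finset.range n, ω (a i) (a (i + 1) - a i) else 0 := by
  let pre : (n : ℕ) → Finset.Iic n → Site d := fun n i => a i
  have key : ∀ n, (quenched ω z).map (Preorder.frestrictLe (π := fun _ => Site d) n)
      = Kernel.partialTraj (X := fun _ => Site d) (historyKernel ω) 0 n (fun _ => z) := fun n =>
    Kernel.traj_map_frestrictLe_apply (X := fun _ => Site d) (κ := historyKernel ω) 0 n _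
  have hset : ∀ n, {X : Path d | ∀ i ≤ n, X i = a i}
      = (Preorder.frestrictLe (π := fun _ => Site d) n) ⁻¹' {pre n} := by
    intro n
    ext X
    simp only [Set.mem_ofPred_eq, Set.mem_preimage, Set.mem_singleton_iff, funext_iff]
    exact ⟨fun h i => h i (Finset.mem_Iic.1 i.2), fun h i hi => h ⟨i, Finset.mem_Iic.2 hi⟩⟩
  have hq : ∀ n, quenched ω z {X | ∀ i ≤ n, X i = a i}
      = Kernel.partialTraj (X := fun _ => Site d) (historyKernel ω) 0 n (fun _ => z)
          {pre n} := by
    intro n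
    rw [← key n, Measure.map_apply (by fun_prop) (measurableSet_singleton _), hset]
  induction n with
  | zero =>
    rw [hq 0, Kernel.partialTraj_self, Kernel.id_apply,
      Measure.dirac_apply' _ (measurableSet_singleton _)]
    by_cases h : a 0 = z
    · rw [if_pos h, Set.indicator_of_mem]
      · simp
      · rw [Set.mem_singleton_iff]
        funext i
        have : (i : ℕ) = 0 := Nat.le_zero.1 (Finset.mem_Iic.1 i.2)
        change z = a i
        rw [this, h]
    · rw [if_neg h, Set.indicator_of_notMem]
      intro h'
      exact h (congrFun h' ⟨0, Finset.mem_Iic.2 le_rfl⟩).symm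
  | succ n ih =>
    have h1 := Kernel.partialTraj_compProd_eq_map_traj (X := fun _ => Site d)
      (κ := historyKernel ω) (Nat.zero_le n) (x₀ := fun _ => z)
    have h2 : {X : Path d | ∀ i ≤ n + 1, X i = a i}
        = (fun X : Path d => (Preorder.frestrictLe (π := fun _ => Site d) n X, X (n + 1))) ⁻¹'
          ({pre n} ×ˢ {a (n + 1)}) := by
      ext X
      have := Set.ext_iff.1 (hset n) X
      simp only [Set.mem_ofPred_eq, Set.mem_preimage, Set.mem_prod] at this ⊢
      rw [← this, Set.mem_singleton_iff]
      constructor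
      · exact fun h => ⟨fun i hi => h i (by omega), h _ le_rfl⟩
      · rintro ⟨h, h'⟩ i hi
        rcases Nat.lt_or_ge n i with hlt | hle
        · have : i = n + 1 := by omega
          rw [this, h']
        · exact h i hle
    have h3 : quenched ω z {X | ∀ i ≤ n + 1, X i = a i}
        = Measure.map (fun X : Path d =>
            (Preorder.frestrictLe (π := fun _ => Site d) n X, X (n + 1))) (quenched ω z)
          ({pre n} ×ˢ {a (n + 1)}) := by
      rw [Measure.map_apply (by fun_prop)
        ((measurableSet_singleton _).prod (measurableSet_singleton _)), h2]
    rw [h3]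
    unfold quenched
    rw [← h1, Measure.compProd_apply_prod (measurableSet_singleton _) (measurableSet_singleton _),
      lintegral_singleton, ← hq n, ih]
    have h4 : historyKernel ω n (pre n) {a (n + 1)} = ω (a n) (a (n + 1) - a n) :=
      walkKernel_singleton ω (a n) (a (n + 1))
    rw [h4, Finset.prod_range_succ]
    split_ifs
    · rw [mul_comm]
    · simp

theorem measurable_quenched {d : ℕ} (z : Site d) :
    Measurable (fun ω : Env d => quenched ω z) := by
  let S : Set (Set (Path d)) := {s | ∃ (a : Path d) (n : ℕ), s = {X | ∀ i ≤ n, X i = a i}}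
  have hS : ∀ s ∈ S, MeasurableSet s := by
    rintro s ⟨a, n, rfl⟩
    have : {X : Path d | ∀ i ≤ n, X i = a i} = ⋂ i, ⋂ (_ : i ≤ n), (fun X => X i) ⁻¹' {a i} := by
      ext X; simp
    rw [this]
    exact MeasurableSet.iInter fun i => MeasurableSet.iInter fun _ =>
      measurable_pi_apply i (measurableSet_singleton _)
  have hgen : (MeasurableSpace.pi : MeasurableSpace (Path d)) = .generateFrom S := by
    apply le_antisymm
    · refine iSup_le fun n => ?_
      rintro _ ⟨t, -, rfl⟩
      have : (fun X : Path d => X n) ⁻¹' t = ⋃ (h : Fin (n + 1) → Site d),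
          ⋃ (_ : h (Fin.last n) ∈ t), {X : Path d | ∀ i ≤ n, X i =
            (fun j => if hj : j < n + 1 then h ⟨j, hj⟩ else 0) i} := by
        ext X
        simp only [Set.mem_preimage, Set.mem_iUnion, Set.mem_ofPred_eq, exists_prop]
        constructor
        · intro hX
          refine ⟨fun i => X i, by simpa using hX, fun i hi => ?_⟩
          rw [dif_pos (by omega)]
        · rintro ⟨h, ht, hX⟩
          have := hX n le_rfl
          rw [dif_pos (by omega)] at this
          rw [this]
          exact ht
      rw [this]
      exact MeasurableSet.iUnion fun h => MeasurableSet.iUnion fun _ =>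
        MeasurableSpace.measurableSet_generateFrom ⟨_, n, rfl⟩
    · exact MeasurableSpace.generateFrom_le hS
  have hpi : IsPiSystem S := by
    rintro _ ⟨a, n, rfl⟩ _ ⟨b, m, rfl⟩ ⟨X, hX, hX'⟩
    refine ⟨X, max n m, ?_⟩
    ext Y
    simp only [Set.mem_inter_iff, Set.mem_ofPred_eq] at hX hX' ⊢
    constructor
    · rintro ⟨h, h'⟩ i hi
      rcases le_max_iff.1 hi with hi | hi
      · rw [h i hi, hX i hi]
      · rw [h' i hi, hX' i hi]
    · exact fun h => ⟨fun i hi => (h i (le_max_of_le_left hi)).trans (hX i hi),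
        fun i hi => (h i (le_max_of_le_right hi)).trans (hX' i hi)⟩
  refine Measurable.measure_of_isPiSystem_of_isProbabilityMeasure hgen hpi ?_
  rintro _ ⟨a, n, rfl⟩
  simp only [quenched_cylinder]
  split_ifs
  · exact Finset.measurable_prod _ fun i _ => measurable_weight _ _
  · exact measurable_const

/-- The quenched law started at `z`, as a kernel from environments to paths. -/
noncomputable def quenchedKernel {d : ℕ} (z : Site d) : Kernel (Env d) (Path d) where
  toFun ω := quenched ω z
  measurable' := measurable_quenched z

instance instMarkovQuenched {d : ℕ} (z : Site d) : IsMarkovKernel (quenchedKernel z) :=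
  ⟨fun ω => instProbQuenched ω z⟩

/-- The averaged law of the walk started at `z`, when the environment has law `μ`:
`∫ P_z^ω(·) μ(dω)`, the path marginal of `P_z^ω(dx_{0,∞}) μ(dω)`. -/
noncomputable def averaged {d : ℕ} (μ : Measure (Env d)) (z : Site d) : Measure (Path d) :=
  μ.bind (quenchedKernel z)

theorem measurable_shift {d : ℕ} (z : Site d) : Measurable (shift z : Env d → Env d) :=
  measurable_pi_lambda _ fun x => measurable_pi_apply (x + z)

theorem measurable_shift_uncurry {d : ℕ} :
    Measurable (fun q : Env d × Path d => shift (q.2 1) q.1) := by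
  have h : Measurable (fun q : Env d × Site d => shift q.2 q.1) :=
    measurable_from_prod_countable_left fun z => measurable_shift z
  exact h.comp (measurable_fst.prodMk ((measurable_pi_apply 1).comp measurable_snd))

/-- The transition kernel of the environment process,
`Π(ω, A) = P_0^ω{T_{X_1} ω ∈ A}`. -/
noncomputable def envKernel (d : ℕ) : Kernel (Env d) (Env d) where
  toFun ω := (quenched ω 0).map (fun X => shift (X 1) ω)
  measurable' := by
    refine Measure.measurable_of_measurable_coe _ fun A hA => ?_
    have h : ∀ ω : Env d, (quenched ω 0).map (fun X => shift (X 1) ω) A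
        = quenchedKernel 0 ω (Prod.mk ω ⁻¹' ((fun q : Env d × Path d => shift (q.2 1) q.1) ⁻¹' A)) :=
      fun ω => Measure.map_apply (measurable_shift_uncurry.comp measurable_prodMk_left) hA
    simp only [h]
    exact Kernel.measurable_kernel_prodMk_left (measurable_shift_uncurry hA)

/-- Ergodicity of a probability measure `μ` for a transition kernel `κ`: every set `A` that is
invariant, i.e. `κ(ω, A) = 1_A(ω)` for `μ`-almost every `ω`, has `μ`-measure zero or one. -/
def IsErgodicFor {α : Type*} [MeasurableSpace α] (κ : Kernel α α) (μ : Measure α) : Prop :=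
  ∀ A : Set α, MeasurableSet A → (∀ᵐ ω ∂μ, κ ω A = A.indicator 1 ω) → μ A = 0 ∨ μ A = 1

/-- `μ` is an i.i.d. product measure: the vectors `(ω_x)_x` are i.i.d. under `μ`. -/
def IsIIDProduct {d : ℕ} (μ : Measure (Env d)) : Prop :=
  ∃ ν : Measure (PMF (Site d)), ∃ _ : IsProbabilityMeasure ν,
    μ = Measure.infinitePi (fun _ : Site d => ν)

/-- Bounded steps: `μ{π_{0,z} = 0} = 1` whenever `|z| > M`. -/
def BoundedSteps {d : ℕ} (μ : Measure (Env d)) (M : ℝ) : Prop :=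
  ∀ z : Site d, M < euclNorm z → μ {ω | ω 0 z = 0} = 1

/-- Transience in direction `u`: `P_0{X_n · u → ∞} = 1`. -/
def TransientInDirection {d : ℕ} (μ : Measure (Env d)) (u : Site d) : Prop :=
  ∀ᵐ X ∂(averaged μ 0), Tendsto (fun n => X n ⬝ᵥ u) atTop atTop

/-- `n ≥ 1` and `sup_{k<n} X_k · u < X_n · u = inf_{k≥n} X_k · u`. -/
def IsRegeneration {d : ℕ} (u : Site d) (X : Path d) (n : ℕ) : Prop :=
  1 ≤ n ∧ (∀ k < n, X k ⬝ᵥ u < X n ⬝ᵥ u) ∧ ∀ k ≥ n, X n ⬝ᵥ u ≤ X k ⬝ᵥ u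

/-- The first regeneration time `τ₁` in direction `u` (infinite if there is none). -/
noncomputable def regenTime {d : ℕ} (u : Site d) (X : Path d) : ℝ≥0∞ :=
  ⨅ (n : ℕ) (_ : IsRegeneration u X n), (n : ℝ≥0∞)

/-- `E_0(τ₁^p) < ∞`. -/
def RegenMoment {d : ℕ} (μ : Measure (Env d)) (u : Site d) (p : ℝ) : Prop :=
  ∫⁻ X, regenTime u X ^ p ∂(averaged μ 0) < ∞

/-- The σ-algebra `𝔖_ℓ = σ{ω_x : x · u ≥ ℓ}`. -/
abbrev levelSigma {d : ℕ} (u : Site d) (l : ℤ) : MeasurableSpace (Env d) :=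
  ⨆ (x : Site d) (_ : l ≤ x ⬝ᵥ u), MeasurableSpace.comap (fun ω : Env d => ω x) inferInstance

theorem levelSigma_le {d : ℕ} (u : Site d) (l : ℤ) :
    levelSigma u l ≤ (MeasurableSpace.pi : MeasurableSpace (Env d)) :=
  iSup₂_le fun x _ => (measurable_pi_apply x).comap_le

/-- The variation distance `sup_A {μ(A) - ν(A)}` over measurable sets `A`. -/
noncomputable def varDist {α : Type*} {m : MeasurableSpace α} (μ ν : Measure α) : ℝ :=
  ⨆ A : {A : Set α // MeasurableSet A}, (μ.real A - ν.real A)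

/-- `|inf_{n≥0} X_n · u|`, with value `∞` if the infimum is `-∞`. -/
noncomputable def backtrack {d : ℕ} (u : Site d) (X : Path d) : ℝ≥0∞ :=
  (⨅ n : ℕ, (((X n ⬝ᵥ u : ℤ) : ℝ) : EReal)).abs

end RWRE

/-! The walk is cut at its regeneration times. Up to such a time it has used the environment only
strictly below its present level, and from then on it uses the environment only at or above that
level. Past and future are therefore independent, and the future is distributed like environment and
walk conditioned never to go below level zero, the law `condJoint` (`isRegenerative_joint`,
`isRegenerative_condJoint`). The blocks between regenerations form a renewal structure with finite
mean block length.

Let `f` look at most `r` levels behind the particle. Visits counted from level `r` on satisfy a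
renewal equation (`sum_visit_renewal`), so by the elementary renewal theorem
(`tendsto_div_of_renewal`) the averages over `n` of the mean of `f(T_{X_n} ω)` converge; the limit
is a mean over one block divided by the mean block length (`blockMeasure`). These limits are
consistent in `r` and come from one measure `Q` (`exists_isAverageLimit`), which is the measure
sought. It is invariant because averages do not feel a shift by one step.

The estimates (c), (d), (e) rest on one principle (`le_lintegral_blockSum`). Let `V m` be a bounded
functional at time `m` that can only increase when the path before a regeneration is forgotten. Then
the limiting average of its means is at most the mean, under `condJoint`, of the sum of `V m` over
`m < τ₁`. Under `condJoint` the walk is nonnegative and gains at most `c` levels per step, so before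
`τ₁` its level is at most `c * τ₁`. Falling back by `l` within a block thus forces `τ₁ ≥ l / c`,
which gives (c); the walk seen from a time in the block never falls by more than `c * τ₁`, which
gives (d); and slow progress forces a long block or a long gap among about `√n` regenerations, which
gives (e). The powers come from the moment of order `p₀`.

Ergodicity is decorrelation. What is seen at time `m` is independent of what follows the first
regeneration beyond its range, and the waiting time for that regeneration has bounded mean on
average over `m`, because `τ₁` is square integrable. This bounds two-time correlations under `Q`
(`exists_lintegral_mul_sum_seen_le`), and approximation of an invariant set `A` by cylinder events
yields `Q A ≤ (Q A)²`. -/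

namespace RWRE

/-! ### Cylinders of paths and the quenched Markov property. -/

variable {d : ℕ}

/-- Paths that agree with `a` up to time `n`. -/
def cyl (a : Path d) (n : ℕ) : Set (Path d) := {X | ∀ i ≤ n, X i = a i}

theorem measurableSet_cyl (a : Path d) (n : ℕ) : MeasurableSet (cyl a n) := by
  have : cyl a n = ⋂ i, ⋂ (_ : i ≤ n), (fun X : Path d => X i) ⁻¹' {a i} := by
    ext X; simp [cyl]
  rw [this]
  exact MeasurableSet.iInter fun i => MeasurableSet.iInter fun _ =>
    measurable_pi_apply i (measurableSet_singleton _)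

/-- The path that follows `a` and then stays at its last site. -/
def extend {n : ℕ} (a : Fin (n + 1) → Site d) : Path d :=
  fun i => a ⟨min i n, by omega⟩

theorem cyl_extend_eq {n : ℕ} (a : Fin (n + 1) → Site d) :
    cyl (extend a) n = (fun (X : Path d) (i : Fin (n + 1)) => X i) ⁻¹' {a} := by
  ext X
  simp only [cyl, extend, Set.mem_ofPred_eq, Set.mem_preimage, Set.mem_singleton_iff]
  constructor
  · intro h
    funext i
    rw [h i (by omega)]
    congr 1
    ext
    simp; omega
  · intro h i hi
    have := congrFun h ⟨i, by omega⟩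
    simp only at this
    rw [this]
    congr 1
    ext
    simp; omega

/-- There are countably many finite paths. Splitting along them replaces random shifts such as
`T_{X_n}` by deterministic ones. -/
theorem lintegral_eq_tsum_cyl {Ω : Type*} [MeasurableSpace Ω] (μ : Measure (Ω)) (Y : Ω → Path d)
    (hY : Measurable Y) (n : ℕ) (G : Ω → ℝ≥0∞) :
    ∫⁻ y, G y ∂μ = ∑' a : Fin (n + 1) → Site d, ∫⁻ y in Y ⁻¹' cyl (extend a) n, G y ∂μ := by
  have hm : Measurable (fun (X : Path d) (i : Fin (n + 1)) => X i) := by fun_prop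
  rw [← lintegral_iUnion]
  · have : (⋃ a : Fin (n + 1) → Site d, Y ⁻¹' cyl (extend a) n) = Set.univ := by
      ext X
      simp [cyl_extend_eq]
    rw [this, Measure.restrict_univ]
  · exact fun a => hY (measurableSet_cyl _ _)
  · intro a b hab
    rw [Function.onFun, Set.disjoint_left]
    intro X hX hX'
    simp only [Set.mem_preimage, cyl_extend_eq, Set.mem_singleton_iff] at hX hX'
    exact hab (hX.symm.trans hX')

theorem isPiSystem_cyl : IsPiSystem {s : Set (Path d) | ∃ a n, s = cyl a n} := by
  rintro _ ⟨a, n, rfl⟩ _ ⟨b, m, rfl⟩ ⟨X, hX, hX'⟩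
  refine ⟨X, max n m, ?_⟩
  ext Y
  simp only [cyl, Set.mem_inter_iff, Set.mem_ofPred_eq] at hX hX' ⊢
  constructor
  · rintro ⟨h, h'⟩ i hi
    rcases le_max_iff.1 hi with hi | hi
    · rw [h i hi, hX i hi]
    · rw [h' i hi, hX' i hi]
  · exact fun h => ⟨fun i hi => (h i (le_max_of_le_left hi)).trans (hX i hi),
      fun i hi => (h i (le_max_of_le_right hi)).trans (hX' i hi)⟩

theorem generateFrom_cyl :
    (MeasurableSpace.pi : MeasurableSpace (Path d)) =
      .generateFrom {s : Set (Path d) | ∃ a n, s = cyl a n} := by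
  apply le_antisymm
  · refine iSup_le fun n => ?_
    rintro _ ⟨t, -, rfl⟩
    have : (fun X : Path d => X n) ⁻¹' t = ⋃ (h : Fin (n + 1) → Site d),
        ⋃ (_ : h (Fin.last n) ∈ t), cyl (extend h) n := by
      ext X
      simp only [cyl_extend_eq, Set.mem_preimage, Set.mem_iUnion, Set.mem_singleton_iff,
        exists_prop]
      constructor
      · exact fun hX => ⟨fun i => X i, by simpa using hX, rfl⟩
      · rintro ⟨h, ht, rfl⟩
        simpa using ht
    rw [this]
    exact MeasurableSet.iUnion fun h => MeasurableSet.iUnion fun _ =>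
      MeasurableSpace.measurableSet_generateFrom ⟨_, n, rfl⟩
  · refine MeasurableSpace.generateFrom_le ?_
    rintro _ ⟨a, n, rfl⟩
    exact measurableSet_cyl a n

theorem measure_ext_cyl {μ ν : Measure (Path d)} [IsFiniteMeasure μ]
    (h : ∀ a n, μ (cyl a n) = ν (cyl a n)) : μ = ν := by
  refine Measure.ext_of_generateFrom_of_iUnion _ (fun N : ℕ => cyl (extend ((Encodable.decode (α := Fin 1 → Site d) N).getD default)) 0) generateFrom_cyl isPiSystem_cyl ?_
    (fun _ => ⟨_, _, rfl⟩) (fun _ => measure_ne_top _ _) ?_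
  · refine Set.eq_univ_of_forall fun X => Set.mem_iUnion.2 ⟨Encodable.encode (fun i : Fin 1 => X i), ?_⟩
    rw [cyl_extend_eq]
    simp
  · rintro _ ⟨a, n, rfl⟩
    exact h a n

theorem quenched_cyl (ω : Env d) (a : Path d) (n : ℕ) :
    quenched ω 0 (cyl a n) =
      if a 0 = 0 then ∏ i ∈ Finset.range n, ω (a i) (a (i + 1) - a i) else 0 :=
  quenched_cylinder ω 0 a n

/-- A functional of the first `n` steps has the same quenched mean in two environments that give
the same probability to every finite path on which it does not vanish. -/
theorem lintegral_quenched_congr {ω ω' : Env d} {n : ℕ} {G : Path d → ℝ≥0∞}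
    (hG : ∀ X X' : Path d, (∀ i ≤ n, X i = X' i) → G X = G X')
    (h : ∀ a : Path d, G a ≠ 0 → quenched ω 0 (cyl a n) = quenched ω' 0 (cyl a n)) :
    ∫⁻ X, G X ∂quenched ω 0 = ∫⁻ X, G X ∂quenched ω' 0 := by
  rw [lintegral_eq_tsum_cyl _ id measurable_id n, lintegral_eq_tsum_cyl _ id measurable_id n]
  refine tsum_congr fun a => ?_
  have key : ∀ μ : Measure (Path d), ∫⁻ X in id ⁻¹' cyl (extend a) n, G X ∂μ
      = G (extend a) * μ (cyl (extend a) n) := by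
    intro μ
    rw [Set.preimage_id, setLIntegral_congr_fun (g := fun _ => G (extend a))
      (measurableSet_cyl _ _) (fun X hX => hG _ _ hX), setLIntegral_const]
  rw [key, key]
  by_cases h0 : G (extend a) = 0
  · simp [h0]
  · rw [h _ h0]

/-- The path seen from its position at time `n`. -/
def pathShift (n : ℕ) (X : Path d) : Path d := fun k => X (n + k) - X n

theorem measurable_pathShift (n : ℕ) : Measurable (pathShift n : Path d → Path d) :=
  measurable_pi_lambda _ fun k => by
    have h : Measurable (fun p : Site d × Site d => p.1 - p.2) := measurable_of_countable _
    exact h.comp (Measurable.prodMk (f := fun X : Path d => X (n + k)) (measurable_pi_apply _)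
      (measurable_pi_apply n))

/-- The product of transition probabilities along a concatenated path splits at time `n`, and its
second factor is a product in the environment shifted by `a n`. Cylinders determine the measure. -/
theorem quenched_markov (ω : Env d) (a : Path d) (n : ℕ) :
    ((quenched ω 0).restrict (cyl a n)).map (pathShift n)
      = quenched ω 0 (cyl a n) • quenched (shift (a n) ω) 0 := by
  refine measure_ext_cyl fun b m => ?_
  rw [Measure.map_apply (measurable_pathShift n) (measurableSet_cyl _ _),
    Measure.restrict_apply (measurable_pathShift n (measurableSet_cyl _ _)), Measure.smul_apply,
    smul_eq_mul, quenched_cyl (shift (a n) ω)]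
  by_cases hb : b 0 = 0
  -- The concatenation of `a` with `b` moved to `a n`; since `b 0 = 0` the two definitions agree at
  -- time `n`.
  · let c : Path d := fun i => if i ≤ n then a i else a n + b (i - n)
    have hc : pathShift n ⁻¹' cyl b m ∩ cyl a n = cyl c (n + m) := by
      ext X
      simp only [Set.mem_inter_iff, Set.mem_preimage, cyl, Set.mem_ofPred_eq, pathShift, c]
      constructor
      · rintro ⟨h1, h2⟩ i hi
        split_ifs with h
        · exact h2 i h
        · have := h1 (i - n) (by omega)
          rw [Nat.add_sub_cancel' (by omega), h2 n le_rfl] at this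
          rw [← this]; abel
      · intro h
        have h2 : ∀ i ≤ n, X i = a i := fun i hi => by
          have := h i (by omega)
          rwa [if_pos hi] at this
        refine ⟨fun i hi => ?_, h2⟩
        rw [h2 n le_rfl, h (n + i) (by omega)]
        split_ifs with h3
        · have : i = 0 := by omega
          subst this
          simp [hb]
        · simp
    rw [hc, quenched_cyl, quenched_cyl, if_pos hb, Finset.prod_range_add]
    have h0 : c 0 = a 0 := by simp [c]
    rw [h0]
    split_ifs with ha
    · congr 1
      · refine Finset.prod_congr rfl fun i hi => ?_
        rw [Finset.mem_range] at hi
        simp only [c]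
        rw [if_pos hi.le, if_pos (by omega)]
      · refine Finset.prod_congr rfl fun i _ => ?_
        have h1 : c (n + i) = a n + b i := by
          simp only [c]
          split_ifs with h
          · have : i = 0 := by omega
            subst this
            simp [hb]
          · simp
        have h2 : c (n + i + 1) = a n + b (i + 1) := by
          simp only [c]
          rw [if_neg (by omega)]
          congr 2; omega
        rw [h1, h2]
        simp only [shift]
        rw [add_comm (b i), add_sub_add_left_eq_sub]
    · simp
  · have : pathShift n ⁻¹' cyl b m ∩ cyl a n = ∅ := by
      ext X
      simp only [Set.mem_inter_iff, Set.mem_preimage, cyl, Set.mem_ofPred_eq, pathShift,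
        Set.mem_empty_iff_false, iff_false, not_and]
      intro h
      have := h 0 (Nat.zero_le _)
      simp at this
      exact absurd this.symm hb
    rw [this, if_neg hb]
    simp

theorem setLIntegral_cyl_pathShift (ω : Env d) (a : Path d) (n : ℕ) {h : Path d → ℝ≥0∞}
    (hh : Measurable h) :
    ∫⁻ X in cyl a n, h (pathShift n X) ∂quenched ω 0
      = quenched ω 0 (cyl a n) * ∫⁻ X, h X ∂quenched (shift (a n) ω) 0 := by
  rw [← lintegral_map hh (measurable_pathShift n), quenched_markov, lintegral_smul_measure,
    smul_eq_mul]

/-- The environment at the endpoint `a n` plays no role. A walk that arrives at a new level is thus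
still independent of the environment on that level. -/
theorem quenched_cyl_congr {ω ω' : Env d} {a : Path d} {n : ℕ}
    (h : ∀ i < n, ω (a i) = ω' (a i)) :
    quenched ω 0 (cyl a n) = quenched ω' 0 (cyl a n) := by
  rw [quenched_cyl, quenched_cyl]
  congr 1
  exact Finset.prod_congr rfl fun i hi => by rw [h i (Finset.mem_range.1 hi)]

/-- The quenched law on paths that stay in `B` only depends on the environment in `B`. -/
theorem quenched_restrict_congr {ω ω' : Env d} {B : Set (Site d)} (h : ∀ x ∈ B, ω x = ω' x) :
    (quenched ω 0).restrict {X | ∀ k, X k ∈ B} = (quenched ω' 0).restrict {X | ∀ k, X k ∈ B} := by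
  have hm : ∀ N : ℕ, MeasurableSet {X : Path d | ∀ k ≤ N, X k ∈ B} := by
    intro N
    have : {X : Path d | ∀ k ≤ N, X k ∈ B} = ⋂ i, ⋂ (_ : i ≤ N), (fun X : Path d => X i) ⁻¹' B := by
      ext X; simp
    rw [this]
    exact MeasurableSet.iInter fun i => MeasurableSet.iInter fun _ =>
      measurable_pi_apply i (MeasurableSet.of_discrete)
  refine measure_ext_cyl fun a n => ?_
  rw [Measure.restrict_apply (measurableSet_cyl _ _), Measure.restrict_apply (measurableSet_cyl _ _)]
  -- Staying in `B` forever is the decreasing limit of staying in `B` up to a finite horizon, where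
  -- the cylinder formula applies.
  have hE : cyl a n ∩ {X | ∀ k, X k ∈ B}
      = ⋂ N : ℕ, cyl a n ∩ {X : Path d | ∀ k ≤ n + N, X k ∈ B} := by
    ext X
    simp only [Set.mem_inter_iff, Set.mem_ofPred_eq, Set.mem_iInter]
    exact ⟨fun h N => ⟨h.1, fun k _ => h.2 k⟩, fun h => ⟨(h 0).1, fun k => (h k).2 k (by omega)⟩⟩
  have hlim : ∀ η : Env d, Tendsto (fun N : ℕ => quenched η 0 (cyl a n ∩ {X : Path d | ∀ k ≤ n + N, X k ∈ B}))
      atTop (nhds (quenched η 0 (cyl a n ∩ {X | ∀ k, X k ∈ B}))) := by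
    intro η
    rw [hE]
    refine tendsto_measure_iInter_atTop
      (fun N => ((measurableSet_cyl a n).inter (hm (n + N))).nullMeasurableSet) ?_
      ⟨0, measure_ne_top _ _⟩
    intro N N' hN X hX
    exact ⟨hX.1, fun k hk => hX.2 k (by omega)⟩
  refine tendsto_nhds_unique (hlim ω) ((hlim ω').congr fun N => ?_)
  have hs := (measurableSet_cyl a n).inter (hm (n + N))
  rw [← lintegral_indicator_one hs, ← lintegral_indicator_one hs]
  refine (lintegral_quenched_congr (n := n + N) ?_ ?_).symm
  · intro X X' hX
    have : X ∈ cyl a n ∩ {X : Path d | ∀ k ≤ n + N, X k ∈ B} ↔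
        X' ∈ cyl a n ∩ {X : Path d | ∀ k ≤ n + N, X k ∈ B} := by
      simp only [Set.mem_inter_iff, cyl, Set.mem_ofPred_eq]
      refine and_congr (forall₂_congr fun i hi => ?_) (forall₂_congr fun i hi => ?_)
      · rw [hX i (by omega)]
      · rw [hX i hi]
    simp only [Set.indicator]
    congr 1
    exact propext this
  · intro b hb
    have hb' := Set.mem_of_indicator_ne_zero hb
    exact quenched_cyl_congr fun i hi => h _ (hb'.2 i hi.le)

theorem quenched_ae_zero (ω : Env d) : ∀ᵐ X ∂quenched ω 0, X 0 = 0 := by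
  have : quenched ω 0 (cyl (fun _ => 0) 0) = 1 := by simp [quenched_cyl]
  filter_upwards [(prob_compl_eq_zero_iff (measurableSet_cyl _ _)).2 this] with X hX
  exact hX 0 le_rfl

/-- Steps of probability zero are almost surely never taken. -/
theorem quenched_ae_step (ω : Env d) :
    ∀ᵐ X ∂quenched ω 0, ∀ n, ω (X n) (X (n + 1) - X n) ≠ 0 := by
  rw [ae_all_iff]
  intro n
  have hs : MeasurableSet {X : Path d | ω (X n) (X (n + 1) - X n) = 0} := by
    have h : Measurable (fun p : Site d × Site d => ω p.1 (p.2 - p.1)) := measurable_of_countable _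
    exact (h.comp (Measurable.prodMk (f := fun X : Path d => X n) (measurable_pi_apply _)
      (measurable_pi_apply (n + 1))))
      (measurableSet_singleton 0)
  rw [ae_iff]
  simp only [not_not]
  rw [← lintegral_indicator_one hs, lintegral_eq_tsum_cyl _ id measurable_id (n + 1),
    ENNReal.tsum_eq_zero]
  intro a
  rw [Set.preimage_id, lintegral_indicator_one hs, Measure.restrict_apply hs]
  by_cases h : ω (extend a n) (extend a (n + 1) - extend a n) = 0
  · refine measure_mono_null Set.inter_subset_right ?_
    rw [quenched_cyl, Finset.prod_range_succ, h]
    simp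
  · have : {X : Path d | ω (X n) (X (n + 1) - X n) = 0} ∩ cyl (extend a) (n + 1) = ∅ := by
      ext X
      simp only [Set.mem_inter_iff, Set.mem_ofPred_eq, cyl, Set.mem_empty_iff_false, iff_false,
        not_and]
      intro h1 h2
      rw [h2 n (by omega), h2 (n + 1) le_rfl] at h1
      exact h h1
    rw [this, measure_empty]

end RWRE

/-! ### Environments restricted to a region, independence, and the joint law of environment and
walk. -/

namespace RWRE

variable {d : ℕ}

open Classical in
/-- The environment `ω` on `B`, with a default value elsewhere. -/
noncomputable def envOn (B : Set (Site d)) (ω : Env d) : Env d :=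
  fun x => if x ∈ B then ω x else PMF.pure 0

theorem envOn_of_mem {B : Set (Site d)} {x : Site d} (h : x ∈ B) (ω : Env d) :
    envOn B ω x = ω x := if_pos h

theorem envOn_congr {B : Set (Site d)} {ω ω' : Env d} (h : ∀ x ∈ B, ω x = ω' x) :
    envOn B ω = envOn B ω' := by
  funext x
  unfold envOn
  split_ifs with hx
  · exact h x hx
  · rfl

/-- The half space `{x : k ≤ x · u}`. -/
def halfSpace (u : Site d) (k : ℤ) : Set (Site d) := {x | k ≤ x ⬝ᵥ u}

theorem mem_halfSpace {u x : Site d} {k : ℤ} : x ∈ halfSpace u k ↔ k ≤ x ⬝ᵥ u := Iff.rfl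

/-- The environment in the half space `{x : k ≤ x · u}`, with a default value elsewhere. -/
noncomputable abbrev cut (u : Site d) (k : ℤ) : Env d → Env d := envOn (halfSpace u k)

theorem cut_cut (u : Site d) {k l : ℤ} (h : k ≤ l) (ω : Env d) :
    cut u l (cut u k ω) = cut u l ω :=
  envOn_congr fun _ hx => envOn_of_mem (h.trans hx) ω

theorem cut_shift (u z : Site d) (k : ℤ) (ω : Env d) :
    cut u k (shift z ω) = shift z (cut u (k + z ⬝ᵥ u) ω) := by
  funext x
  have : x ∈ halfSpace u k ↔ x + z ∈ halfSpace u (k + z ⬝ᵥ u) := by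
    simp [mem_halfSpace, add_dotProduct]
  by_cases h : x ∈ halfSpace u k
  · exact (if_pos h).trans (if_pos (this.1 h)).symm
  · exact (if_neg h).trans (if_neg fun h' => h (this.2 h')).symm

theorem measurable_envOn_cylinderEvents (B : Set (Site d)) :
    @Measurable _ _ (cylinderEvents B) _ (envOn B : Env d → Env d) := by
  refine @measurable_pi_lambda _ _ _ (cylinderEvents B) _ _ fun x => ?_
  unfold envOn
  split_ifs with hx
  · exact measurable_cylinderEvent_apply hx
  · exact measurable_const

theorem measurable_envOn (B : Set (Site d)) : Measurable (envOn B : Env d → Env d) :=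
  (measurable_envOn_cylinderEvents B).mono cylinderEvents_le_pi le_rfl

/-- A functional unchanged by `envOn B` is measurable with respect to the coordinates in `B`, and
coordinates in disjoint sets of sites are independent. -/
theorem lintegral_envOn_mul {P : Measure (Env d)} (hP : IsIIDProduct P) {B C : Set (Site d)}
    (hBC : Disjoint B C) {f g : Env d → ℝ≥0∞} (hf : Measurable f) (hg : Measurable g)
    (hfB : ∀ ω, f (envOn B ω) = f ω) (hgC : ∀ ω, g (envOn C ω) = g ω) :
    ∫⁻ ω, f ω * g ω ∂P = (∫⁻ ω, f ω ∂P) * ∫⁻ ω, g ω ∂P := by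
  obtain ⟨ν, hν, rfl⟩ := hP
  have hind : iIndepFun (fun (x : Site d) (ω : Env d) => ω x)
      (Measure.infinitePi (fun _ : Site d => ν)) :=
    iIndepFun_infinitePi (P := fun _ : Site d => ν) (X := fun _ p => p) fun _ => measurable_id
  have h2 := indep_iSup_of_disjoint (fun x => (measurable_pi_apply x).comap_le) hind hBC
  refine lintegral_mul_eq_lintegral_mul_lintegral_of_independent_measurableSpace
    (Mf := cylinderEvents B) (Mg := cylinderEvents C) cylinderEvents_le_pi cylinderEvents_le_pi
    h2 ?_ ?_
  · rw [← funext hfB]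
    exact hf.comp (measurable_envOn_cylinderEvents B)
  · rw [← funext hgC]
    exact hg.comp (measurable_envOn_cylinderEvents C)

theorem map_shift {P : Measure (Env d)} (hP : IsIIDProduct P) (z : Site d) :
    P.map (shift z) = P := by
  obtain ⟨ν, hν, rfl⟩ := hP
  exact Measure.map_infinitePi_infinitePi_of_inj (P := fun _ : Site d => ν)
    (f := fun x : Site d => x + z) (add_left_injective z)

theorem isProbabilityMeasure_of_isIIDProduct {P : Measure (Env d)} (hP : IsIIDProduct P) :
    IsProbabilityMeasure P := by
  obtain ⟨ν, hν, rfl⟩ := hP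
  infer_instance

theorem lintegral_shift {P : Measure (Env d)} (hP : IsIIDProduct P) (z : Site d)
    {f : Env d → ℝ≥0∞} (hf : Measurable f) : ∫⁻ ω, f (shift z ω) ∂P = ∫⁻ ω, f ω ∂P := by
  conv_rhs => rw [← map_shift hP z]
  rw [lintegral_map hf (measurable_shift z)]

/-- Environments all of whose steps are at most `M` long. -/
def boundedEnv (d : ℕ) (M : ℝ) : Set (Env d) := {ω | ∀ x z, M < euclNorm z → ω x z = 0}

theorem ae_mem_boundedEnv {P : Measure (Env d)} (hP : IsIIDProduct P) {M : ℝ}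
    (hS : BoundedSteps P M) : ∀ᵐ ω ∂P, ω ∈ boundedEnv d M := by
  have := isProbabilityMeasure_of_isIIDProduct hP
  simp only [boundedEnv, Set.mem_ofPred_eq]
  rw [ae_all_iff]
  intro x
  rw [ae_all_iff]
  intro z
  by_cases hz : M < euclNorm z
  · have hs : MeasurableSet {ω : Env d | ω 0 z = 0} := measurable_weight 0 z (measurableSet_singleton 0)
    have h : ∀ᵐ ω ∂P, ω 0 z = 0 := (prob_compl_eq_zero_iff hs).2 (hS z hz)
    rw [← map_shift hP x] at h
    filter_upwards [ae_of_ae_map (measurable_shift x).aemeasurable h] with ω hω _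
    simpa [shift] using hω
  · simp [hz]

theorem measurable_theta_aux (n : ℕ) :
    Measurable (fun y : Env d × Path d => shift (y.2 n) y.1) := by
  have h : Measurable (fun q : Env d × Site d => shift q.2 q.1) :=
    measurable_from_prod_countable_left fun z => measurable_shift z
  exact h.comp (measurable_fst.prodMk ((measurable_pi_apply n).comp measurable_snd))

/-- Environment and path, seen from the position of the walk at time `n`. -/
def theta (n : ℕ) (y : Env d × Path d) : Env d × Path d := (shift (y.2 n) y.1, pathShift n y.2)

theorem measurable_theta (n : ℕ) : Measurable (theta n : Env d × Path d → Env d × Path d) :=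
  (measurable_theta_aux n).prodMk ((measurable_pathShift n).comp measurable_snd)

theorem theta_theta (m n : ℕ) (y : Env d × Path d) : theta n (theta m y) = theta (m + n) y := by
  refine Prod.ext ?_ ?_
  · funext x
    simp only [theta, shift, pathShift]
    rw [add_assoc, sub_add_cancel]
  · funext k
    simp only [theta, pathShift, add_assoc]
    rw [sub_sub_sub_cancel_right]

/-- The joint law of environment and walk started at the origin. -/
noncomputable def joint (μ : Measure (Env d)) : Measure (Env d × Path d) :=
  μ ⊗ₘ quenchedKernel 0

instance (μ : Measure (Env d)) [IsProbabilityMeasure μ] : IsProbabilityMeasure (joint μ) := by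
  unfold joint; infer_instance

theorem lintegral_joint (μ : Measure (Env d)) [SFinite μ] {F : Env d × Path d → ℝ≥0∞}
    (hF : Measurable F) : ∫⁻ y, F y ∂joint μ = ∫⁻ ω, ∫⁻ X, F (ω, X) ∂quenched ω 0 ∂μ :=
  Measure.lintegral_compProd hF

theorem ae_joint (μ : Measure (Env d)) [SFinite μ] {p : Env d × Path d → Prop}
    (hp : MeasurableSet {y | p y}) (h : ∀ᵐ ω ∂μ, ∀ᵐ X ∂quenched ω 0, p (ω, X)) :
    ∀ᵐ y ∂joint μ, p y :=
  (Measure.ae_compProd_iff hp).2 h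

theorem averaged_eq_map (μ : Measure (Env d)) [SFinite μ] :
    averaged μ 0 = (joint μ).map Prod.snd :=
  (Measure.snd_compProd μ (quenchedKernel 0)).symm

theorem lintegral_joint_fst (μ : Measure (Env d)) [SFinite μ] {f : Env d → ℝ≥0∞}
    (hf : Measurable f) : ∫⁻ y, f y.1 ∂joint μ = ∫⁻ ω, f ω ∂μ := by
  rw [lintegral_joint μ (F := fun y => f y.1) (hf.comp measurable_fst)]
  simp

/-- Decomposition of the joint law along the first `n` steps. -/
theorem lintegral_joint_theta (μ : Measure (Env d)) [SFinite μ] (n : ℕ)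
    {Φ Ψ : Env d × Path d → ℝ≥0∞} (hΦ : Measurable Φ) (hΨ : Measurable Ψ)
    (hdep : ∀ ω X X', (∀ i ≤ n, X i = X' i) → Φ (ω, X) = Φ (ω, X')) :
    ∫⁻ y, Φ y * Ψ (theta n y) ∂joint μ
      = ∑' a : Fin (n + 1) → Site d, ∫⁻ ω, Φ (ω, extend a) * quenched ω 0 (cyl (extend a) n)
          * ∫⁻ X, Ψ (shift (extend a n) ω, X) ∂quenched (shift (extend a n) ω) 0 ∂μ := by
  have hm : Measurable fun y => Φ y * Ψ (theta n y) := hΦ.mul (hΨ.comp (measurable_theta n))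
  rw [lintegral_eq_tsum_cyl _ Prod.snd measurable_snd n]
  refine tsum_congr fun a => ?_
  have hc : MeasurableSet (Prod.snd ⁻¹' cyl (extend a) n : Set (Env d × Path d)) :=
    measurable_snd (measurableSet_cyl _ _)
  rw [← lintegral_indicator hc, lintegral_joint _ (hm.indicator hc)]
  refine lintegral_congr fun ω => ?_
  have h1 : ∀ X, (Prod.snd ⁻¹' cyl (extend a) n : Set (Env d × Path d)).indicator
      (fun y => Φ y * Ψ (theta n y)) (ω, X) = (cyl (extend a) n).indicator
      (fun X => Φ (ω, extend a) * Ψ (shift (extend a n) ω, pathShift n X)) X := by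
    intro X
    by_cases hX : X ∈ cyl (extend a) n
    · rw [Set.indicator_of_mem hX, Set.indicator_of_mem (by exact hX)]
      rw [hdep ω X _ hX]
      simp only [theta]
      rw [hX n le_rfl]
    · rw [Set.indicator_of_notMem hX, Set.indicator_of_notMem (by exact hX)]
  simp only [h1]
  have h2 : Measurable fun X => Ψ (shift (extend a n) ω, X) := hΨ.comp measurable_prodMk_left
  have h3 : Measurable fun X => Ψ (shift (extend a n) ω, pathShift n X) :=
    h2.comp (measurable_pathShift n)
  rw [lintegral_indicator (measurableSet_cyl _ _), lintegral_const_mul _ h3,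
    setLIntegral_cyl_pathShift _ _ _ h2, mul_assoc]

end RWRE

/-! ### Records, regenerations, and independence of past and future. -/

namespace RWRE

variable {d : ℕ}

theorem measurable_level (u : Site d) (k : ℕ) : Measurable fun X : Path d => X k ⬝ᵥ u :=
  (measurable_of_countable fun z : Site d => z ⬝ᵥ u).comp (measurable_pi_apply k)

/-- Paths that never go below level zero. -/
def stays (u : Site d) : Set (Path d) := {X | ∀ k, 0 ≤ X k ⬝ᵥ u}

/-- The walk is at time `n` at a strict record level. -/
def IsRecord (u : Site d) (X : Path d) (n : ℕ) : Prop := ∀ k < n, X k ⬝ᵥ u < X n ⬝ᵥ u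

theorem measurableSet_stays (u : Site d) : MeasurableSet (stays u) := by
  simp only [stays, measurableSet_setOfPred]
  exact Measurable.forall fun k =>
    measurableSet_setOfPred.1 (measurableSet_le measurable_const (measurable_level u k))

theorem measurableSet_isRecord (u : Site d) (n : ℕ) : MeasurableSet {X : Path d | IsRecord u X n} := by
  simp only [IsRecord, measurableSet_setOfPred]
  exact Measurable.forall fun k => Measurable.forall fun _ =>
    measurableSet_setOfPred.1 (measurableSet_lt (measurable_level u k) (measurable_level u n))

/-- The record condition concerns the past only and the other one the future only; independence is
applied to this pair. -/
theorem isRegeneration_iff {u : Site d} {X : Path d} {n : ℕ} :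
    IsRegeneration u X n ↔ (1 ≤ n ∧ IsRecord u X n) ∧ pathShift n X ∈ stays u := by
  simp only [IsRegeneration, IsRecord, stays, pathShift, Set.mem_ofPred_eq, sub_dotProduct,
    sub_nonneg, and_assoc]
  refine and_congr_right fun _ => and_congr_right fun _ => ⟨fun h k => h _ (by omega), fun h k hk => ?_⟩
  have := h (k - n)
  rwa [Nat.add_sub_cancel' hk] at this

theorem measurableSet_isRegeneration (u : Site d) (n : ℕ) :
    MeasurableSet {X : Path d | IsRegeneration u X n} := by
  simp only [isRegeneration_iff]
  exact ((MeasurableSet.const _).inter (measurableSet_isRecord u n)).inter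
    (measurable_pathShift n (measurableSet_stays u))

/-- `Φ` depends only on the path up to time `n` and the environment strictly below the level
reached at time `n`. -/
def DependsOnPast (u : Site d) (n : ℕ) (Φ : Env d × Path d → ℝ≥0∞) : Prop :=
  ∀ ω ω' X X', (∀ i ≤ n, X i = X' i) → (∀ x, x ⬝ᵥ u < X n ⬝ᵥ u → ω x = ω' x) →
    Φ (ω, X) = Φ (ω', X')

theorem measurable_lintegral_quenched {F : Env d × Path d → ℝ≥0∞} (hF : Measurable F) :
    Measurable fun ω => ∫⁻ X, F (ω, X) ∂quenched ω 0 :=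
  Measurable.lintegral_kernel_prod_right' (κ := quenchedKernel 0) hF

theorem measurable_quenched_cyl (a : Path d) (n : ℕ) :
    Measurable fun ω : Env d => quenched ω 0 (cyl a n) :=
  Kernel.measurable_coe (quenchedKernel 0) (measurableSet_cyl a n)

/-- A path that stays at nonnegative levels never reads the environment below level zero. Hence the
quenched mean of such a `Ψ` is itself a functional of the environment in the half space. -/
theorem lintegral_quenched_cut {u : Site d} {Ψ : Env d × Path d → ℝ≥0∞}
    (hcut : ∀ ω X, Ψ (cut u 0 ω, X) = Ψ (ω, X)) (hstay : ∀ ω X, Ψ (ω, X) ≠ 0 → X ∈ stays u)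
    (ω : Env d) :
    ∫⁻ X, Ψ (cut u 0 ω, X) ∂quenched (cut u 0 ω) 0 = ∫⁻ X, Ψ (ω, X) ∂quenched ω 0 := by
  simp only [hcut]
  have h1 : ∀ η : Env d, ∫⁻ X, Ψ (ω, X) ∂quenched η 0 = ∫⁻ X in stays u, Ψ (ω, X) ∂quenched η 0 := by
    intro η
    rw [← lintegral_indicator (measurableSet_stays u)]
    refine lintegral_congr fun X => ?_
    by_cases hX : X ∈ stays u
    · rw [Set.indicator_of_mem hX]
    · rw [Set.indicator_of_notMem hX]
      by_contra h
      exact hX (hstay ω X h)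
  rw [h1, h1]
  have h2 := quenched_restrict_congr (ω := cut u 0 ω) (ω' := ω) (B := halfSpace u 0)
    fun x hx => envOn_of_mem hx ω
  have h3 : {X : Path d | ∀ k, X k ∈ halfSpace u 0} = stays u := rfl
  rw [h3] at h2
  rw [h2]

/-- At a record time the past and a future that stays above the record are independent. -/
theorem lintegral_past_mul_future {P : Measure (Env d)} (hP : IsIIDProduct P) (u : Site d) (n : ℕ)
    {Φ Ψ : Env d × Path d → ℝ≥0∞} (hΦ : Measurable Φ) (hΨ : Measurable Ψ)
    (hdep : DependsOnPast u n Φ) (hrec : ∀ ω X, Φ (ω, X) ≠ 0 → IsRecord u X n)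
    (hcut : ∀ ω X, Ψ (cut u 0 ω, X) = Ψ (ω, X)) (hstay : ∀ ω X, Ψ (ω, X) ≠ 0 → X ∈ stays u) :
    ∫⁻ y, Φ y * Ψ (theta n y) ∂joint P = (∫⁻ y, Φ y ∂joint P) * ∫⁻ y, Ψ y ∂joint P := by
  have := isProbabilityMeasure_of_isIIDProduct hP
  have hdep' : ∀ ω X X', (∀ i ≤ n, X i = X' i) → Φ (ω, X) = Φ (ω, X') :=
    fun ω X X' h => hdep ω ω X X' h fun _ _ => rfl
  have hone := lintegral_joint_theta P n hΦ (measurable_const (a := (1 : ℝ≥0∞))) hdep'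
  simp only [mul_one, lintegral_const, measure_univ] at hone
  rw [lintegral_joint_theta P n hΦ hΨ hdep', hone, ← ENNReal.tsum_mul_right]
  refine tsum_congr fun a => ?_
  have hF := measurable_lintegral_quenched hΨ
  rw [lintegral_joint P hΨ, ← lintegral_shift hP (extend a n) hF]
  -- At a record all earlier sites lie strictly below level `X_n`, while the future stays at or
  -- above it.
  have hdisj : Disjoint {x : Site d | x ⬝ᵥ u < extend a n ⬝ᵥ u} (halfSpace u (extend a n ⬝ᵥ u)) := by
    rw [Set.disjoint_left]
    intro x hx hx'
    exact not_le.2 (show x ⬝ᵥ u < _ from hx) (mem_halfSpace.1 hx')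
  refine lintegral_envOn_mul hP hdisj
    ((hΦ.comp measurable_prodMk_right).mul (measurable_quenched_cyl _ _))
    (hF.comp (measurable_shift _)) ?_ ?_
  · intro ω
    have h1 : Φ (envOn {x : Site d | x ⬝ᵥ u < extend a n ⬝ᵥ u} ω, extend a) = Φ (ω, extend a) :=
      hdep _ _ _ _ (fun _ _ => rfl) fun x hx => envOn_of_mem hx ω
    simp only [h1]
    by_cases h0 : Φ (ω, extend a) = 0
    · rw [h0, zero_mul, zero_mul]
    · rw [quenched_cyl_congr fun i hi => envOn_of_mem (hrec _ _ h0 i hi) ω]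
  · intro ω
    have h := lintegral_quenched_cut hcut hstay
    show ∫⁻ X, Ψ (shift (extend a n) _, X) ∂quenched (shift (extend a n) _) 0 = _
    rw [← h, cut_shift, zero_add, cut_cut _ le_rfl, ← zero_add (extend a n ⬝ᵥ u), ← cut_shift, h]

/-- The law of environment and walk conditioned on never going below level zero. -/
noncomputable def condJoint (P : Measure (Env d)) (u : Site d) : Measure (Env d × Path d) :=
  (joint P)[|{y | y.2 ∈ stays u}]

/-- Regeneration property of a law `ρ` of environment and walk. -/
def IsRegenerative (P : Measure (Env d)) (u : Site d) (ρ : Measure (Env d × Path d)) : Prop :=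
  ∀ (n : ℕ) (Φ Ψ : Env d × Path d → ℝ≥0∞), Measurable Φ → Measurable Ψ → DependsOnPast u n Φ →
    (∀ ω X, X ∈ stays u → Ψ (cut u 0 ω, X) = Ψ (ω, X)) →
    ∫⁻ y in {y | IsRegeneration u y.2 n}, Φ y * Ψ (theta n y) ∂ρ
      = (∫⁻ y in {y | IsRegeneration u y.2 n}, Φ y ∂ρ) * ∫⁻ y, Ψ y ∂condJoint P u

theorem measurableSet_stays' (u : Site d) : MeasurableSet {y : Env d × Path d | y.2 ∈ stays u} :=
  measurable_snd (measurableSet_stays u)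

theorem measurableSet_isRegeneration' (u : Site d) (n : ℕ) :
    MeasurableSet {y : Env d × Path d | IsRegeneration u y.2 n} :=
  measurable_snd (measurableSet_isRegeneration u n)

theorem lintegral_condJoint (P : Measure (Env d)) (u : Site d) (F : Env d × Path d → ℝ≥0∞) :
    ∫⁻ y, F y ∂condJoint P u
      = (joint P {y | y.2 ∈ stays u})⁻¹ * ∫⁻ y in {y | y.2 ∈ stays u}, F y ∂joint P := by
  rw [condJoint, ProbabilityTheory.cond, lintegral_smul_measure, smul_eq_mul]

theorem setLIntegral_isRegeneration {P : Measure (Env d)} (hP : IsIIDProduct P) (u : Site d)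
    (n : ℕ) {Φ Ψ : Env d × Path d → ℝ≥0∞} (hΦ : Measurable Φ) (hΨ : Measurable Ψ)
    (hdep : DependsOnPast u n Φ) (hcut : ∀ ω X, X ∈ stays u → Ψ (cut u 0 ω, X) = Ψ (ω, X)) :
    ∫⁻ y in {y | IsRegeneration u y.2 n}, Φ y * Ψ (theta n y) ∂joint P
      = (∫⁻ y in {y | 1 ≤ n ∧ IsRecord u y.2 n}, Φ y ∂joint P)
        * ∫⁻ y in {y | y.2 ∈ stays u}, Ψ y ∂joint P := by
  have hA : MeasurableSet {y : Env d × Path d | 1 ≤ n ∧ IsRecord u y.2 n} :=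
    (MeasurableSet.const _).inter (measurable_snd (measurableSet_isRecord u n))
  have hB := measurableSet_stays' u
  rw [← lintegral_indicator (measurableSet_isRegeneration' u n), ← lintegral_indicator hA,
    ← lintegral_indicator hB, ← lintegral_past_mul_future hP u n (hΦ.indicator hA) (hΨ.indicator hB)]
  · refine lintegral_congr fun y => ?_
    by_cases h1 : 1 ≤ n ∧ IsRecord u y.2 n
    · by_cases h2 : pathShift n y.2 ∈ stays u
      · rw [Set.indicator_of_mem (by exact isRegeneration_iff.2 ⟨h1, h2⟩),
          Set.indicator_of_mem (by exact h1), Set.indicator_of_mem (by exact h2)]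
      · rw [Set.indicator_of_notMem (by exact fun h => h2 (isRegeneration_iff.1 h).2),
          Set.indicator_of_notMem (s := {y : Env d × Path d | y.2 ∈ stays u}) (by exact h2), mul_zero]
    · rw [Set.indicator_of_notMem (by exact fun h => h1 (isRegeneration_iff.1 h).1),
          Set.indicator_of_notMem (s := {y : Env d × Path d | 1 ≤ n ∧ IsRecord u y.2 n})
            (by exact h1), zero_mul]
  · intro ω ω' X X' hX hω
    have h : (1 ≤ n ∧ IsRecord u X n) ↔ (1 ≤ n ∧ IsRecord u X' n) := by
      refine and_congr_right fun _ => forall₂_congr fun k hk => ?_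
      rw [hX k hk.le, hX n le_rfl]
    by_cases h1 : 1 ≤ n ∧ IsRecord u X n
    · rw [Set.indicator_of_mem (by exact h1), Set.indicator_of_mem (by exact h.1 h1)]
      exact hdep ω ω' X X' hX hω
    · rw [Set.indicator_of_notMem (by exact h1), Set.indicator_of_notMem (by exact fun h' => h1 (h.2 h'))]
  · exact fun ω X h => (Set.mem_of_indicator_ne_zero h).2
  · intro ω X
    by_cases h : X ∈ stays u
    · rw [Set.indicator_of_mem (by exact h), Set.indicator_of_mem (by exact h), hcut ω X h]
    · rw [Set.indicator_of_notMem (by exact h), Set.indicator_of_notMem (by exact h)]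
  · intro ω X h
    by_contra hX
    exact h (Set.indicator_of_notMem (by exact hX) _)

theorem isRegenerative_joint {P : Measure (Env d)} (hP : IsIIDProduct P) (u : Site d) :
    IsRegenerative P u (joint P) := by
  have := isProbabilityMeasure_of_isIIDProduct hP
  intro n Φ Ψ hΦ hΨ hdep hcut
  have h1 := setLIntegral_isRegeneration hP u n hΦ (measurable_const (a := (1 : ℝ≥0∞))) hdep
    fun _ _ _ => rfl
  simp only [mul_one, lintegral_const, Measure.restrict_apply MeasurableSet.univ, Set.univ_inter,
    one_mul] at h1
  rw [setLIntegral_isRegeneration hP u n hΦ hΨ hdep hcut, h1, lintegral_condJoint, mul_assoc]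
  congr 1
  -- If the conditioning event is null, both sides vanish.
  by_cases h0 : joint P {y | y.2 ∈ stays u} = 0
  · rw [setLIntegral_measure_zero _ _ h0]; simp
  · rw [← mul_assoc, ENNReal.mul_inv_cancel h0 (measure_ne_top _ _), one_mul]

/-- After a regeneration the walk stays above `X_n`, so whether it ever goes below zero is decided
by time `n`. The conditioning only reweights the past. -/
theorem isRegenerative_condJoint {P : Measure (Env d)} (hP : IsIIDProduct P) (u : Site d) :
    IsRegenerative P u (condJoint P u) := by
  intro n Φ Ψ hΦ hΨ hdep hcut
  have hA : MeasurableSet {y : Env d × Path d | ∀ k ≤ n, 0 ≤ y.2 k ⬝ᵥ u} := by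
    rw [measurableSet_setOfPred]
    exact Measurable.forall fun k => Measurable.forall fun _ => measurableSet_setOfPred.1
      (measurableSet_le measurable_const ((measurable_level u k).comp measurable_snd))
  have hset : {y : Env d × Path d | IsRegeneration u y.2 n} ∩ {y | y.2 ∈ stays u}
      = {y | ∀ k ≤ n, 0 ≤ y.2 k ⬝ᵥ u} ∩ {y | IsRegeneration u y.2 n} := by
    ext y
    simp only [Set.mem_inter_iff, Set.mem_ofPred_eq, stays]
    constructor
    · exact fun h => ⟨fun k _ => h.2 k, h.1⟩
    · refine fun h => ⟨h.2, fun k => ?_⟩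
      rcases le_total k n with hk | hk
      · exact h.1 k hk
      · exact (h.1 n le_rfl).trans (h.2.2.2 k hk)
  have key : ∀ F : Env d × Path d → ℝ≥0∞, ∫⁻ y in {y | IsRegeneration u y.2 n}, F y ∂condJoint P u
      = (joint P {y | y.2 ∈ stays u})⁻¹ * ∫⁻ y in {y | IsRegeneration u y.2 n},
        {y | ∀ k ≤ n, 0 ≤ y.2 k ⬝ᵥ u}.indicator F y ∂joint P := by
    intro F
    rw [← lintegral_indicator (measurableSet_isRegeneration' u n), lintegral_condJoint,
      setLIntegral_indicator (measurableSet_isRegeneration' u n),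
      setLIntegral_indicator hA, hset]
  rw [key, key, mul_assoc, ← isRegenerative_joint hP u n _ Ψ (hΦ.indicator hA) hΨ ?_ hcut]
  · congr 1
    refine lintegral_congr fun y => ?_
    rw [Set.indicator_mul_left]
  · intro ω ω' X X' hX hω
    have h : (∀ k ≤ n, 0 ≤ X k ⬝ᵥ u) ↔ (∀ k ≤ n, 0 ≤ X' k ⬝ᵥ u) :=
      forall₂_congr fun k hk => by rw [hX k hk]
    by_cases h1 : ∀ k ≤ n, 0 ≤ X k ⬝ᵥ u
    · rw [Set.indicator_of_mem (by exact h1), Set.indicator_of_mem (by exact h.1 h1)]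
      exact hdep ω ω' X X' hX hω
    · rw [Set.indicator_of_notMem (by exact h1), Set.indicator_of_notMem (by exact fun h' => h1 (h.2 h'))]

end RWRE

/-! ### The first regeneration beyond a given level. -/

namespace RWRE

variable {d : ℕ}

/-- `n` is the first regeneration time at which the walk is more than `r` above its level at
time `m`. -/
def IsFirst (u : Site d) (m r n : ℕ) (X : Path d) : Prop :=
  (IsRegeneration u X n ∧ X m ⬝ᵥ u + r < X n ⬝ᵥ u) ∧
    ∀ j < n, ¬ (IsRegeneration u X j ∧ X m ⬝ᵥ u + r < X j ⬝ᵥ u)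

/-- The first regeneration time at which the walk is more than `r` above its level at time `m`. -/
noncomputable def firstTime (u : Site d) (m r : ℕ) (X : Path d) : ℝ≥0∞ :=
  ⨅ (n : ℕ) (_ : IsRegeneration u X n ∧ X m ⬝ᵥ u + r < X n ⬝ᵥ u), (n : ℝ≥0∞)

theorem firstTime_le {u : Site d} {m r n : ℕ} {X : Path d} (h : IsRegeneration u X n)
    (h' : X m ⬝ᵥ u + r < X n ⬝ᵥ u) : firstTime u m r X ≤ n :=
  iInf₂_le n ⟨h, h'⟩

theorem IsFirst.firstTime_eq {u : Site d} {m r n : ℕ} {X : Path d} (h : IsFirst u m r n X) :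
    firstTime u m r X = n := by
  refine le_antisymm (firstTime_le h.1.1 h.1.2) (le_iInf₂ fun j hj => ?_)
  by_contra hlt
  rw [not_le, Nat.cast_lt] at hlt
  exact h.2 j hlt hj

theorem exists_isFirst {u : Site d} {m r : ℕ} {X : Path d} (h : firstTime u m r X ≠ ⊤) :
    ∃ n, IsFirst u m r n X := by
  classical
  have h' : ∃ n, IsRegeneration u X n ∧ X m ⬝ᵥ u + r < X n ⬝ᵥ u := by
    by_contra hne
    push Not at hne
    refine h (iInf₂_eq_top.2 fun n hn => absurd hn.2 (not_lt.2 (hne n hn.1)))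
  exact ⟨Nat.find h', Nat.find_spec h', fun j hj => Nat.find_min h' hj⟩

theorem IsFirst.unique {u : Site d} {m r n n' : ℕ} {X : Path d} (h : IsFirst u m r n X)
    (h' : IsFirst u m r n' X) : n = n' := by
  have := h.firstTime_eq.symm.trans h'.firstTime_eq
  exact_mod_cast this

theorem firstTime_zero (u : Site d) (X : Path d) : firstTime u 0 0 X = regenTime u X := by
  unfold firstTime regenTime
  refine iInf_congr fun n => iInf_congr_Prop ⟨fun h => h.1, fun h => ⟨h, ?_⟩⟩ fun _ => rfl
  simpa using h.2.1 0 h.1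

theorem measurableSet_isFirst (u : Site d) (m r n : ℕ) :
    MeasurableSet {y : Env d × Path d | IsFirst u m r n y.2} := by
  have h : ∀ j, MeasurableSet {y : Env d × Path d | IsRegeneration u y.2 j ∧ y.2 m ⬝ᵥ u + r < y.2 j ⬝ᵥ u} :=
    fun j => (measurableSet_isRegeneration' u j).inter
      (measurableSet_lt (((measurable_level u m).comp measurable_snd).add measurable_const)
        ((measurable_level u j).comp measurable_snd))
  refine (h n).inter ?_
  refine measurableSet_setOfPred.2 ?_
  exact Measurable.forall fun j => Measurable.forall fun _ => (measurableSet_setOfPred.1 (h j)).not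

theorem measurable_firstTime (u : Site d) (m r : ℕ) :
    Measurable fun y : Env d × Path d => firstTime u m r y.2 := by
  have h : ∀ j, MeasurableSet {y : Env d × Path d | IsRegeneration u y.2 j ∧ y.2 m ⬝ᵥ u + r < y.2 j ⬝ᵥ u} :=
    fun j => (measurableSet_isRegeneration' u j).inter
      (measurableSet_lt (((measurable_level u m).comp measurable_snd).add measurable_const)
        ((measurable_level u j).comp measurable_snd))
  classical
  have h2 : (fun y : Env d × Path d => firstTime u m r y.2) = fun y => ⨅ n : ℕ,
      if IsRegeneration u y.2 n ∧ y.2 m ⬝ᵥ u + r < y.2 n ⬝ᵥ u then (n : ℝ≥0∞) else ⊤ := by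
    funext y
    unfold firstTime
    refine iInf_congr fun n => ?_
    rw [iInf_eq_if]
  rw [h2]
  exact Measurable.iInf fun n => Measurable.ite (h n) measurable_const measurable_const

theorem lintegral_isFirst {u : Site d} {m r : ℕ} {ρ : Measure (Env d × Path d)}
    (h : ∀ᵐ y ∂ρ, firstTime u m r y.2 ≠ ⊤) (G : Env d × Path d → ℝ≥0∞) :
    ∫⁻ y, G y ∂ρ = ∑' n, ∫⁻ y in {y | IsFirst u m r n y.2}, G y ∂ρ := by
  rw [← lintegral_iUnion (measurableSet_isFirst u m r)]
  · have : (⋃ n, {y : Env d × Path d | IsFirst u m r n y.2}) =ᵐ[ρ] Set.univ := by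
      refine eventuallyEq_univ.2 ?_
      filter_upwards [h] with y hy
      exact Set.mem_iUnion.2 (exists_isFirst hy)
    rw [setLIntegral_congr this, Measure.restrict_univ]
  · intro n n' hn
    rw [Function.onFun, Set.disjoint_left]
    exact fun y hy hy' => hn (IsFirst.unique hy hy')

theorem tsum_measure_isFirst {u : Site d} {m r : ℕ} {ρ : Measure (Env d × Path d)}
    [IsProbabilityMeasure ρ] (h : ∀ᵐ y ∂ρ, firstTime u m r y.2 ≠ ⊤) :
    ∑' n, ρ {y | IsFirst u m r n y.2} = 1 := by
  have := lintegral_isFirst h (fun _ => 1)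
  simpa using this.symm

theorem measure_isFirst_zero (u : Site d) (m r : ℕ) (ρ : Measure (Env d × Path d)) :
    ρ {y | IsFirst u m r 0 y.2} = 0 := by
  have : {y : Env d × Path d | IsFirst u m r 0 y.2} = ∅ := by
    ext y
    simp only [Set.mem_ofPred_eq, Set.mem_empty_iff_false, iff_false]
    intro h
    have := h.1.1.1
    omega
  rw [this, measure_empty]

/-- Once `n` is a regeneration, an earlier `j` is one as soon as the path stays at or above `X_j`
until time `n`. Hence being the first is an event of the past, the set `S` below. The indicator in
`hdep` lets `Φ` look up to `r` levels ahead of `X_m`: on that event those levels are still below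
`X_n`. -/
theorem IsRegenerative.setLIntegral_isFirst {P : Measure (Env d)} {u : Site d}
    {ρ : Measure (Env d × Path d)} (hρ : IsRegenerative P u ρ) (m r n : ℕ)
    {Φ Ψ : Env d × Path d → ℝ≥0∞} (hΦ : Measurable Φ) (hΨ : Measurable Ψ)
    (hdep : DependsOnPast u n (fun y => {y | m < n ∧ y.2 m ⬝ᵥ u + r < y.2 n ⬝ᵥ u}.indicator Φ y))
    (hcut : ∀ ω X, X ∈ stays u → Ψ (cut u 0 ω, X) = Ψ (ω, X)) :
    ∫⁻ y in {y | IsFirst u m r n y.2}, Φ y * Ψ (theta n y) ∂ρ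
      = (∫⁻ y in {y | IsFirst u m r n y.2}, Φ y ∂ρ) * ∫⁻ y, Ψ y ∂condJoint P u := by
  let S : Set (Env d × Path d) := {y | (m < n ∧ y.2 m ⬝ᵥ u + r < y.2 n ⬝ᵥ u) ∧ ∀ j < n,
    ¬ ((1 ≤ j ∧ IsRecord u y.2 j ∧ ∀ k, j ≤ k → k < n → y.2 j ⬝ᵥ u ≤ y.2 k ⬝ᵥ u) ∧
      y.2 m ⬝ᵥ u + r < y.2 j ⬝ᵥ u)}
  have hl : ∀ k, Measurable fun y : Env d × Path d => y.2 k ⬝ᵥ u :=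
    fun k => (measurable_level u k).comp measurable_snd
  have hl' : ∀ j, MeasurableSet {y : Env d × Path d | y.2 m ⬝ᵥ u + r < y.2 j ⬝ᵥ u} :=
    fun j => measurableSet_lt ((hl m).add measurable_const) (hl j)
  have hS : MeasurableSet S := by
    refine ((MeasurableSet.const _).inter (hl' n)).inter ?_
    refine measurableSet_setOfPred.2 ?_
    refine Measurable.forall fun j => Measurable.forall fun _ => Measurable.not ?_
    refine measurableSet_setOfPred.1 ?_
    refine ((MeasurableSet.const _).inter ((measurable_snd (measurableSet_isRecord u j)).inter ?_)).inter (hl' j)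
    refine measurableSet_setOfPred.2 ?_
    exact Measurable.forall fun k => Measurable.forall fun _ => Measurable.forall fun _ =>
      measurableSet_setOfPred.1 (measurableSet_le (hl j) (hl k))
  have hset : {y : Env d × Path d | IsFirst u m r n y.2}
      = S ∩ {y | IsRegeneration u y.2 n} := by
    ext ⟨ω, X⟩
    simp only [IsFirst, S, Set.mem_inter_iff, Set.mem_ofPred_eq]
    constructor
    · rintro ⟨⟨h1, h2⟩, h3⟩
      refine ⟨⟨⟨?_, h2⟩, ?_⟩, h1⟩
      · by_contra hmn
        have := h1.2.2 m (by omega)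
        omega
      · rintro j hj ⟨⟨h4, h5, h6⟩, h7⟩
        refine h3 j hj ⟨⟨h4, h5, fun k hk => ?_⟩, h7⟩
        rcases lt_or_ge k n with hkn | hkn
        · exact h6 k hk hkn
        · exact (h1.2.1 j hj).le.trans (h1.2.2 k hkn)
    · rintro ⟨⟨⟨-, h2⟩, h3⟩, h1⟩
      exact ⟨⟨h1, h2⟩, fun j hj h => h3 j hj ⟨⟨h.1.1, h.1.2.1, fun k hk _ => h.1.2.2 k hk⟩, h.2⟩⟩
  rw [hset, ← setLIntegral_indicator hS, ← setLIntegral_indicator hS,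
    ← hρ n _ Ψ (hΦ.indicator hS) hΨ ?_ hcut]
  · refine lintegral_congr fun y => ?_
    rw [Set.indicator_mul_left]
  · intro ω ω' X X' hX hω
    have h0 := hdep ω ω' X X' hX hω
    have h : ((ω, X) ∈ S) ↔ ((ω', X') ∈ S) := by
      simp only [S, Set.mem_ofPred_eq, IsRecord]
      by_cases hmn : m < n
      · rw [hX m hmn.le, hX n le_rfl]
        refine and_congr_right fun _ => forall₂_congr fun j hj => ?_
        rw [hX j hj.le]
        refine not_congr (and_congr_left fun _ => and_congr_right fun _ => and_congr ?_ ?_)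
        · exact forall₂_congr fun k hk => by rw [hX k (by omega)]
        · exact forall₃_congr fun k hk hk' => by rw [hX k (by omega)]
      · simp [hmn]
    by_cases h1 : (ω, X) ∈ S
    · rw [Set.indicator_of_mem h1, Set.indicator_of_mem (h.1 h1)]
      simp only at h0
      rwa [Set.indicator_of_mem (by exact h1.1), Set.indicator_of_mem (by exact (h.1 h1).1)] at h0
    · rw [Set.indicator_of_notMem h1, Set.indicator_of_notMem fun h' => h1 (h.2 h')]

theorem IsRegenerative.setLIntegral_isFirst_future {P : Measure (Env d)} {u : Site d}
    {ρ : Measure (Env d × Path d)} (hρ : IsRegenerative P u ρ) (m r n : ℕ)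
    {Ψ : Env d × Path d → ℝ≥0∞} (hΨ : Measurable Ψ)
    (hcut : ∀ ω X, X ∈ stays u → Ψ (cut u 0 ω, X) = Ψ (ω, X)) :
    ∫⁻ y in {y | IsFirst u m r n y.2}, Ψ (theta n y) ∂ρ
      = ρ {y | IsFirst u m r n y.2} * ∫⁻ y, Ψ y ∂condJoint P u := by
  have := hρ.setLIntegral_isFirst m r n (Φ := fun _ => 1) measurable_const hΨ ?_ hcut
  · simpa using this
  · intro ω ω' X X' hX _
    by_cases hmn : m < n
    · simp only [Set.indicator, Set.mem_ofPred_eq]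
      rw [hX m hmn.le, hX n le_rfl]
    · simp [hmn]

theorem IsRegeneration.of_pathShift {u : Site d} {X : Path d} {n j : ℕ} (h : IsRegeneration u X n)
    (h' : IsRegeneration u (pathShift n X) j) : IsRegeneration u X (n + j) := by
  simp only [IsRegeneration, pathShift, sub_dotProduct, sub_lt_sub_iff_right,
    sub_le_sub_iff_right] at h'
  refine ⟨by have := h.1; omega, fun k hk => ?_, fun k hk => ?_⟩
  · rcases lt_or_ge k n with hkn | hkn
    · exact (h.2.1 k hkn).trans (h'.2.1 0 h'.1)
    · have := h'.2.1 (k - n) (by omega)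
      rwa [Nat.add_sub_cancel' hkn] at this
  · have := h'.2.2 (k - n) (by omega)
    rwa [Nat.add_sub_cancel' (by omega)] at this

/-- A regeneration of the restarted path is one of the whole path, and `hr` says that the restarted
path aims at least as high. -/
theorem firstTime_le_add {u : Site d} {X : Path d} {n m m' r r' : ℕ} (h : IsRegeneration u X n)
    (hr : X m ⬝ᵥ u + r ≤ X (n + m') ⬝ᵥ u + r') :
    firstTime u m r X ≤ n + firstTime u m' r' (pathShift n X) := by
  by_cases ht : firstTime u m' r' (pathShift n X) = ⊤
  · simp [ht]
  · obtain ⟨j, hj⟩ := exists_isFirst ht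
    rw [hj.firstTime_eq, ← Nat.cast_add]
    refine firstTime_le (h.of_pathShift hj.1.1) ?_
    have := hj.1.2
    simp only [pathShift, sub_dotProduct] at this
    omega

end RWRE

/-! ### Moments of regeneration times, and domination by sums over one block. -/

namespace RWRE

variable {d : ℕ}

/-- An i.i.d. environment in which the first regeneration time is square integrable. -/
structure HasRegenSecondMoment (P : Measure (Env d)) (u : Site d) : Prop where
  iid : IsIIDProduct P
  sq : ∫⁻ y, regenTime u y.2 ^ 2 ∂joint P ≠ ⊤

theorem measurable_regenTime (u : Site d) :
    Measurable fun y : Env d × Path d => regenTime u y.2 := by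
  simp only [← firstTime_zero]
  exact measurable_firstTime u 0 0

theorem one_le_regenTime (u : Site d) (X : Path d) : 1 ≤ regenTime u X :=
  le_iInf₂ fun n hn => by exact_mod_cast hn.1

theorem regenTime_le_sq (u : Site d) (X : Path d) : regenTime u X ≤ regenTime u X ^ 2 := by
  rw [pow_two]
  exact le_mul_of_one_le_left' (one_le_regenTime u X)

theorem condJoint_absolutelyContinuous (P : Measure (Env d)) (u : Site d) :
    condJoint P u ≪ joint P := cond_absolutelyContinuous

theorem ae_condJoint_stays (P : Measure (Env d)) (u : Site d) :
    ∀ᵐ y ∂condJoint P u, y.2 ∈ stays u :=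
  ae_cond_mem (measurableSet_stays' u)

namespace HasRegenSecondMoment

variable {P : Measure (Env d)} {u : Site d} (hP : HasRegenSecondMoment P u)

include hP

theorem isProbabilityMeasure : IsProbabilityMeasure P := isProbabilityMeasure_of_isIIDProduct hP.iid

theorem ae_joint_ne_top : ∀ᵐ y ∂joint P, firstTime u 0 0 y.2 ≠ ⊤ := by
  filter_upwards [ae_lt_top ((measurable_regenTime u).pow_const 2) hP.sq] with y hy h
  rw [firstTime_zero] at h
  simp [h] at hy

/-- Otherwise, by independence at records, almost surely no time would be a regeneration, although
`τ₁` is almost surely finite. -/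
theorem joint_stays_ne_zero : joint P {y | y.2 ∈ stays u} ≠ 0 := by
  have := hP.isProbabilityMeasure
  intro h0
  have h : ∀ n, joint P {y | IsRegeneration u y.2 n} = 0 := by
    intro n
    have := setLIntegral_isRegeneration hP.iid u n (measurable_const (a := (1 : ℝ≥0∞)))
      (measurable_const (a := (1 : ℝ≥0∞))) (fun _ _ _ _ _ _ => rfl) fun _ _ _ => rfl
    simpa [h0] using this
  have h1 := tsum_measure_isFirst hP.ae_joint_ne_top
  rw [ENNReal.tsum_eq_zero.2 fun n => measure_mono_null (fun y hy => hy.1.1) (h n)] at h1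
  exact zero_ne_one h1

theorem isProbabilityMeasure_condJoint : IsProbabilityMeasure (condJoint P u) :=
  have := hP.isProbabilityMeasure
  cond_isProbabilityMeasure hP.joint_stays_ne_zero

theorem lintegral_condJoint_ne_top {F : Env d × Path d → ℝ≥0∞} (hF : ∫⁻ y, F y ∂joint P ≠ ⊤) :
    ∫⁻ y, F y ∂condJoint P u ≠ ⊤ := by
  rw [lintegral_condJoint]
  exact ENNReal.mul_ne_top (ENNReal.inv_ne_top.2 hP.joint_stays_ne_zero)
    (ne_top_of_le_ne_top hF (setLIntegral_le_lintegral _ _))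

theorem ae_condJoint_ne_top : ∀ᵐ y ∂condJoint P u, firstTime u 0 0 y.2 ≠ ⊤ :=
  (condJoint_absolutelyContinuous P u).ae_le hP.ae_joint_ne_top

theorem lintegral_regenTime_joint : ∫⁻ y, regenTime u y.2 ∂joint P ≠ ⊤ :=
  ne_top_of_le_ne_top hP.sq (lintegral_mono fun y => regenTime_le_sq u y.2)

theorem lintegral_regenTime_condJoint : ∫⁻ y, regenTime u y.2 ∂condJoint P u ≠ ⊤ :=
  hP.lintegral_condJoint_ne_top hP.lintegral_regenTime_joint

omit hP in
theorem lintegral_regenTime_add {ρ : Measure (Env d × Path d)} [IsProbabilityMeasure ρ]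
    (hρ : IsRegenerative P u ρ) (hfin : ∀ᵐ y ∂ρ, firstTime u 0 0 y.2 ≠ ⊤)
    {Ψ : Env d × Path d → ℝ≥0∞} (hΨ : Measurable Ψ)
    (hcut : ∀ ω X, X ∈ stays u → Ψ (cut u 0 ω, X) = Ψ (ω, X)) :
    ∑' n, ∫⁻ y in {y | IsFirst u 0 0 n y.2}, (n + Ψ (theta n y)) ∂ρ
      = ∫⁻ y, regenTime u y.2 ∂ρ + ∫⁻ y, Ψ y ∂condJoint P u := by
  have h1 : ∀ n : ℕ, ∫⁻ y in {y | IsFirst u 0 0 n y.2}, ((n : ℝ≥0∞) + Ψ (theta n y)) ∂ρ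
      = ∫⁻ y in {y | IsFirst u 0 0 n y.2}, regenTime u y.2 ∂ρ
        + ρ {y | IsFirst u 0 0 n y.2} * ∫⁻ y, Ψ y ∂condJoint P u := by
    intro n
    rw [lintegral_add_left measurable_const, hρ.setLIntegral_isFirst_future 0 0 n hΨ hcut]
    congr 1
    refine setLIntegral_congr_fun (measurableSet_isFirst u 0 0 n) fun y hy => ?_
    rw [← firstTime_zero, IsFirst.firstTime_eq hy]
  simp only [h1]
  rw [ENNReal.tsum_add, ENNReal.tsum_mul_right, tsum_measure_isFirst hfin, one_mul,
    ← lintegral_isFirst hfin]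

omit hP in
-- The first regeneration gains at least one level, so a further gain of more than `r` is enough.
theorem lintegral_firstTime_succ_le {ρ : Measure (Env d × Path d)} [IsProbabilityMeasure ρ]
    (hρ : IsRegenerative P u ρ) (hfin : ∀ᵐ y ∂ρ, firstTime u 0 0 y.2 ≠ ⊤) (r : ℕ) :
    ∫⁻ y, firstTime u 0 (r + 1) y.2 ∂ρ
      ≤ ∫⁻ y, regenTime u y.2 ∂ρ + ∫⁻ y, firstTime u 0 r y.2 ∂condJoint P u := by
  rw [← lintegral_regenTime_add hρ hfin (measurable_firstTime u 0 r) fun _ _ _ => rfl,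
    lintegral_isFirst hfin]
  refine ENNReal.tsum_le_tsum fun n => setLIntegral_mono' (measurableSet_isFirst u 0 0 n) ?_
  intro y hy
  refine firstTime_le_add hy.1.1 ?_
  have := hy.1.2
  push_cast
  simp only [add_zero] at this ⊢
  have h : ((0 : ℕ) : ℤ) = 0 := rfl
  omega

theorem lintegral_firstTime_condJoint (r : ℕ) :
    ∫⁻ y, firstTime u 0 r y.2 ∂condJoint P u ≠ ⊤ := by
  have := hP.isProbabilityMeasure_condJoint
  induction r with
  | zero => simpa only [firstTime_zero] using hP.lintegral_regenTime_condJoint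
  | succ r ih =>
    exact ne_top_of_le_ne_top (ENNReal.add_ne_top.2 ⟨hP.lintegral_regenTime_condJoint, ih⟩)
      (lintegral_firstTime_succ_le (isRegenerative_condJoint hP.iid u) hP.ae_condJoint_ne_top r)

theorem lintegral_firstTime_joint (r : ℕ) : ∫⁻ y, firstTime u 0 r y.2 ∂joint P ≠ ⊤ := by
  have := hP.isProbabilityMeasure
  cases r with
  | zero => simpa only [firstTime_zero] using hP.lintegral_regenTime_joint
  | succ r =>
    exact ne_top_of_le_ne_top (ENNReal.add_ne_top.2 ⟨hP.lintegral_regenTime_joint,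
      hP.lintegral_firstTime_condJoint r⟩)
      (lintegral_firstTime_succ_le (isRegenerative_joint hP.iid u) hP.ae_joint_ne_top r)

theorem ae_joint_firstTime_ne_top : ∀ᵐ y ∂joint P, ∀ m r, firstTime u m r y.2 ≠ ⊤ := by
  have h : ∀ᵐ y ∂joint P, ∀ r, firstTime u 0 r y.2 < ⊤ :=
    ae_all_iff.2 fun r => ae_lt_top (measurable_firstTime u 0 r) (hP.lintegral_firstTime_joint r)
  filter_upwards [h] with y hy m r
  -- A regeneration this far above `X_0` is more than `r` above `X_m`.
  obtain ⟨n, hn⟩ := exists_isFirst (hy (r + (y.2 m ⬝ᵥ u - y.2 0 ⬝ᵥ u).toNat)).ne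
  refine ne_top_of_le_ne_top (ENNReal.natCast_ne_top n) (firstTime_le hn.1.1 ?_)
  have := hn.1.2
  push_cast at this
  omega

end HasRegenSecondMoment

/-- The sum of `V` over the times before the first regeneration. -/
noncomputable def blockSum (u : Site d) (V : ℕ → Env d × Path d → ℝ≥0∞) (y : Env d × Path d) :
    ℝ≥0∞ :=
  ∑' m : ℕ, {y : Env d × Path d | (m : ℝ≥0∞) < regenTime u y.2}.indicator (V m) y

theorem sum_range_le_blockSum {u : Site d} {V : ℕ → Env d × Path d → ℝ≥0∞} {y : Env d × Path d}
    {n : ℕ} (h : IsFirst u 0 0 n y.2) : ∑ m ∈ Finset.range n, V m y ≤ blockSum u V y := by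
  refine le_trans (Finset.sum_le_sum fun m hm => ?_) (ENNReal.sum_le_tsum (Finset.range n))
  rw [Set.indicator_of_mem]
  rw [Set.mem_ofPred_eq, ← firstTime_zero, h.firstTime_eq, Nat.cast_lt]
  exact Finset.mem_range.1 hm

theorem measurable_blockSum (u : Site d) {V : ℕ → Env d × Path d → ℝ≥0∞}
    (hV : ∀ m, Measurable (V m)) : Measurable (blockSum u V) :=
  Measurable.tsum fun m =>
    (hV m).indicator (measurableSet_lt measurable_const (measurable_regenTime u))

theorem blockSum_le_mul {u : Site d} {V : ℕ → Env d × Path d → ℝ≥0∞} {y : Env d × Path d}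
    {W : ℝ≥0∞} (hfin : regenTime u y.2 ≠ ⊤) (h : ∀ m : ℕ, (m : ℝ≥0∞) < regenTime u y.2 → V m y ≤ W) :
    blockSum u V y ≤ regenTime u y.2 * W := by
  rw [← firstTime_zero] at hfin
  obtain ⟨n, hn⟩ := exists_isFirst hfin
  have h2 := hn.firstTime_eq
  rw [firstTime_zero] at h2
  unfold blockSum
  rw [tsum_eq_sum (s := Finset.range n), h2]
  · refine (Finset.sum_le_card_nsmul _ _ W fun m hm => ?_).trans (by simp)
    rw [Set.indicator]
    split_ifs with hm'
    · exact h m hm'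
    · exact zero_le
  · intro m hm
    rw [Set.indicator_of_notMem]
    rw [Finset.mem_range] at hm
    rw [Set.mem_ofPred_eq, h2, Nat.cast_lt]
    exact hm

section domination

variable {P : Measure (Env d)} {u : Site d} {V : ℕ → Env d × Path d → ℝ≥0∞}

/-- By `hshift`, forgetting the path before a regeneration can only increase `V`. The sum is
therefore at most the sum over the first block plus a fresh sum under `condJoint` over the remaining
steps. -/
theorem sum_lintegral_le_of_regenerative {ρ : Measure (Env d × Path d)} [IsProbabilityMeasure ρ]
    (hρ : IsRegenerative P u ρ) (hfin : ∀ᵐ y ∂ρ, firstTime u 0 0 y.2 ≠ ⊤)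
    (hV : ∀ m, Measurable (V m)) (hcut : ∀ m ω X, X ∈ stays u → V m (cut u 0 ω, X) = V m (ω, X))
    (hshift : ∀ n m y, IsRegeneration u y.2 n → n ≤ m → V m y ≤ V (m - n) (theta n y)) (N : ℕ) :
    ∑ m ∈ Finset.range N, ∫⁻ y, V m y ∂ρ ≤ ∫⁻ y, blockSum u V y ∂ρ
      + ∑' n, ρ {y | IsFirst u 0 0 n y.2} *
        ∑ m ∈ Finset.range (N - n), ∫⁻ y, V m y ∂condJoint P u := by
  have h1 : ∀ n, ∫⁻ y in {y | IsFirst u 0 0 n y.2},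
      ∑ m ∈ Finset.range (N - n), V m (theta n y) ∂ρ = ρ {y | IsFirst u 0 0 n y.2} *
        ∑ m ∈ Finset.range (N - n), ∫⁻ y, V m y ∂condJoint P u := by
    intro n
    rw [← lintegral_finsetSum _ fun m _ => hV m]
    refine hρ.setLIntegral_isFirst_future 0 0 n
      (Ψ := fun y => ∑ m ∈ Finset.range (N - n), V m y)
      (Finset.measurable_fun_sum _ fun m _ => hV m) ?_
    exact fun ω X hX => Finset.sum_congr rfl fun m _ => hcut m ω X hX
  simp only [← h1]
  rw [← lintegral_finsetSum _ fun m _ => hV m, lintegral_isFirst hfin,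
    lintegral_isFirst hfin (blockSum u V), ← ENNReal.tsum_add]
  refine ENNReal.tsum_le_tsum fun n => ?_
  rw [← lintegral_add_left (measurable_blockSum u hV)]
  refine setLIntegral_mono' (measurableSet_isFirst u 0 0 n) fun y hy => ?_
  calc ∑ m ∈ Finset.range N, V m y ≤ ∑ m ∈ Finset.range (n + (N - n)), V m y :=
        Finset.sum_le_sum_of_subset (Finset.range_mono (by omega))
    _ = ∑ m ∈ Finset.range n, V m y + ∑ m ∈ Finset.range (N - n), V (n + m) y :=
        Finset.sum_range_add _ _ _
    _ ≤ _ := by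
        refine add_le_add (sum_range_le_blockSum hy) (Finset.sum_le_sum fun m _ => ?_)
        have := hshift n (n + m) y hy.1.1 (by omega)
        rwa [Nat.add_sub_cancel_left] at this

/-- Sums of a subadditive functional are dominated by its mean over one regeneration block. -/
theorem sum_lintegral_condJoint_le (hP : HasRegenSecondMoment P u)
    (hV : ∀ m, Measurable (V m)) (hcut : ∀ m ω X, X ∈ stays u → V m (cut u 0 ω, X) = V m (ω, X))
    (hshift : ∀ n m y, IsRegeneration u y.2 n → n ≤ m → V m y ≤ V (m - n) (theta n y)) (N : ℕ) :
    ∑ m ∈ Finset.range N, ∫⁻ y, V m y ∂condJoint P u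
      ≤ N * ∫⁻ y, blockSum u V y ∂condJoint P u := by
  have := hP.isProbabilityMeasure_condJoint
  induction N using Nat.strong_induction_on with
  | _ N ih =>
    rcases Nat.eq_zero_or_pos N with rfl | hN
    · simp
    refine (sum_lintegral_le_of_regenerative (isRegenerative_condJoint hP.iid u)
      hP.ae_condJoint_ne_top hV hcut hshift N).trans ?_
    -- A block has length at least one, so at most `N - 1` steps remain; the first block supplies
    -- the missing summand.
    have h2 : ∑' n, condJoint P u {y | IsFirst u 0 0 n y.2} *
        ∑ m ∈ Finset.range (N - n), ∫⁻ y, V m y ∂condJoint P u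
        ≤ ∑' n, condJoint P u {y | IsFirst u 0 0 n y.2} *
          ((N - 1 : ℕ) * ∫⁻ y, blockSum u V y ∂condJoint P u) := by
      refine ENNReal.tsum_le_tsum fun n => ?_
      rcases Nat.eq_zero_or_pos n with rfl | hn
      · simp [measure_isFirst_zero]
      · refine mul_le_mul_right ((ih (N - n) (by omega)).trans ?_) _
        refine mul_le_mul_left ?_ _
        exact_mod_cast (by omega : N - n ≤ N - 1)
    rw [ENNReal.tsum_mul_right, tsum_measure_isFirst hP.ae_condJoint_ne_top, one_mul] at h2
    refine (add_le_add_right h2 _).trans (le_of_eq ?_)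
    obtain ⟨N, rfl⟩ := Nat.exists_eq_add_of_lt hN
    simp only [zero_add, Nat.add_sub_cancel]
    push_cast
    ring

theorem sum_lintegral_joint_le (hP : HasRegenSecondMoment P u)
    (hV : ∀ m, Measurable (V m)) (hcut : ∀ m ω X, X ∈ stays u → V m (cut u 0 ω, X) = V m (ω, X))
    (hshift : ∀ n m y, IsRegeneration u y.2 n → n ≤ m → V m y ≤ V (m - n) (theta n y)) (N : ℕ) :
    ∑ m ∈ Finset.range N, ∫⁻ y, V m y ∂joint P
      ≤ ∫⁻ y, blockSum u V y ∂joint P + N * ∫⁻ y, blockSum u V y ∂condJoint P u := by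
  have := hP.isProbabilityMeasure
  refine (sum_lintegral_le_of_regenerative (isRegenerative_joint hP.iid u)
    hP.ae_joint_ne_top hV hcut hshift N).trans (add_le_add_right ?_ _)
  have h2 : ∑' n, joint P {y | IsFirst u 0 0 n y.2} *
      ∑ m ∈ Finset.range (N - n), ∫⁻ y, V m y ∂condJoint P u
      ≤ ∑' n, joint P {y | IsFirst u 0 0 n y.2} *
        (N * ∫⁻ y, blockSum u V y ∂condJoint P u) := by
    refine ENNReal.tsum_le_tsum fun n => mul_le_mul_right
      ((sum_lintegral_condJoint_le hP hV hcut hshift (N - n)).trans (mul_le_mul_left ?_ _)) _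
    exact_mod_cast Nat.sub_le N n
  rwa [ENNReal.tsum_mul_right, tsum_measure_isFirst hP.ae_joint_ne_top, one_mul] at h2

end domination

end RWRE

/-! ### The renewal theorem and the occupation measure of one block. -/

namespace RWRE

/-- Elementary renewal theorem. -/
theorem tendsto_div_of_renewal {p b c : ℕ → ℝ} {μ l : ℝ} (hp : ∀ s, 0 ≤ p s) (hp0 : p 0 = 0)
    (hsum : HasSum p 1) (hμ : HasSum (fun s : ℕ => p s * s) μ) (hμ0 : 0 < μ)
    (hb : ∀ N : ℕ, |b N| ≤ N) (hren : ∀ N, b N = c N + ∑' s, p s * b (N - s))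
    (hc : Tendsto c atTop (nhds l)) :
    Tendsto (fun N : ℕ => b N / N) atTop (nhds (l / μ)) := by
  set v := l / μ with hv
  let t : ℕ → ℝ := fun N => ∑' s, p s * (min s N : ℕ)
  have ht : Tendsto t atTop (nhds μ) := by
    rw [← hμ.tsum_eq]
    refine tendsto_tsum_of_dominated_convergence (bound := fun s => p s * s) hμ.summable ?_ ?_
    · intro s
      refine tendsto_const_nhds.congr' ?_
      filter_upwards [eventually_ge_atTop s] with N hN
      rw [min_eq_left hN]
    · filter_upwards with N s
      rw [Real.norm_of_nonneg (mul_nonneg (hp s) (Nat.cast_nonneg _))]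
      exact mul_le_mul_of_nonneg_left (by exact_mod_cast min_le_left s N) (hp s)
  -- The deviation `e` from linear growth satisfies the same renewal equation with `D` in place of
  -- `c`, and `D` tends to zero by the choice of `v`.
  let e : ℕ → ℝ := fun N => b N - v * N
  let D : ℕ → ℝ := fun N => c N - v * t N
  have hD : Tendsto (fun N => |D N|) atTop (nhds 0) := by
    have h := (hc.sub (ht.const_mul v)).abs
    rwa [hv, div_mul_cancel₀ _ hμ0.ne', sub_self, abs_zero] at h
  have hsb : ∀ (g : ℕ → ℝ) (K : ℝ), (∀ s, |g s| ≤ K) → Summable fun s => p s * g s := by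
    intro g K hg
    refine Summable.of_norm_bounded (g := fun s => p s * K) (hsum.summable.mul_right K) fun s => ?_
    rw [Real.norm_eq_abs, abs_mul, abs_of_nonneg (hp s)]
    exact mul_le_mul_of_nonneg_left (hg s) (hp s)
  have he : ∀ N, e N = D N + ∑' s, p s * e (N - s) := by
    intro N
    have h1 : Summable fun s => p s * b (N - s) := hsb _ N fun s =>
      (hb _).trans (by exact_mod_cast Nat.sub_le N s)
    have h2 : Summable fun s => p s * ((N - s : ℕ) : ℝ) := hsb _ N fun s => by
      rw [abs_of_nonneg (Nat.cast_nonneg _)]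
      exact_mod_cast Nat.sub_le N s
    have h3 : Summable fun s => p s * ((min s N : ℕ) : ℝ) := hsb _ N fun s => by
      rw [abs_of_nonneg (Nat.cast_nonneg _)]
      exact_mod_cast min_le_right s N
    -- Subtraction is truncated, so `(N - s) + min s N = N` also for `s > N`.
    have h4 : ∑' s, p s * ((N - s : ℕ) : ℝ) + t N = N := by
      simp only [t]
      rw [← h2.tsum_add h3]
      have : ∀ s, p s * ((N - s : ℕ) : ℝ) + p s * ((min s N : ℕ) : ℝ) = p s * N := by
        intro s
        rw [← mul_add, ← Nat.cast_add]
        congr 2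
        omega
      simp only [this]
      rw [tsum_mul_right, hsum.tsum_eq, one_mul]
    have h5 : ∑' s, p s * e (N - s) = ∑' s, p s * b (N - s) - v * ∑' s, p s * ((N - s : ℕ) : ℝ) := by
      rw [← tsum_mul_left, ← h1.tsum_sub (h2.mul_left v)]
      refine tsum_congr fun s => ?_
      simp only [e]
      ring
    rw [h5]
    simp only [e, D]
    rw [hren N]
    linear_combination v * h4
  -- Since `p 0 = 0`, the renewal term is an average of earlier values, all bounded by the sum over
  -- `j < N`. The bound divided by `N` is then a Cesàro mean of a null sequence.
  have hbound : ∀ N, |e N| ≤ ∑ j ∈ Finset.range (N + 1), |D j| := by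
    intro N
    induction N using Nat.strong_induction_on with
    | _ N ih =>
      rcases Nat.eq_zero_or_pos N with rfl | hN
      · have h0 : b 0 = 0 := by simpa using hb 0
        simp [e, h0]
      rw [he N, Finset.sum_range_succ, add_comm]
      refine (abs_add_le _ _).trans (add_le_add_left ?_ _)
      have h6 : ∀ s, |p s * e (N - s)| ≤ p s * ∑ j ∈ Finset.range N, |D j| := by
        intro s
        rw [abs_mul, abs_of_nonneg (hp s)]
        rcases Nat.eq_zero_or_pos s with rfl | hs
        · simp [hp0]
        · refine mul_le_mul_of_nonneg_left ((ih (N - s) (by omega)).trans ?_) (hp s)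
          exact Finset.sum_le_sum_of_subset_of_nonneg (Finset.range_mono (by omega))
            fun _ _ _ => abs_nonneg _
      have h7 := tsum_of_norm_bounded (f := fun s => p s * e (N - s)) (hsum.mul_right (∑ j ∈ Finset.range N, |D j|)) h6
      rwa [one_mul, Real.norm_eq_abs] at h7
  have hlim : Tendsto (fun N : ℕ => e N / N) atTop (nhds 0) := by
    have h8 : Tendsto (fun N : ℕ => (N : ℝ)⁻¹ * ∑ j ∈ Finset.range N, |D j| + (N : ℝ)⁻¹ * |D N|)
        atTop (nhds 0) := by
      have := hD.cesaro.add (tendsto_inv_atTop_nhds_zero_nat.mul hD)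
      simpa using this
    refine squeeze_zero_norm (fun N => ?_) h8
    rw [Real.norm_eq_abs, abs_div, Nat.abs_cast, div_eq_inv_mul, ← mul_add,
      ← Finset.sum_range_succ]
    exact mul_le_mul_of_nonneg_left (hbound N) (by positivity)
  have := hlim.add_const v
  rw [zero_add] at this
  refine this.congr' ?_
  filter_upwards [eventually_gt_atTop 0] with N hN
  have : (N : ℝ) ≠ 0 := by exact_mod_cast hN.ne'
  simp only [e]
  field_simp
  ring

variable {d : ℕ}

/-- `f` evaluated at the environment seen from the particle at time `n`. -/
def seen (f : Env d → ℝ≥0∞) (n : ℕ) (y : Env d × Path d) : ℝ≥0∞ := f (shift (y.2 n) y.1)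

theorem measurable_seen {f : Env d → ℝ≥0∞} (hf : Measurable f) (n : ℕ) : Measurable (seen f n) :=
  hf.comp (measurable_theta_aux n)

theorem seen_theta (f : Env d → ℝ≥0∞) (m n : ℕ) (y : Env d × Path d) :
    seen f n (theta m y) = seen f (m + n) y :=
  congrArg f (congrArg Prod.fst (theta_theta m n y))

/-- `seen f n`, when the walk is at level at least `r`. -/
noncomputable def visit (u : Site d) (f : Env d → ℝ≥0∞) (r n : ℕ) : Env d × Path d → ℝ≥0∞ :=
  {y : Env d × Path d | (r : ℤ) ≤ y.2 n ⬝ᵥ u}.indicator (seen f n)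

theorem measurable_visit (u : Site d) {f : Env d → ℝ≥0∞} (hf : Measurable f) (r n : ℕ) :
    Measurable (visit u f r n) :=
  (measurable_seen hf n).indicator
    (measurableSet_le measurable_const ((measurable_level u n).comp measurable_snd))

theorem visit_le_seen (u : Site d) (f : Env d → ℝ≥0∞) (r n : ℕ) (y : Env d × Path d) :
    visit u f r n y ≤ seen f n y := Set.indicator_le_self _ _ _

/-- At level at least `r`, looking `r` levels back does not reach below zero. Restricting to such
visits makes them functionals of the future alone after a regeneration. -/
theorem visit_cut {u : Site d} {f : Env d → ℝ≥0∞} {r : ℕ} (hf : ∀ ω, f (cut u (-r) ω) = f ω)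
    (n : ℕ) (ω : Env d) (X : Path d) : visit u f r n (cut u 0 ω, X) = visit u f r n (ω, X) := by
  by_cases h : (r : ℤ) ≤ X n ⬝ᵥ u
  · unfold visit
    rw [Set.indicator_of_mem (by exact h), Set.indicator_of_mem (by exact h)]
    simp only [seen]
    rw [← hf, cut_shift, cut_cut _ (by omega), ← cut_shift, hf]
  · unfold visit
    rw [Set.indicator_of_notMem (by exact h), Set.indicator_of_notMem (by exact h)]

/-- Visits at time `n` to level at least `r` that are not of this kind for the walk restarted
at its first regeneration time. -/
def initialSet (u : Site d) (r n : ℕ) : Set (Env d × Path d) :=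
  {y | (r : ℤ) ≤ y.2 n ⬝ᵥ u ∧
    ∃ s, IsFirst u 0 0 s y.2 ∧ (n < s ∨ y.2 n ⬝ᵥ u < y.2 s ⬝ᵥ u + r)}

theorem measurableSet_initialSet (u : Site d) (r n : ℕ) :
    MeasurableSet (initialSet u r n : Set (Env d × Path d)) := by
  have hl : ∀ k, Measurable fun y : Env d × Path d => y.2 k ⬝ᵥ u :=
    fun k => (measurable_level u k).comp measurable_snd
  refine (measurableSet_le measurable_const (hl n)).inter ?_
  refine measurableSet_setOfPred.2 ?_
  exact Measurable.exists fun s => measurableSet_setOfPred.1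
    ((measurableSet_isFirst u 0 0 s).inter ((MeasurableSet.const _).union
      (measurableSet_lt (hl n) ((hl s).add measurable_const))))

/-- The restarted walk counts the times `n ≥ s` with `X_n` at least `r` above `X_s`. As `X_s` has
nonnegative level, these are also visits of the original walk; the other visits form `initialSet`.
-/
theorem visit_eq_add {u : Site d} (f : Env d → ℝ≥0∞) {r s : ℕ} {y : Env d × Path d}
    (hy : IsFirst u 0 0 s y.2) (hs : y.2 ∈ stays u) (n : ℕ) :
    visit u f r n y = (initialSet u r n).indicator (seen f n) y
      + if s ≤ n then visit u f r (n - s) (theta s y) else 0 := by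
  have hmem : y ∈ initialSet u r n ↔
      (r : ℤ) ≤ y.2 n ⬝ᵥ u ∧ (n < s ∨ y.2 n ⬝ᵥ u < y.2 s ⬝ᵥ u + r) := by
    refine and_congr_right fun _ => ⟨?_, fun h => ⟨s, hy, h⟩⟩
    rintro ⟨s', hs', h⟩
    rwa [hy.unique hs']
  by_cases hn : s ≤ n
  · rw [if_pos hn]
    have hlev : (theta s y).2 (n - s) ⬝ᵥ u = y.2 n ⬝ᵥ u - y.2 s ⬝ᵥ u := by
      simp only [theta, pathShift, sub_dotProduct]
      rw [Nat.add_sub_cancel' hn]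
    have hseen : seen f (n - s) (theta s y) = seen f n y := by
      rw [seen_theta, Nat.add_sub_cancel' hn]
    have h0 := hs s
    unfold visit
    simp only [Set.indicator, Set.mem_ofPred_eq, hmem, hlev, hseen]
    by_cases h1 : (r : ℤ) ≤ y.2 n ⬝ᵥ u
    · by_cases h2 : y.2 n ⬝ᵥ u < y.2 s ⬝ᵥ u + r
      · rw [if_pos h1, if_pos ⟨h1, Or.inr h2⟩, if_neg (by omega), add_zero]
      · rw [if_pos h1, if_neg (by omega), if_pos (by omega), zero_add]
    · rw [if_neg h1, if_neg (by omega), if_neg (by omega), zero_add]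
  · rw [if_neg hn, add_zero]
    unfold visit
    simp only [Set.indicator, Set.mem_ofPred_eq, hmem]
    by_cases h1 : (r : ℤ) ≤ y.2 n ⬝ᵥ u
    · rw [if_pos h1, if_pos ⟨h1, Or.inl (by omega)⟩]
    · rw [if_neg h1, if_neg (by omega)]

theorem sum_range_ite_sub {M : Type*} [AddCommMonoid M] (g : ℕ → M) (N s : ℕ) :
    ∑ n ∈ Finset.range N, (if s ≤ n then g (n - s) else 0) = ∑ j ∈ Finset.range (N - s), g j := by
  rcases le_total s N with h | h
  · obtain ⟨k, rfl⟩ := Nat.exists_eq_add_of_le h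
    rw [Finset.sum_range_add, Nat.add_sub_cancel_left, Finset.sum_eq_zero, zero_add]
    · exact Finset.sum_congr rfl fun j _ => by rw [if_pos (by omega), Nat.add_sub_cancel_left]
    · intro n hn
      rw [if_neg]
      have := Finset.mem_range.1 hn
      omega
  · rw [Nat.sub_eq_zero_of_le h, Finset.range_zero, Finset.sum_empty]
    refine Finset.sum_eq_zero fun n hn => if_neg ?_
    have := Finset.mem_range.1 hn
    omega

theorem sum_range_lt_le (N k : ℕ) :
    ∑ n ∈ Finset.range N, (if n < k then (1 : ℝ≥0∞) else 0) ≤ k := by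
  rw [← Finset.sum_filter, Finset.sum_const, nsmul_one]
  have : (Finset.range N).filter (· < k) ⊆ Finset.range k := by
    intro n hn
    exact Finset.mem_range.2 (Finset.mem_filter.1 hn).2
  exact_mod_cast (Finset.card_le_card this).trans (by simp)

/-- After a regeneration above level `r` the walk never returns below `r`. -/
theorem sum_range_below_le {u : Site d} {X : Path d} (h0 : 0 ≤ X 0 ⬝ᵥ u) (r N : ℕ) :
    ∑ n ∈ Finset.range N, (if X n ⬝ᵥ u < r then (1 : ℝ≥0∞) else 0) ≤ firstTime u 0 r X := by
  by_cases ht : firstTime u 0 r X = ⊤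
  · simp [ht]
  · obtain ⟨k, hk⟩ := exists_isFirst ht
    rw [hk.firstTime_eq]
    refine le_trans (Finset.sum_le_sum fun n _ => ?_) (sum_range_lt_le N k)
    by_cases h1 : n < k
    · rw [if_pos h1]
      split_ifs <;> simp
    · have := hk.1.1.2.2 n (by omega)
      have := hk.1.2
      rw [if_neg (by omega)]
      exact zero_le

section renewal

variable {P : Measure (Env d)} {u : Site d}

/-- The renewal equation for the expected number of visits: after the first regeneration the count
starts afresh, with the same law. -/
theorem sum_visit_renewal (hP : HasRegenSecondMoment P u) {f : Env d → ℝ≥0∞} (hf : Measurable f)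
    {r : ℕ} (hcut : ∀ ω, f (cut u (-r) ω) = f ω) (N : ℕ) :
    ∑ n ∈ Finset.range N, ∫⁻ y, visit u f r n y ∂condJoint P u
      = ∑ n ∈ Finset.range N, ∫⁻ y in initialSet u r n, seen f n y ∂condJoint P u
        + ∑' s, condJoint P u {y | IsFirst u 0 0 s y.2} *
          ∑ n ∈ Finset.range (N - s), ∫⁻ y, visit u f r n y ∂condJoint P u := by
  have hm : ∀ n, Measurable (visit u f r n) := measurable_visit u hf r
  have hm' : ∀ n, Measurable ((initialSet u r n).indicator (seen f n)) := fun n =>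
    (measurable_seen hf n).indicator (measurableSet_initialSet u r n)
  have h1 : ∀ s, condJoint P u {y | IsFirst u 0 0 s y.2} *
      ∑ n ∈ Finset.range (N - s), ∫⁻ y, visit u f r n y ∂condJoint P u
      = ∫⁻ y in {y | IsFirst u 0 0 s y.2},
        ∑ n ∈ Finset.range (N - s), visit u f r n (theta s y) ∂condJoint P u := by
    intro s
    rw [← lintegral_finsetSum _ fun n _ => hm n]
    refine ((isRegenerative_condJoint hP.iid u).setLIntegral_isFirst_future 0 0 s
      (Ψ := fun y => ∑ n ∈ Finset.range (N - s), visit u f r n y)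
      (Finset.measurable_fun_sum _ fun n _ => hm n) ?_).symm
    exact fun ω X _ => Finset.sum_congr rfl fun n _ => visit_cut hcut n ω X
  simp only [h1, ← lintegral_indicator (measurableSet_initialSet u r _)]
  rw [← lintegral_finsetSum _ fun n _ => hm n, ← lintegral_finsetSum _ fun n _ => hm' n,
    lintegral_isFirst hP.ae_condJoint_ne_top, lintegral_isFirst hP.ae_condJoint_ne_top
      (fun y => ∑ n ∈ Finset.range N, (initialSet u r n).indicator (seen f n) y),
    ← ENNReal.tsum_add]
  refine tsum_congr fun s => ?_
  rw [← lintegral_add_left (Finset.measurable_fun_sum _ fun n _ => hm' n)]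
  refine lintegral_congr_ae ?_
  filter_upwards [ae_restrict_of_ae (ae_condJoint_stays P u),
    ae_restrict_mem (measurableSet_isFirst u 0 0 s)] with y hy hs
  rw [Finset.sum_congr rfl fun n _ => visit_eq_add f hs hy n, Finset.sum_add_distrib,
    sum_range_ite_sub (fun n => visit u f r n (theta s y))]

/-- Initial visits occur before `τ₁` or while the restarted walk is below level `r`. Their number is
at most `τ₁` plus `firstTime u 0 r` of the restarted walk. -/
theorem tsum_initialSet_ne_top (hP : HasRegenSecondMoment P u) (r : ℕ) :
    ∑' n, condJoint P u (initialSet u r n) ≠ ⊤ := by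
  have := hP.isProbabilityMeasure_condJoint
  refine ne_top_of_le_ne_top (ENNReal.add_ne_top.2 ⟨hP.lintegral_regenTime_condJoint,
    hP.lintegral_firstTime_condJoint r⟩) ?_
  rw [← HasRegenSecondMoment.lintegral_regenTime_add (isRegenerative_condJoint hP.iid u)
    hP.ae_condJoint_ne_top (measurable_firstTime u 0 r) fun _ _ _ => rfl,
    ENNReal.tsum_eq_iSup_nat]
  refine iSup_le fun N => ?_
  have h1 : ∀ n, condJoint P u (initialSet u r n)
      = ∫⁻ y, (initialSet u r n).indicator 1 y ∂condJoint P u := fun n =>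
    (lintegral_indicator_one (measurableSet_initialSet u r n)).symm
  simp only [h1]
  rw [← lintegral_finsetSum _ fun n _ => measurable_one.indicator (measurableSet_initialSet u r n),
    lintegral_isFirst hP.ae_condJoint_ne_top]
  refine ENNReal.tsum_le_tsum fun s => setLIntegral_mono' (measurableSet_isFirst u 0 0 s) ?_
  intro y hy
  have h2 : ∀ n, (initialSet u r n).indicator (1 : Env d × Path d → ℝ≥0∞) y
      ≤ (if n < s then 1 else 0) +
        if s ≤ n then (if (theta s y).2 (n - s) ⬝ᵥ u < r then 1 else 0) else 0 := by
    intro n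
    by_cases h3 : y ∈ initialSet u r n
    · obtain ⟨-, s', hs', h⟩ := h3
      rw [← IsFirst.unique hy hs'] at h
      refine (Set.indicator_le_self' (by simp) y).trans ?_
      by_cases h4 : n < s
      · rw [if_pos h4]; simp
      · rw [if_neg h4, if_pos (by omega), if_pos]
        · simp
        · simp only [theta, pathShift, sub_dotProduct]
          rw [Nat.add_sub_cancel' (by omega)]
          omega
    · rw [Set.indicator_of_notMem h3]
      exact zero_le
  refine (Finset.sum_le_sum fun n _ => h2 n).trans ?_
  rw [Finset.sum_add_distrib]
  refine add_le_add (sum_range_lt_le N s) ?_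
  rw [sum_range_ite_sub (fun n => if (theta s y).2 n ⬝ᵥ u < r then (1 : ℝ≥0∞) else 0)]
  exact sum_range_below_le (by simp [theta, pathShift]) r _

/-- The mean over one regeneration block of visits of the environment process. -/
noncomputable def blockMeasure (P : Measure (Env d)) (u : Site d) (r : ℕ) : Measure (Env d) :=
  (∫⁻ y, regenTime u y.2 ∂condJoint P u)⁻¹ • Measure.sum fun n =>
    ((condJoint P u).restrict (initialSet u r n)).map fun y => shift (y.2 n) y.1

theorem lintegral_blockMeasure (P : Measure (Env d)) (u : Site d) (r : ℕ) {f : Env d → ℝ≥0∞}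
    (hf : Measurable f) : ∫⁻ ω, f ω ∂blockMeasure P u r
      = (∑' n, ∫⁻ y in initialSet u r n, seen f n y ∂condJoint P u)
        / ∫⁻ y, regenTime u y.2 ∂condJoint P u := by
  rw [blockMeasure, lintegral_smul_measure, lintegral_sum_measure, smul_eq_mul,
    ENNReal.div_eq_inv_mul]
  congr 1
  refine tsum_congr fun n => ?_
  rw [lintegral_map hf (measurable_theta_aux n)]
  rfl

/-- The renewal theorem applies with `p` the law of `τ₁` under `condJoint`. The inhomogeneous term
increases to the total over initial visits, and `blockMeasure` is normalized by the mean of `τ₁`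
accordingly. -/
theorem tendsto_sum_visit_div (hP : HasRegenSecondMoment P u) {f : Env d → ℝ≥0∞}
    (hf : Measurable f) (hf1 : ∀ ω, f ω ≤ 1) {r : ℕ} (hcut : ∀ ω, f (cut u (-r) ω) = f ω) :
    Tendsto (fun N : ℕ => (∑ n ∈ Finset.range N, ∫⁻ y, visit u f r n y ∂condJoint P u) / N)
      atTop (nhds (∫⁻ ω, f ω ∂blockMeasure P u r)) := by
  have hprob := hP.isProbabilityMeasure_condJoint
  set μ := ∫⁻ y, regenTime u y.2 ∂condJoint P u with hμ
  have hμtop : μ ≠ ⊤ := hP.lintegral_regenTime_condJoint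
  have hμ0 : μ ≠ 0 := by
    refine (lt_of_lt_of_le zero_lt_one ?_).ne'
    calc (1 : ℝ≥0∞) = ∫⁻ y, 1 ∂condJoint P u := by simp
      _ ≤ μ := lintegral_mono fun y => one_le_regenTime u y.2
  set L := ∑' n, ∫⁻ y in initialSet u r n, seen f n y ∂condJoint P u with hL
  have hLtop : L ≠ ⊤ := by
    refine ne_top_of_le_ne_top (tsum_initialSet_ne_top hP r) (ENNReal.tsum_le_tsum fun n => ?_)
    refine (lintegral_mono fun y => hf1 _).trans ?_
    simp
  set p : ℕ → ℝ≥0∞ := fun s => condJoint P u {y | IsFirst u 0 0 s y.2} with hpdef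
  set b : ℕ → ℝ≥0∞ := fun N => ∑ n ∈ Finset.range N, ∫⁻ y, visit u f r n y ∂condJoint P u with hbdef
  set c : ℕ → ℝ≥0∞ := fun N =>
    ∑ n ∈ Finset.range N, ∫⁻ y in initialSet u r n, seen f n y ∂condJoint P u with hcdef
  have hbN : ∀ N : ℕ, b N ≤ N := by
    intro N
    refine (Finset.sum_le_card_nsmul _ _ 1 fun n _ => ?_).trans (by simp)
    refine (lintegral_mono fun y => (visit_le_seen u f r n y).trans (hf1 _)).trans ?_
    simp
  have hbtop : ∀ N, b N ≠ ⊤ := fun N => ne_top_of_le_ne_top (ENNReal.natCast_ne_top N) (hbN N)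
  have hptop : ∀ s, p s ≠ ⊤ := fun s => measure_ne_top _ _
  have hpsum : ∑' s, p s = 1 := tsum_measure_isFirst hP.ae_condJoint_ne_top
  have hpμ : ∑' s : ℕ, p s * s = μ := by
    rw [hμ, lintegral_isFirst hP.ae_condJoint_ne_top]
    refine tsum_congr fun s => ?_
    rw [setLIntegral_congr_fun (g := fun _ => (s : ℝ≥0∞)) (measurableSet_isFirst u 0 0 s),
      setLIntegral_const, mul_comm]
    intro y hy
    simp only
    rw [← firstTime_zero, IsFirst.firstTime_eq hy]
  have hctop : ∀ N, c N ≠ ⊤ := fun N =>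
    ne_top_of_le_ne_top hLtop (ENNReal.sum_le_tsum (Finset.range N))
  have hren : ∀ N, b N = c N + ∑' s, p s * b (N - s) := sum_visit_renewal hP hf hcut
  have key := tendsto_div_of_renewal (p := fun s => (p s).toReal) (b := fun N => (b N).toReal)
    (c := fun N => (c N).toReal) (μ := μ.toReal) (l := L.toReal) (fun s => ENNReal.toReal_nonneg)
    (by simp [hpdef, measure_isFirst_zero]) ?_ ?_ (ENNReal.toReal_pos hμ0 hμtop) ?_ ?_ ?_
  · have hlim := ENNReal.tendsto_ofReal key
    rw [lintegral_blockMeasure P u r hf]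
    have h1 : ENNReal.ofReal (L.toReal / μ.toReal) = L / μ := by
      rw [← ENNReal.toReal_div, ENNReal.ofReal_toReal (ENNReal.div_ne_top hLtop hμ0)]
    rw [h1] at hlim
    refine hlim.congr' ?_
    filter_upwards [eventually_gt_atTop 0] with N hN
    rw [← ENNReal.toReal_natCast, ← ENNReal.toReal_div, ENNReal.ofReal_toReal]
    exact ENNReal.div_ne_top (hbtop N) (by exact_mod_cast hN.ne')
  · have := (ENNReal.summable_toReal (f := p) (by rw [hpsum]; simp)).hasSum
    rwa [← ENNReal.tsum_toReal_eq hptop, hpsum, ENNReal.toReal_one] at this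
  · have h2 : ∀ s : ℕ, (p s).toReal * s = (p s * s).toReal := by
      intro s
      rw [ENNReal.toReal_mul, ENNReal.toReal_natCast]
    simp only [h2]
    have := (ENNReal.summable_toReal (f := fun s : ℕ => p s * s) (by rw [hpμ]; exact hμtop)).hasSum
    rwa [← ENNReal.tsum_toReal_eq fun s => ENNReal.mul_ne_top (hptop s) (ENNReal.natCast_ne_top s),
      hpμ] at this
  · intro N
    rw [abs_of_nonneg ENNReal.toReal_nonneg]
    simpa using ENNReal.toReal_mono (ENNReal.natCast_ne_top N) (hbN N)
  · intro N
    have h3 : ∑' s, p s * b (N - s) ≠ ⊤ := fun h => by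
      have := hren N
      rw [h, add_top] at this
      exact hbtop N this
    have h4 := congrArg ENNReal.toReal (hren N)
    rw [ENNReal.toReal_add (hctop N) h3, ENNReal.tsum_toReal_eq fun s =>
      ENNReal.mul_ne_top (hptop s) (hbtop _)] at h4
    simpa only [ENNReal.toReal_mul] using h4
  · exact (ENNReal.tendsto_toReal hLtop).comp (ENNReal.tendsto_nat_tsum _)

end renewal

end RWRE

/-! ### Decorrelation, and convergence of averages along the walk. -/

namespace RWRE

variable {d : ℕ} {P : Measure (Env d)} {u : Site d}

theorem indicator_one_congr {α : Type*} {S : Set α} {a b : α} (h : a ∈ S ↔ b ∈ S) :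
    S.indicator (1 : α → ℝ≥0∞) a = S.indicator 1 b := by
  by_cases hb : b ∈ S
  · rw [Set.indicator_of_mem hb, Set.indicator_of_mem (h.2 hb), Pi.one_apply, Pi.one_apply]
  · rw [Set.indicator_of_notMem hb, Set.indicator_of_notMem fun ha => hb (h.1 ha)]

/-- The first regeneration more than `r` above `X_m` lies beyond everything that `f` sees from
`X_m`. So `f` belongs to the past, the visits belong to the future, and independence is exact. -/
theorem lintegral_seen_mul_visit (hP : HasRegenSecondMoment P u) {f g : Env d → ℝ≥0∞}
    (hf : Measurable f) (hg : Measurable g) {r : ℕ}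
    (hfdep : ∀ ω ω' : Env d, (∀ x, x ⬝ᵥ u < r → ω x = ω' x) → f ω = f ω')
    (hgcut : ∀ ω, g (cut u (-r) ω) = g ω) (m N : ℕ) :
    ∑' s, ∫⁻ y in {y | IsFirst u m r s y.2},
        seen f m y * ∑ j ∈ Finset.range N, visit u g r j (theta s y) ∂joint P
      = (∫⁻ y, seen f m y ∂joint P)
        * ∑ j ∈ Finset.range N, ∫⁻ y, visit u g r j y ∂condJoint P u := by
  have hfin : ∀ᵐ y ∂joint P, firstTime u m r y.2 ≠ ⊤ := by
    filter_upwards [hP.ae_joint_firstTime_ne_top] with y hy using hy m r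
  rw [lintegral_isFirst hfin (seen f m), ← ENNReal.tsum_mul_right]
  refine tsum_congr fun s => ?_
  rw [← lintegral_finsetSum _ fun j _ => measurable_visit u hg r j]
  refine (isRegenerative_joint hP.iid u).setLIntegral_isFirst m r s
    (Ψ := fun y => ∑ j ∈ Finset.range N, visit u g r j y) (measurable_seen hf m)
    (Finset.measurable_fun_sum _ fun j _ => measurable_visit u hg r j) ?_
    (fun ω X _ => Finset.sum_congr rfl fun j _ => visit_cut hgcut j ω X)
  intro ω ω' X X' hX hω
  by_cases h : m < s ∧ X m ⬝ᵥ u + r < X s ⬝ᵥ u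
  · have h' : m < s ∧ X' m ⬝ᵥ u + r < X' s ⬝ᵥ u := by
      rwa [← hX m h.1.le, ← hX s le_rfl]
    beta_reduce
    rw [Set.indicator_of_mem (by exact h), Set.indicator_of_mem (by exact h')]
    simp only [seen]
    refine hfdep _ _ fun x hx => ?_
    simp only [shift]
    rw [← hX m h.1.le]
    refine hω _ ?_
    rw [add_dotProduct]
    omega
  · have h' : ¬ (m < s ∧ X' m ⬝ᵥ u + r < X' s ⬝ᵥ u) := by
      intro h'
      rw [← hX m h'.1.le, ← hX s le_rfl] at h'
      exact h h'
    beta_reduce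
    rw [Set.indicator_of_notMem (by exact h), Set.indicator_of_notMem (by exact h')]

/-- Apart from visits of the walk restarted at `s`, only the times between `m` and `s` and the times
when the restarted walk is below level `r` contribute. -/
theorem sum_range_seen_le {g : Env d → ℝ≥0∞} (hg1 : ∀ ω, g ω ≤ 1) {m r s : ℕ} (N : ℕ)
    (hms : m ≤ s) (y : Env d × Path d) :
    ∑ n ∈ Finset.range N, seen g (m + n) y ≤ ((s - m : ℕ) : ℝ≥0∞) + firstTime u 0 r (theta s y).2
      + ∑ j ∈ Finset.range N, visit u g r j (theta s y) := by
  have h1 : ∀ j, seen g (s + j) y ≤ (if (theta s y).2 j ⬝ᵥ u < r then 1 else 0)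
      + visit u g r j (theta s y) := by
    intro j
    by_cases h : (theta s y).2 j ⬝ᵥ u < r
    · rw [if_pos h]
      exact (hg1 _).trans le_self_add
    · rw [if_neg h, zero_add, visit, Set.indicator_of_mem (by exact not_lt.1 h), seen_theta]
  calc ∑ n ∈ Finset.range N, seen g (m + n) y
      ≤ ∑ n ∈ Finset.range ((s - m) + N), seen g (m + n) y :=
        Finset.sum_le_sum_of_subset (Finset.range_mono (by omega))
    _ = ∑ n ∈ Finset.range (s - m), seen g (m + n) y
        + ∑ j ∈ Finset.range N, seen g (s + j) y := by
        rw [Finset.sum_range_add]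
        congr 1
        refine Finset.sum_congr rfl fun j _ => ?_
        congr 1
        omega
    _ ≤ ((s - m : ℕ) : ℝ≥0∞) + ∑ j ∈ Finset.range N,
          ((if (theta s y).2 j ⬝ᵥ u < r then 1 else 0) + visit u g r j (theta s y)) := by
        refine add_le_add ?_ (Finset.sum_le_sum fun j _ => h1 j)
        exact (Finset.sum_le_card_nsmul _ _ 1 fun n _ => hg1 _).trans (by simp)
    _ ≤ _ := by
        rw [Finset.sum_add_distrib, add_assoc]
        gcongr
        exact sum_range_below_le (by simp [theta, pathShift]) r N

theorem sum_range_visit_le {g : Env d → ℝ≥0∞} (hg1 : ∀ ω, g ω ≤ 1) {m r s : ℕ} (N : ℕ)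
    (hms : m ≤ s) (y : Env d × Path d) :
    ∑ j ∈ Finset.range N, visit u g r j (theta s y)
      ≤ ∑ n ∈ Finset.range N, seen g (m + n) y + ((s - m : ℕ) : ℝ≥0∞) := by
  calc ∑ j ∈ Finset.range N, visit u g r j (theta s y)
      ≤ ∑ j ∈ Finset.range N, seen g (s + j) y := Finset.sum_le_sum fun j _ =>
        (visit_le_seen _ _ _ _ _).trans (seen_theta g s j y).le
    _ ≤ ∑ n ∈ Finset.range (s - m), seen g (m + n) y
        + ∑ j ∈ Finset.range N, seen g (s + j) y := le_add_self
    _ = ∑ n ∈ Finset.range (N + (s - m)), seen g (m + n) y := by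
        rw [add_comm N, Finset.sum_range_add]
        congr 1
        refine Finset.sum_congr rfl fun j _ => ?_
        congr 1
        omega
    _ ≤ _ := by
        rw [Finset.sum_range_add]
        refine add_le_add_right ?_ _
        exact (Finset.sum_le_card_nsmul _ _ 1 fun n _ => hg1 _).trans (by simp)

theorem IsFirst.lt {m r s : ℕ} {X : Path d} (h : IsFirst u m r s X) : m < s := by
  by_contra hms
  have h1 := h.1.1.2.2 m (by omega)
  have h2 := h.1.2
  omega

theorem IsFirst.firstTime_sub {m r s : ℕ} {X : Path d} (h : IsFirst u m r s X) :
    firstTime u m r X - m = ((s - m : ℕ) : ℝ≥0∞) := by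
  rw [h.firstTime_eq, ENNReal.natCast_sub]

/-- The error is the mean waiting time for the separating regeneration plus the mean time spent low
after it. It does not depend on `N`. -/
theorem lintegral_seen_mul_sum_le (hP : HasRegenSecondMoment P u) {f g : Env d → ℝ≥0∞}
    (hf : Measurable f) (hf1 : ∀ ω, f ω ≤ 1) (hg : Measurable g) (hg1 : ∀ ω, g ω ≤ 1) {r : ℕ}
    (hfdep : ∀ ω ω' : Env d, (∀ x, x ⬝ᵥ u < r → ω x = ω' x) → f ω = f ω')
    (hgcut : ∀ ω, g (cut u (-r) ω) = g ω) (m N : ℕ) :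
    ∫⁻ y, seen f m y * ∑ n ∈ Finset.range N, seen g (m + n) y ∂joint P
      ≤ (∫⁻ y, seen f m y ∂joint P)
          * ∑ j ∈ Finset.range N, ∫⁻ y, visit u g r j y ∂condJoint P u
        + ∫⁻ y, (firstTime u m r y.2 - m) ∂joint P
        + ∫⁻ y, firstTime u 0 r y.2 ∂condJoint P u := by
  have hprob := hP.isProbabilityMeasure
  have hfin : ∀ᵐ y ∂joint P, firstTime u m r y.2 ≠ ⊤ := by
    filter_upwards [hP.ae_joint_firstTime_ne_top] with y hy using hy m r
  have h3 : ∑' s, ∫⁻ y in {y | IsFirst u m r s y.2}, firstTime u 0 r (theta s y).2 ∂joint P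
      = ∫⁻ y, firstTime u 0 r y.2 ∂condJoint P u := by
    simp only [(isRegenerative_joint hP.iid u).setLIntegral_isFirst_future m r _
      (measurable_firstTime u 0 r) fun _ _ _ => rfl]
    rw [ENNReal.tsum_mul_right, tsum_measure_isFirst hfin, one_mul]
  rw [← lintegral_seen_mul_visit hP hf hg hfdep hgcut, ← h3, lintegral_isFirst hfin,
    lintegral_isFirst hfin (fun y => firstTime u m r y.2 - m), ← ENNReal.tsum_add,
    ← ENNReal.tsum_add]
  refine ENNReal.tsum_le_tsum fun s => ?_
  rw [← lintegral_add_right _ ((measurable_firstTime u m r).sub_const _),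
    ← lintegral_add_right _ (show Measurable fun y => firstTime u 0 r (theta s y).2 from
      (measurable_firstTime u 0 r).comp (measurable_theta s))]
  refine setLIntegral_mono' (measurableSet_isFirst u m r s) fun y hy => ?_
  rw [IsFirst.firstTime_sub hy]
  calc _ ≤ seen f m y * (((s - m : ℕ) : ℝ≥0∞) + firstTime u 0 r (theta s y).2
      + ∑ j ∈ Finset.range N, visit u g r j (theta s y)) :=
        mul_le_mul_right (sum_range_seen_le hg1 N hy.lt.le y) _
    _ ≤ _ := by
        rw [mul_add, add_comm, add_assoc]
        gcongr
        exact mul_le_of_le_one_left' (hf1 _)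

theorem le_lintegral_seen_mul_sum (hP : HasRegenSecondMoment P u) {f g : Env d → ℝ≥0∞}
    (hf : Measurable f) (hf1 : ∀ ω, f ω ≤ 1) (hg : Measurable g) (hg1 : ∀ ω, g ω ≤ 1) {r : ℕ}
    (hfdep : ∀ ω ω' : Env d, (∀ x, x ⬝ᵥ u < r → ω x = ω' x) → f ω = f ω')
    (hgcut : ∀ ω, g (cut u (-r) ω) = g ω) (m N : ℕ) :
    (∫⁻ y, seen f m y ∂joint P) * ∑ j ∈ Finset.range N, ∫⁻ y, visit u g r j y ∂condJoint P u
      ≤ ∫⁻ y, seen f m y * ∑ n ∈ Finset.range N, seen g (m + n) y ∂joint P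
        + ∫⁻ y, (firstTime u m r y.2 - m) ∂joint P := by
  have hfin : ∀ᵐ y ∂joint P, firstTime u m r y.2 ≠ ⊤ := by
    filter_upwards [hP.ae_joint_firstTime_ne_top] with y hy using hy m r
  rw [← lintegral_seen_mul_visit hP hf hg hfdep hgcut, lintegral_isFirst hfin,
    lintegral_isFirst hfin (fun y => firstTime u m r y.2 - m), ← ENNReal.tsum_add]
  refine ENNReal.tsum_le_tsum fun s => ?_
  rw [← lintegral_add_right _ ((measurable_firstTime u m r).sub_const _)]
  refine setLIntegral_mono' (measurableSet_isFirst u m r s) fun y hy => ?_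
  rw [IsFirst.firstTime_sub hy]
  calc _ ≤ seen f m y * (∑ n ∈ Finset.range N, seen g (m + n) y + ((s - m : ℕ) : ℝ≥0∞)) :=
        mul_le_mul_right (sum_range_visit_le hg1 N hy.lt.le y) _
    _ ≤ _ := by
        rw [mul_add]
        gcongr
        exact mul_le_of_le_one_left' (hf1 _)

theorem tendsto_const_div_natCast {C : ℝ≥0∞} (hC : C ≠ ⊤) :
    Tendsto (fun N : ℕ => C / N) atTop (nhds 0) := by
  have h := ENNReal.Tendsto.const_mul ENNReal.tendsto_inv_nat_nhds_zero (Or.inr hC)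
  simpa [div_eq_mul_inv] using h

/-- Two sequences within bounded distance of each other have the same averages. -/
theorem tendsto_div_of_le_add {a b : ℕ → ℝ≥0∞} {C l : ℝ≥0∞} (hC : C ≠ ⊤)
    (hab : ∀ N, a N ≤ b N + C) (hba : ∀ N, b N ≤ a N + C)
    (hb : Tendsto (fun N : ℕ => b N / N) atTop (nhds l)) :
    Tendsto (fun N : ℕ => a N / N) atTop (nhds l) := by
  have hC0 := tendsto_const_div_natCast hC
  refine tendsto_of_tendsto_of_tendsto_of_le_of_le (g := fun N : ℕ => b N / N - C / N)
    (h := fun N : ℕ => b N / N + C / N) ?_ ?_ ?_ ?_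
  · have := ENNReal.Tendsto.sub hb hC0 (Or.inr (by simp))
    rwa [tsub_zero] at this
  · have := hb.add hC0
    rwa [add_zero] at this
  · intro N
    refine tsub_le_iff_right.2 ?_
    rw [← ENNReal.add_div]
    exact ENNReal.div_le_div_right (hba N) _
  · intro N
    simp only
    rw [← ENNReal.add_div]
    exact ENNReal.div_le_div_right (hab N) _

/-- Averages of the environment seen from the particle converge, for functionals that do not
look far behind the particle. -/
theorem tendsto_sum_seen_div (hP : HasRegenSecondMoment P u) {f : Env d → ℝ≥0∞}
    (hf : Measurable f) (hf1 : ∀ ω, f ω ≤ 1) {r : ℕ} (hcut : ∀ ω, f (cut u (-r) ω) = f ω) :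
    Tendsto (fun N : ℕ => (∑ n ∈ Finset.range N, ∫⁻ y, seen f n y ∂joint P) / N)
      atTop (nhds (∫⁻ ω, f ω ∂blockMeasure P u r)) := by
  have hprob := hP.isProbabilityMeasure
  have h1 : ∀ N, ∫⁻ y, seen (fun _ : Env d => 1) 0 y * ∑ n ∈ Finset.range N, seen f (0 + n) y ∂joint P
      = ∑ n ∈ Finset.range N, ∫⁻ y, seen f n y ∂joint P := by
    intro N
    rw [← lintegral_finsetSum _ fun n _ => measurable_seen hf n]
    simp [seen]
  have h2 : ∫⁻ y, seen (fun _ : Env d => (1 : ℝ≥0∞)) 0 y ∂joint P = 1 := by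
    simp [seen]
  have h3 : ∫⁻ y, (firstTime u 0 r y.2 - (0 : ℕ)) ∂joint P ≠ ⊤ := by
    simpa using hP.lintegral_firstTime_joint r
  -- With the constant functional at time zero, the decorrelation bounds compare averages under
  -- `joint` with visits under `condJoint`.
  have hup := fun N => lintegral_seen_mul_sum_le hP (f := fun _ => 1) measurable_const
    (fun _ => le_rfl) hf hf1 (r := r) (fun _ _ _ => rfl) hcut 0 N
  have hlo := fun N => le_lintegral_seen_mul_sum hP (f := fun _ => 1) measurable_const
    (fun _ => le_rfl) hf hf1 (r := r) (fun _ _ _ => rfl) hcut 0 N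
  simp only [h1, h2, one_mul] at hup hlo
  refine tendsto_div_of_le_add (C := ∫⁻ y, (firstTime u 0 r y.2 - (0 : ℕ)) ∂joint P
        + ∫⁻ y, firstTime u 0 r y.2 ∂condJoint P u)
    (ENNReal.add_ne_top.2 ⟨h3, hP.lintegral_firstTime_condJoint r⟩) (fun N => ?_) (fun N => ?_)
    (tendsto_sum_visit_div hP hf hf1 hcut)
  · rw [← add_assoc]
    exact hup N
  · rw [← add_assoc]
    exact (hlo N).trans le_self_add

theorem isProbabilityMeasure_blockMeasure (hP : HasRegenSecondMoment P u) (r : ℕ) :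
    IsProbabilityMeasure (blockMeasure P u r) := by
  have hprob := hP.isProbabilityMeasure
  have h := tendsto_sum_seen_div hP (f := fun _ => 1) measurable_const (fun _ => le_rfl) (r := r)
    fun _ => rfl
  rw [lintegral_one] at h
  refine ⟨tendsto_nhds_unique h (tendsto_const_nhds.congr' ?_)⟩
  filter_upwards [eventually_gt_atTop 0] with N hN
  simp only [seen, lintegral_const, measure_univ, mul_one, Finset.sum_const, Finset.card_range,
    nsmul_eq_mul]
  rw [ENNReal.div_self (by exact_mod_cast hN.ne') (ENNReal.natCast_ne_top N)]

/-- Both sides are limits of the same averages along the walk, which do not involve `r` or `r'`. -/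
theorem map_cut_blockMeasure (hP : HasRegenSecondMoment P u) {r r' : ℕ} (h : r ≤ r') :
    (blockMeasure P u r').map (cut u (-r)) = (blockMeasure P u r).map (cut u (-r)) := by
  ext A hA
  have hm : Measurable (cut u (-r)) := measurable_envOn _
  rw [Measure.map_apply hm hA, Measure.map_apply hm hA]
  have hA' := hm hA
  rw [← lintegral_indicator_one hA', ← lintegral_indicator_one hA']
  have h1 : ∀ ω, (cut u (-r) ⁻¹' A).indicator (1 : Env d → ℝ≥0∞) ω ≤ 1 :=
    fun ω => Set.indicator_le_self' (by simp) ω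
  have h2 : ∀ k : ℕ, r ≤ k → ∀ ω, (cut u (-r) ⁻¹' A).indicator (1 : Env d → ℝ≥0∞) (cut u (-k) ω)
      = (cut u (-r) ⁻¹' A).indicator 1 ω := by
    intro k hk ω
    have h3 : cut u (-k) ω ∈ cut u (-r) ⁻¹' A ↔ ω ∈ cut u (-r) ⁻¹' A := by
      rw [Set.mem_preimage, Set.mem_preimage, cut_cut u (by omega)]
    exact indicator_one_congr h3
  exact tendsto_nhds_unique
    (tendsto_sum_seen_div hP (measurable_one.indicator hA') h1 (h2 r' h))
    (tendsto_sum_seen_div hP (measurable_one.indicator hA') h1 (h2 r le_rfl))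

end RWRE

/-! ### Construction of the limit measure. -/

namespace RWRE

/-- Probability vectors form a measurable subset of a countable product. The gluing below uses
regular conditional distributions and therefore needs a standard Borel space. -/
instance (d : ℕ) : StandardBorelSpace (PMF (Site d)) := by
  have h : MeasurableSet {f : Site d → ℝ≥0∞ | HasSum f 1} := by
    have : {f : Site d → ℝ≥0∞ | HasSum f 1} = {f | ∑' z, f z = 1} := by
      ext f
      simp only [Set.mem_ofPred_eq]
      exact ENNReal.summable.hasSum_iff
    rw [this]
    exact (Measurable.tsum fun z => measurable_pi_apply z) (measurableSet_singleton 1)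
  exact h.standardBorel

instance (d : ℕ) : Nonempty (PMF (Site d)) := ⟨PMF.pure 0⟩

/-- Consistent laws along a sequence of maps come from one random sequence. -/
theorem exists_measure_of_consistent {E : Type*} [MeasurableSpace E] [StandardBorelSpace E]
    [Nonempty E] (c : ℕ → E → E) (hc : ∀ k, Measurable (c k)) (v : ℕ → Measure E)
    [∀ k, IsProbabilityMeasure (v k)] (hv : ∀ k, (v (k + 1)).map (c k) = (v k).map (c k)) :
    ∃ μ : Measure (ℕ → E), IsProbabilityMeasure μ ∧ (μ.map fun s => s 0) = (v 0).map (c 0) ∧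
      ∀ k, (μ.map fun s => (s k, s (k + 1))) = (v (k + 1)).map fun e => (c k e, c (k + 1) e) := by
  have : IsProbabilityMeasure ((v 0).map (c 0)) := Measure.isProbabilityMeasure_map (hc 0).aemeasurable
  -- A Markov chain whose step from `n` draws `c (n + 1)` given `c n`, both evaluated at one point
  -- of law `v (n + 1)`.
  let κ : (n : ℕ) → Kernel (Π _ : Finset.Iic n, E) E := fun n =>
    (condDistrib (c (n + 1)) (c n) (v (n + 1))).comap
      (fun h => h ⟨n, Finset.mem_Iic.2 le_rfl⟩) (measurable_pi_apply _)
  let μ : Measure (ℕ → E) := Kernel.trajMeasure (X := fun _ => E) ((v 0).map (c 0)) κ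
  have hμ0 : (μ.map fun s => s 0) = (v 0).map (c 0) := by
    have h : μ.map (Preorder.frestrictLe (π := fun _ => E) 0)
        = ((v 0).map (c 0)).map (MeasurableEquiv.piUnique fun _ : Finset.Iic 0 => E).symm := by
      simp only [μ]
      rw [Kernel.trajMeasure, Measure.map_comp _ _ (by fun_prop), Kernel.traj_map_frestrictLe,
        Kernel.partialTraj_self, Measure.id_comp]
    have h2 := congrArg (Measure.map (MeasurableEquiv.piUnique fun _ : Finset.Iic 0 => E)) h
    rw [Measure.map_map (by fun_prop) (by fun_prop), Measure.map_map (by fun_prop) (by fun_prop),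
      MeasurableEquiv.self_comp_symm, Measure.map_id] at h2
    exact h2
  have hstep : ∀ k, (μ.map fun s => s k) ⊗ₘ condDistrib (c (k + 1)) (c k) (v (k + 1))
      = μ.map fun s => (s k, s (k + 1)) := by
    intro k
    have h := Kernel.map_frestrictLe_trajMeasure_compProd_eq_map_trajMeasure (X := fun _ => E)
      (μ₀ := (v 0).map (c 0)) (κ := κ) (a := k)
    have hm : Measurable fun q : (Π _ : Finset.Iic k, E) × E =>
        (q.1 ⟨k, Finset.mem_Iic.2 le_rfl⟩, q.2) := by fun_prop
    have h2 := congrArg (Measure.map (fun q : (Π _ : Finset.Iic k, E) × E =>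
      (q.1 ⟨k, Finset.mem_Iic.2 le_rfl⟩, q.2))) h
    rw [Measure.map_map hm (by fun_prop)] at h2
    refine Eq.trans ?_ h2
    ext A hA
    rw [Measure.map_apply hm hA, Measure.compProd_apply hA, Measure.compProd_apply (hm hA),
      lintegral_map (Kernel.measurable_kernel_prodMk_left hA) (by fun_prop),
      lintegral_map (Kernel.measurable_kernel_prodMk_left (hm hA)) (by fun_prop)]
    rfl
  -- By `hv`, the law of the chain at time `k` is also that of `c k` under `v (k + 1)`, the law that
  -- the next kernel disintegrates.
  have hmarg : ∀ k, (μ.map fun s => s k) = (v k).map (c k) := by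
    intro k
    induction k with
    | zero => exact hμ0
    | succ k ih =>
      have h1 := hstep k
      rw [ih, ← hv k, compProd_map_condDistrib (hc _).aemeasurable] at h1
      have h2 := congrArg (Measure.map Prod.snd) h1
      rw [Measure.map_map measurable_snd ((hc k).prodMk (hc (k + 1))),
        Measure.map_map measurable_snd (by fun_prop)] at h2
      exact h2.symm
  refine ⟨μ, inferInstance, hμ0, fun k => ?_⟩
  rw [← hstep, hmarg, ← hv k, compProd_map_condDistrib (hc _).aemeasurable]


variable {d : ℕ} {P : Measure (Env d)} {u : Site d}

/-- A law on environments whose marginals on half spaces agree with those of `blockMeasure`. -/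
theorem exists_limit_measure (hP : HasRegenSecondMoment P u) :
    ∃ Q : Measure (Env d), IsProbabilityMeasure Q ∧
      ∀ r : ℕ, Q.map (cut u (-r)) = (blockMeasure P u r).map (cut u (-r)) := by
  have hv := isProbabilityMeasure_blockMeasure hP
  have hc : ∀ k : ℕ, Measurable (cut u (-k)) := fun k => measurable_envOn _
  obtain ⟨μ, hμ, h0, hμk⟩ := exists_measure_of_consistent (fun k : ℕ => cut u (-k)) hc
    (blockMeasure P u) fun k => map_cut_blockMeasure hP (Nat.le_succ k)
  have hmarg : ∀ k, (μ.map fun s => s k) = (blockMeasure P u k).map (cut u (-k)) := by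
    intro k
    cases k with
    | zero => exact h0
    | succ k =>
      have h := congrArg (Measure.map Prod.snd) (hμk k)
      rwa [Measure.map_map measurable_snd ((hc k).prodMk (hc (k + 1))),
        Measure.map_map measurable_snd (by fun_prop)] at h
  -- Consecutive entries are distributed as two cuts of a single environment, so they agree on the
  -- smaller half space.
  have hcons : ∀ᵐ s ∂μ, ∀ k : ℕ, ∀ x : Site d, -(k : ℤ) ≤ x ⬝ᵥ u → s k x = s (k + 1) x := by
    rw [ae_all_iff]
    intro k
    have hS : MeasurableSet {q : Env d × Env d | ∀ x : Site d, -(k : ℤ) ≤ x ⬝ᵥ u → q.1 x = q.2 x} := by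
      refine measurableSet_setOfPred.2 (Measurable.forall fun x => Measurable.forall fun _ => ?_)
      exact measurableSet_setOfPred.1 (measurableSet_eq_fun (by fun_prop) (by fun_prop))
    have h : ∀ᵐ q : Env d × Env d ∂(μ.map fun s : ℕ → Env d => (s k, s (k + 1))),
        ∀ x : Site d, -(k : ℤ) ≤ x ⬝ᵥ u → q.1 x = q.2 x := by
      rw [hμk, ae_map_iff ((hc k).prodMk (hc (k + 1))).aemeasurable hS]
      refine ae_of_all _ fun ω x hx => ?_
      have hx' : x ∈ halfSpace u (-((k + 1 : ℕ) : ℤ)) := by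
        rw [mem_halfSpace]
        push_cast
        omega
      exact (envOn_of_mem (B := halfSpace u (-k)) hx ω).trans (envOn_of_mem hx' ω).symm
    exact ae_of_ae_map (by fun_prop) h
  -- The entry with index `|x · u|` reaches far enough back to contain the site `x`.
  let glue : (ℕ → Env d) → Env d := fun s x => s (x ⬝ᵥ u).natAbs x
  have hglue : Measurable glue := measurable_pi_lambda _ fun x => by fun_prop
  refine ⟨μ.map glue, Measure.isProbabilityMeasure_map hglue.aemeasurable, fun r => ?_⟩
  rw [Measure.map_map (hc r) hglue]
  have h1 : (fun s => cut u (-r) (glue s)) =ᵐ[μ] fun s => cut u (-r) (s r) := by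
    filter_upwards [hcons] with s hs
    have hmono : ∀ k l : ℕ, k ≤ l → ∀ x : Site d, -(k : ℤ) ≤ x ⬝ᵥ u → s k x = s l x := by
      intro k l hkl x hx
      induction l, hkl using Nat.le_induction with
      | base => rfl
      | succ l hl ih =>
        rw [ih]
        exact hs l x (by omega)
    refine envOn_congr fun x hx => ?_
    rw [mem_halfSpace] at hx
    simp only [glue]
    rcases le_total (x ⬝ᵥ u).natAbs r with h | h
    · exact hmono _ _ h x (by omega)
    · exact (hmono _ _ h x (by omega)).symm
  have h2 : μ.map (fun s => cut u (-r) (s r)) = (μ.map fun s => s r).map (cut u (-r)) :=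
    (Measure.map_map (hc r) (by fun_prop)).symm
  rw [show cut u (-r) ∘ glue = fun s => cut u (-r) (glue s) from rfl, Measure.map_congr h1, h2,
    hmarg, Measure.map_map (hc r) (hc r)]
  congr 1
  funext ω
  exact cut_cut u le_rfl ω

/-- `Q` is the limit of averages of the environment seen from the particle. -/
def IsAverageLimit (P : Measure (Env d)) (u : Site d) (Q : Measure (Env d)) : Prop :=
  ∀ (f : Env d → ℝ≥0∞) (k : ℤ), Measurable f → (∀ ω, f ω ≤ 1) → (∀ ω, f (cut u k ω) = f ω) →
    Tendsto (fun N : ℕ => (∑ n ∈ Finset.range N, ∫⁻ y, seen f n y ∂joint P) / N)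
      atTop (nhds (∫⁻ ω, f ω ∂Q))

/-- The identity with `blockMeasure` is recorded too, because ergodicity needs the limit of visits
under `condJoint` in terms of `Q`. -/
theorem exists_isAverageLimit (hP : HasRegenSecondMoment P u) :
    ∃ Q : Measure (Env d), IsProbabilityMeasure Q ∧ IsAverageLimit P u Q ∧
      ∀ (f : Env d → ℝ≥0∞) (r : ℕ), Measurable f → (∀ ω, f (cut u (-r) ω) = f ω) →
        ∫⁻ ω, f ω ∂Q = ∫⁻ ω, f ω ∂blockMeasure P u r := by
  obtain ⟨Q, hQ, hmap⟩ := exists_limit_measure hP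
  have key : ∀ (f : Env d → ℝ≥0∞) (r : ℕ), Measurable f → (∀ ω, f (cut u (-r) ω) = f ω) →
      ∫⁻ ω, f ω ∂Q = ∫⁻ ω, f ω ∂blockMeasure P u r := by
    intro f r hf hcut
    have h := lintegral_map (μ := Q) hf (measurable_envOn (halfSpace u (-r)))
    have h' := lintegral_map (μ := blockMeasure P u r) hf (measurable_envOn (halfSpace u (-r)))
    rw [lintegral_congr hcut] at h h'
    rw [← h, ← h', hmap r]
  refine ⟨Q, hQ, fun f k hf hf1 hcut => ?_, key⟩
  have hcut' : ∀ ω, f (cut u (-(k.natAbs : ℤ)) ω) = f ω := by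
    intro ω
    rw [← hcut, cut_cut u (by omega), hcut]
  rw [key f k.natAbs hf hcut']
  exact tendsto_sum_seen_div hP hf hf1 hcut'

end RWRE

/-! ### Bounded steps, and local functionals of environment and walk. -/

namespace RWRE

variable {d : ℕ}

/-- Paths from the origin that change level by at most `c` in each step. -/
def slowPaths (u : Site d) (c : ℕ) : Set (Path d) :=
  {X | X 0 = 0 ∧ ∀ n, |X (n + 1) ⬝ᵥ u - X n ⬝ᵥ u| ≤ c}

theorem measurableSet_slowPaths (u : Site d) (c : ℕ) : MeasurableSet (slowPaths u c) := by
  refine (measurable_pi_apply 0 (measurableSet_singleton 0)).inter ?_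
  refine measurableSet_setOfPred.2 (Measurable.forall fun n => measurableSet_setOfPred.1 ?_)
  exact measurableSet_le (((measurable_level u (n + 1)).sub (measurable_level u n)).comp
    measurable_id |> (measurable_of_countable fun z : ℤ => |z|).comp) measurable_const

theorem abs_level_sub_le {u : Site d} {c : ℕ} {X : Path d} (h : X ∈ slowPaths u c) (m n : ℕ) :
    |X (m + n) ⬝ᵥ u - X m ⬝ᵥ u| ≤ c * n := by
  induction n with
  | zero => simp
  | succ n ih =>
    have h1 := h.2 (m + n)
    rw [← add_assoc]
    push_cast
    rw [abs_le] at *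
    constructor <;> nlinarith

theorem abs_level_le {u : Site d} {c : ℕ} {X : Path d} (h : X ∈ slowPaths u c) (n : ℕ) :
    |X n ⬝ᵥ u| ≤ c * n := by
  have := abs_level_sub_le h 0 n
  rw [h.1, zero_add] at this
  simpa using this

theorem exists_level_bound (u : Site d) (M : ℝ) :
    ∃ c : ℕ, 1 ≤ c ∧ ∀ z : Site d, euclNorm z ≤ M → |z ⬝ᵥ u| ≤ c := by
  refine ⟨⌈M * ∑ i, |(u i : ℝ)|⌉₊ + 1, by omega, fun z hz => ?_⟩
  have h1 : ∀ i, |(z i : ℝ)| ≤ M := fun i => by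
    refine le_trans (Real.abs_le_sqrt ?_) hz
    exact Finset.single_le_sum (f := fun i => (z i : ℝ) ^ 2) (fun _ _ => sq_nonneg _)
      (Finset.mem_univ i)
  have h2 : |((z ⬝ᵥ u : ℤ) : ℝ)| ≤ M * ∑ i, |(u i : ℝ)| := by
    simp only [dotProduct]
    push_cast
    rw [Finset.mul_sum]
    refine (Finset.abs_sum_le_sum_abs _ _).trans (Finset.sum_le_sum fun i _ => ?_)
    rw [abs_mul]
    exact mul_le_mul_of_nonneg_right (h1 i) (abs_nonneg _)
  have h3 := h2.trans (Nat.le_ceil _)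
  rw [← Int.cast_abs] at h3
  have h4 : |z ⬝ᵥ u| ≤ (⌈M * ∑ i, |(u i : ℝ)|⌉₊ : ℤ) := by exact_mod_cast h3
  push_cast
  omega

section slow

variable {u : Site d} {M : ℝ} {c : ℕ}

theorem quenched_ae_slow (hc : ∀ z : Site d, euclNorm z ≤ M → |z ⬝ᵥ u| ≤ c) {ω : Env d}
    (hω : ω ∈ boundedEnv d M) : ∀ᵐ X ∂quenched ω 0, X ∈ slowPaths u c := by
  filter_upwards [quenched_ae_zero ω, quenched_ae_step ω] with X h0 hX
  refine ⟨h0, fun n => ?_⟩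
  rw [← sub_dotProduct]
  refine hc _ (not_lt.1 fun h => hX n (hω _ _ h))

theorem measurableSet_boundedEnv (M : ℝ) : MeasurableSet (boundedEnv d M) := by
  refine measurableSet_setOfPred.2 (Measurable.forall fun x => Measurable.forall fun z =>
    Measurable.forall fun _ => measurableSet_setOfPred.1 ?_)
  exact measurable_weight x z (measurableSet_singleton 0)

theorem shift_mem_boundedEnv {ω : Env d} (h : ω ∈ boundedEnv d M) (z : Site d) :
    shift z ω ∈ boundedEnv d M := fun x y hy => h (x + z) y hy

theorem ae_joint_bounded (μ : Measure (Env d)) [SFinite μ] (h : ∀ᵐ ω ∂μ, ω ∈ boundedEnv d M) :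
    ∀ᵐ y ∂joint μ, y.1 ∈ boundedEnv d M :=
  ae_joint μ (measurable_fst (measurableSet_boundedEnv M)) (h.mono fun _ hω => ae_of_all _ fun _ => hω)

theorem ae_joint_slow (hc : ∀ z : Site d, euclNorm z ≤ M → |z ⬝ᵥ u| ≤ c) (μ : Measure (Env d))
    [SFinite μ] (h : ∀ᵐ ω ∂μ, ω ∈ boundedEnv d M) : ∀ᵐ y ∂joint μ, y.2 ∈ slowPaths u c :=
  ae_joint μ (measurable_snd (measurableSet_slowPaths u c)) (h.mono fun _ hω => quenched_ae_slow hc hω)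

/-- Since `c * K ≤ r`, a path from the origin that leaves the half space within its first `K` sites
must make a step longer than `M` beforehand. This step starts inside the half space, so it has
probability zero in both environments. -/
theorem quenched_cut_cyl (hc : ∀ z : Site d, euclNorm z ≤ M → |z ⬝ᵥ u| ≤ c) {ω : Env d}
    (hω : ω ∈ boundedEnv d M) {K r : ℕ} (hr : c * K ≤ r) (a : Path d) :
    quenched (cut u (-r) ω) 0 (cyl a K) = quenched ω 0 (cyl a K) := by
  by_cases h : ∀ i < K, a i ∈ halfSpace u (-r)
  · exact quenched_cyl_congr fun i hi => envOn_of_mem (h i hi) ω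
  rw [quenched_cyl, quenched_cyl]
  split_ifs with h0
  · push Not at h
    classical
    have hi := Nat.find_spec h
    set i := Nat.find h with hidef
    have hmin : ∀ j < i, a j ∈ halfSpace u (-r) := by
      intro j hj
      have := Nat.find_min h hj
      push Not at this
      exact this (hj.trans hi.1)
    have hj : ∃ j < i, M < euclNorm (a (j + 1) - a j) := by
      by_contra hne
      push Not at hne
      have hlev : ∀ k ≤ i, -((c * k : ℕ) : ℤ) ≤ a k ⬝ᵥ u := by
        intro k hk
        induction k with
        | zero => simp [h0]
        | succ k ih =>
          have h1 := ih (by omega)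
          have h2 := (abs_le.1 (hc _ (hne k (by omega)))).1
          rw [sub_dotProduct] at h2
          push_cast at h1 ⊢
          linarith
      refine hi.2 ?_
      rw [mem_halfSpace]
      have h3 := hlev i le_rfl
      have h4 : c * i ≤ r := (Nat.mul_le_mul_left c hi.1.le).trans hr
      omega
    obtain ⟨j, hj, hjM⟩ := hj
    have hjK : j ∈ Finset.range K := Finset.mem_range.2 (hj.trans hi.1)
    have h5 : cut u (-r) ω (a j) (a (j + 1) - a j) = 0 := by
      rw [cut, envOn_of_mem (hmin j hj)]
      exact hω _ _ hjM
    rw [Finset.prod_eq_zero hjK h5, Finset.prod_eq_zero hjK (hω _ _ hjM)]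
  · rfl

theorem lintegral_joint_markov (μ : Measure (Env d)) [SFinite μ] {H : Env d × Path d → ℝ≥0∞}
    (hH : Measurable H) (m : ℕ) :
    ∫⁻ y, H (theta m y) ∂joint μ
      = ∫⁻ y, seen (fun ω => ∫⁻ X, H (ω, X) ∂quenched ω 0) m y ∂joint μ := by
  have h1 := lintegral_joint_theta μ m (measurable_const (a := (1 : ℝ≥0∞))) hH fun _ _ _ _ => rfl
  have h2 := lintegral_joint_theta μ m (measurable_seen (measurable_lintegral_quenched hH) m)
    (measurable_const (a := (1 : ℝ≥0∞))) fun ω X X' hX => by simp only [seen]; rw [hX m le_rfl]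
  simp only [one_mul, mul_one, lintegral_const, measure_univ] at h1 h2
  rw [h1, h2]
  refine tsum_congr fun a => lintegral_congr fun ω => ?_
  rw [mul_comm]
  rfl

variable {P Q : Measure (Env d)}

/-- A jump of a given length at a given site is a local event, and it is never seen along the walk
because bounded environments are preserved by shifts. -/
theorem IsAverageLimit.ae_mem_boundedEnv [IsProbabilityMeasure P] (hQ : IsAverageLimit P u Q)
    (hb : ∀ᵐ ω ∂P, ω ∈ boundedEnv d M) : ∀ᵐ ω ∂Q, ω ∈ boundedEnv d M := by
  simp only [boundedEnv, Set.mem_ofPred_eq]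
  rw [ae_all_iff]
  intro x
  rw [ae_all_iff]
  intro z
  by_cases hz : M < euclNorm z
  · have hs : MeasurableSet {ω : Env d | ω x z = 0}ᶜ :=
      (measurable_weight x z (measurableSet_singleton 0)).compl
    have hlim := hQ ({ω : Env d | ω x z = 0}ᶜ.indicator 1) (x ⬝ᵥ u) (measurable_one.indicator hs)
      (fun ω => Set.indicator_le_self' (by simp) ω) (fun ω => indicator_one_congr (by
        simp only [Set.mem_compl_iff, Set.mem_ofPred_eq]
        rw [cut, envOn_of_mem (mem_halfSpace.2 le_rfl)]))
    have h0 : ∀ n, ∫⁻ y, seen ({ω : Env d | ω x z = 0}ᶜ.indicator 1) n y ∂joint P = 0 := by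
      intro n
      rw [lintegral_eq_zero_iff (measurable_seen (measurable_one.indicator hs) n)]
      filter_upwards [ae_joint_bounded P hb] with y hy
      simp only [seen]
      rw [Set.indicator_of_notMem]
      · rfl
      · simp only [Set.mem_compl_iff, Set.mem_ofPred_eq, not_not]
        exact shift_mem_boundedEnv hy _ x z hz
    simp only [h0, Finset.sum_const_zero, ENNReal.zero_div] at hlim
    have h1 := tendsto_nhds_unique tendsto_const_nhds hlim
    rw [lintegral_indicator_one hs] at h1
    have h2 : ∀ᵐ ω ∂Q, ω x z = 0 := h1.symm
    filter_upwards [h2] with ω hω _ using hω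
  · simp [hz]

/-- Averages along the walk of a local functional of environment and walk. -/
theorem IsAverageLimit.tendsto_joint [IsProbabilityMeasure P] [IsProbabilityMeasure Q]
    (hQ : IsAverageLimit P u Q) (hb : ∀ᵐ ω ∂P, ω ∈ boundedEnv d M)
    (hc : ∀ z : Site d, euclNorm z ≤ M → |z ⬝ᵥ u| ≤ c) {H : Env d × Path d → ℝ≥0∞}
    (hH : Measurable H) {C : ℝ≥0∞} (hC : C ≠ ⊤) (hC0 : C ≠ 0) (hHC : ∀ y, H y ≤ C) {K r : ℕ}
    (hK : ∀ ω X X', (∀ i ≤ K, X i = X' i) → H (ω, X) = H (ω, X'))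
    (hcut : ∀ ω, ∀ X ∈ slowPaths u c, H (cut u (-r) ω, X) = H (ω, X)) :
    Tendsto (fun N : ℕ => (∑ m ∈ Finset.range N, ∫⁻ y, H (theta m y) ∂joint P) / N)
      atTop (nhds (∫⁻ y, H y ∂joint Q)) := by
  -- The walk descends at most `c * K` levels in `K` steps, and `H` looks back `r` levels.
  set R : ℕ := r + c * K with hR
  set F : Env d → ℝ≥0∞ := fun ω => ∫⁻ X, H (ω, X) ∂quenched ω 0 with hF
  have hFm : Measurable F := measurable_lintegral_quenched hH
  have hcutm : Measurable (cut u (-R)) := measurable_envOn _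
  have hcutR : ∀ ω, ∀ X ∈ slowPaths u c, H (cut u (-R) ω, X) = H (ω, X) := by
    intro ω X hX
    rw [← hcut _ X hX, cut_cut u (by omega), hcut ω X hX]
  have hG : ∀ ω ∈ boundedEnv d M, F (cut u (-R) ω) = F ω := by
    intro ω hω
    calc F (cut u (-R) ω) = ∫⁻ X, H (cut u (-R) ω, X) ∂quenched ω 0 :=
          lintegral_quenched_congr (fun X X' => hK _ X X')
            fun a _ => quenched_cut_cyl hc hω (by omega) a
      _ = F ω := lintegral_congr_ae
          ((quenched_ae_slow hc hω).mono fun X hX => hcutR ω X hX)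
  have hFC : ∀ ω, F ω ≤ C := by
    intro ω
    refine (lintegral_mono fun X => hHC (ω, X)).trans ?_
    simp
  -- Division by `C` is needed because `IsAverageLimit` concerns functionals bounded by one.
  have hlim := hQ (fun ω => F (cut u (-R) ω) / C) (-R) ((hFm.comp hcutm).div_const C)
    (fun ω => ENNReal.div_le_of_le_mul (by simpa using hFC _))
    (fun ω => by rw [cut_cut u le_rfl])
  have h0 : ∫⁻ ω, F (cut u (-R) ω) ∂Q = ∫⁻ ω, F ω ∂Q := by
    refine lintegral_congr_ae ?_
    filter_upwards [hQ.ae_mem_boundedEnv hb] with ω hω using hG ω hω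
  have h1 : ∫⁻ ω, F (cut u (-R) ω) / C ∂Q = (∫⁻ y, H y ∂joint Q) / C := by
    simp only [div_eq_mul_inv]
    rw [lintegral_mul_const _ (show Measurable fun ω => F (cut u (-R) ω) from hFm.comp hcutm),
      h0, lintegral_joint Q hH]
  have h2 : ∀ m, ∫⁻ y, seen (fun ω => F (cut u (-R) ω) / C) m y ∂joint P
      = (∫⁻ y, H (theta m y) ∂joint P) / C := by
    intro m
    rw [lintegral_joint_markov P hH]
    simp only [div_eq_mul_inv]
    rw [← lintegral_mul_const _ (measurable_seen hFm m)]
    refine lintegral_congr_ae ?_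
    filter_upwards [ae_joint_bounded P hb] with y hy
    simp only [seen]
    rw [hG _ (shift_mem_boundedEnv hy _)]
  rw [h1] at hlim
  simp only [h2] at hlim
  have h3 := ENNReal.Tendsto.const_mul (a := C) hlim (Or.inr hC)
  rw [ENNReal.mul_div_cancel hC0 hC] at h3
  refine h3.congr fun N => ?_
  simp only [div_eq_mul_inv]
  rw [← Finset.sum_mul, ← mul_assoc, ← mul_assoc, mul_comm C, mul_assoc _ C C⁻¹,
    ENNReal.mul_inv_cancel hC0 hC, mul_one]

end slow

end RWRE

/-! ### Invariance, the block bound, and the variation distance to the original law. -/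

namespace RWRE

variable {d : ℕ} {P Q : Measure (Env d)} {u : Site d} {M : ℝ} {c : ℕ}

theorem seen_cut {f : Env d → ℝ≥0∞} {r R n : ℕ} (hf : ∀ ω, f (cut u (-r) ω) = f ω) (ω : Env d)
    {X : Path d} (h : -(R : ℤ) ≤ -r + X n ⬝ᵥ u) :
    seen f n (cut u (-R) ω, X) = seen f n (ω, X) := by
  simp only [seen]
  rw [← hf, cut_shift, cut_cut u h, ← cut_shift, hf]

/-- Functionals of the environment at finitely many sites. -/
theorem exists_radius {A : Set (Env d)} (hA : A ∈ measurableCylinders fun _ : Site d => PMF (Site d))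
    (u : Site d) : ∃ r : ℕ, (∀ ω, A.indicator (1 : Env d → ℝ≥0∞) (cut u (-r) ω) = A.indicator 1 ω) ∧
      ∀ ω ω' : Env d, (∀ x, x ⬝ᵥ u < r → ω x = ω' x) →
        A.indicator (1 : Env d → ℝ≥0∞) ω = A.indicator 1 ω' := by
  obtain ⟨J, S, -, rfl⟩ := (mem_measurableCylinders _).1 hA
  have hJ : ∀ x ∈ J, (x ⬝ᵥ u).natAbs < ∑ x ∈ J, (x ⬝ᵥ u).natAbs + 1 := fun x hx =>
    Nat.lt_succ_of_le (Finset.single_le_sum (f := fun x => (x ⬝ᵥ u).natAbs)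
      (fun _ _ => Nat.zero_le _) hx)
  have key : ∀ ω ω' : Env d, (∀ x ∈ J, ω x = ω' x) →
      (cylinder J S).indicator (1 : Env d → ℝ≥0∞) ω = (cylinder J S).indicator 1 ω' := by
    intro ω ω' h
    refine indicator_one_congr ?_
    rw [mem_cylinder, mem_cylinder]
    have : J.restrict ω = J.restrict ω' := funext fun x => h x x.2
    rw [this]
  refine ⟨∑ x ∈ J, (x ⬝ᵥ u).natAbs + 1, fun ω => key _ _ fun x hx => ?_, fun ω ω' h =>
    key _ _ fun x hx => h x ?_⟩
  · refine envOn_of_mem ?_ ω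
    have := hJ x hx
    rw [mem_halfSpace]
    omega
  · have := hJ x hx
    omega

theorem envKernel_apply_eq (ω : Env d) {A : Set (Env d)} (hA : MeasurableSet A) :
    envKernel d ω A = ∫⁻ X, seen (A.indicator 1) 1 (ω, X) ∂quenched ω 0 := by
  have hm : Measurable fun X : Path d => shift (X 1) ω :=
    (measurable_theta_aux 1).comp measurable_prodMk_left
  change (quenched ω 0).map (fun X => shift (X 1) ω) A = _
  rw [← lintegral_indicator_one hA, lintegral_map (measurable_one.indicator hA) hm]
  rfl

/-- Delaying the observation by one step changes a sum along the walk by at most one, so the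
averages have the same limit. Cylinder events determine the measure. -/
theorem IsAverageLimit.invariant [IsProbabilityMeasure P] [IsProbabilityMeasure Q]
    (hQ : IsAverageLimit P u Q) (hb : ∀ᵐ ω ∂P, ω ∈ boundedEnv d M)
    (hc : ∀ z : Site d, euclNorm z ≤ M → |z ⬝ᵥ u| ≤ c) : Kernel.Invariant (envKernel d) Q := by
  have hmark : IsMarkovKernel (envKernel d) := ⟨fun ω =>
    Measure.isProbabilityMeasure_map
      ((measurable_theta_aux 1).comp measurable_prodMk_left).aemeasurable⟩
  rw [Kernel.Invariant]
  refine ext_of_generate_finite _ (generateFrom_measurableCylinders).symm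
    isPiSystem_measurableCylinders ?_ (by simp)
  intro A hA
  have hAm := MeasurableSet.of_mem_measurableCylinders hA
  obtain ⟨r, hr, -⟩ := exists_radius hA u
  have hf : Measurable (A.indicator (1 : Env d → ℝ≥0∞)) := measurable_one.indicator hAm
  have hf1 : ∀ ω, A.indicator (1 : Env d → ℝ≥0∞) ω ≤ 1 := fun ω => Set.indicator_le_self' (by simp) ω
  have h1 : (Q.bind (envKernel d)) A = ∫⁻ y, seen (A.indicator 1) 1 y ∂joint Q := by
    rw [Measure.bind_apply hAm (envKernel d).aemeasurable, lintegral_joint Q (measurable_seen hf 1)]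
    exact lintegral_congr fun ω => envKernel_apply_eq ω hAm
  rw [h1, ← lintegral_indicator_one hAm]
  have hlim := hQ.tendsto_joint hb hc (measurable_seen hf 1) ENNReal.one_ne_top one_ne_zero
    (fun y => hf1 _) (K := 1) (r := r + c) (fun ω X X' h => by simp only [seen]; rw [h 1 le_rfl])
    (fun ω X hX => by
      refine seen_cut hr ω ?_
      have := (abs_le.1 (abs_level_le hX 1)).1
      push_cast at this ⊢
      linarith)
  refine tendsto_nhds_unique hlim
    (tendsto_div_of_le_add ENNReal.one_ne_top (fun N => ?_) (fun N => ?_) (hQ _ (-r) hf hf1 hr))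
  · simp only [seen_theta]
    have h2 := Finset.sum_range_succ' (fun m => ∫⁻ y, seen (A.indicator 1) m y ∂joint P) N
    have h3 := Finset.sum_range_succ (fun m => ∫⁻ y, seen (A.indicator 1) m y ∂joint P) N
    have h4 : ∫⁻ y, seen (A.indicator 1) N y ∂joint P ≤ 1 :=
      (lintegral_mono fun y => hf1 _).trans (by simp)
    calc _ ≤ ∑ m ∈ Finset.range (N + 1), ∫⁻ y, seen (A.indicator 1) m y ∂joint P := by
          rw [h2]
          refine le_trans (le_of_eq ?_) le_self_add
          exact Finset.sum_congr rfl fun m _ => by rw [add_comm m 1]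
      _ ≤ _ := by
          rw [h3]
          gcongr
  · simp only [seen_theta]
    have h2 := Finset.sum_range_succ' (fun m => ∫⁻ y, seen (A.indicator 1) m y ∂joint P) N
    have h4 : ∫⁻ y, seen (A.indicator 1) 0 y ∂joint P ≤ 1 :=
      (lintegral_mono fun y => hf1 _).trans (by simp)
    calc _ ≤ ∑ m ∈ Finset.range (N + 1), ∫⁻ y, seen (A.indicator 1) m y ∂joint P :=
          Finset.sum_le_sum_of_subset (Finset.range_mono (Nat.le_succ N))
      _ ≤ _ := by
          rw [h2]
          refine add_le_add (le_of_eq ?_) h4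
          exact Finset.sum_congr rfl fun m _ => by rw [add_comm m 1]

/-- Limits of averages of a subadditive functional are bounded by its mean over one block. -/
theorem le_lintegral_blockSum (hP : HasRegenSecondMoment P u) {V : ℕ → Env d × Path d → ℝ≥0∞}
    (hV : ∀ m, Measurable (V m)) (hcut : ∀ m ω X, X ∈ stays u → V m (cut u 0 ω, X) = V m (ω, X))
    (hshift : ∀ n m y, IsRegeneration u y.2 n → n ≤ m → V m y ≤ V (m - n) (theta n y))
    {C : ℝ≥0∞} (hC : C ≠ ⊤) (hVC : ∀ m y, V m y ≤ C) {a : ℕ → ℝ≥0∞} {e l : ℝ≥0∞}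
    (ha : ∀ N : ℕ, a N ≤ N * e + ∑ m ∈ Finset.range N, ∫⁻ y, V m y ∂joint P)
    (hlim : Tendsto (fun N : ℕ => a N / N) atTop (nhds l)) :
    l ≤ e + ∫⁻ y, blockSum u V y ∂condJoint P u := by
  -- Under `joint` the first block has a different law from the later ones. Its contribution is
  -- finite and disappears after division by `N`.
  have hfin : ∫⁻ y, blockSum u V y ∂joint P ≠ ⊤ := by
    refine ne_top_of_le_ne_top (ENNReal.mul_ne_top hP.lintegral_regenTime_joint hC) ?_
    rw [← lintegral_mul_const _ (measurable_regenTime u)]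
    refine lintegral_mono_ae ?_
    filter_upwards [hP.ae_joint_ne_top] with y hy
    rw [firstTime_zero] at hy
    exact blockSum_le_mul hy fun m _ => hVC m y
  set B := ∫⁻ y, blockSum u V y ∂condJoint P u
  have h1 : Tendsto (fun N : ℕ => (∫⁻ y, blockSum u V y ∂joint P) / N + (e + B)) atTop
      (nhds (0 + (e + B))) := (tendsto_const_div_natCast hfin).add_const _
  rw [zero_add] at h1
  refine le_of_tendsto_of_tendsto hlim h1 ?_
  filter_upwards [eventually_gt_atTop 0] with N hN
  have hN0 : (N : ℝ≥0∞) ≠ 0 := by exact_mod_cast hN.ne'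
  have hNtop : (N : ℝ≥0∞) ≠ ⊤ := ENNReal.natCast_ne_top N
  calc a N / N ≤ (∫⁻ y, blockSum u V y ∂joint P + N * (e + B)) / N := by
        refine ENNReal.div_le_div_right ((ha N).trans ?_) _
        rw [mul_add, add_left_comm]
        exact add_le_add_right (sum_lintegral_joint_le hP hV hcut hshift N) _
    _ = _ := by rw [ENNReal.add_div, mul_comm, ENNReal.mul_div_cancel_right hN0 hNtop]

theorem ae_condJoint_slow [IsProbabilityMeasure P] (hb : ∀ᵐ ω ∂P, ω ∈ boundedEnv d M)
    (hc : ∀ z : Site d, euclNorm z ≤ M → |z ⬝ᵥ u| ≤ c) :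
    ∀ᵐ y ∂condJoint P u, y.2 ∈ slowPaths u c :=
  (condJoint_absolutelyContinuous P u).ae_le (ae_joint_slow hc P hb)

/-- Chebyshev's argument: the factor `(τ₁ / a) ^ (p₀ - s)` is at least one. -/
theorem indicator_regenTime_le {p₀ s a : ℝ} (hs : s ≤ p₀) (ha : 0 < a) {X : Path d}
    (hX : regenTime u X ≠ ⊤) (h : ENNReal.ofReal a ≤ regenTime u X) :
    regenTime u X ^ s ≤ ENNReal.ofReal (a⁻¹ ^ (p₀ - s)) * regenTime u X ^ p₀ := by
  have h0 : regenTime u X ≠ 0 := (lt_of_lt_of_le zero_lt_one (one_le_regenTime u X)).ne'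
  have h1 : 1 ≤ ENNReal.ofReal a⁻¹ * regenTime u X := by
    calc (1 : ℝ≥0∞) = ENNReal.ofReal a⁻¹ * ENNReal.ofReal a := by
          rw [← ENNReal.ofReal_mul (by positivity), inv_mul_cancel₀ ha.ne', ENNReal.ofReal_one]
      _ ≤ _ := mul_le_mul_right h _
  have h2 : p₀ = (p₀ - s) + s := by ring
  calc regenTime u X ^ s = 1 * regenTime u X ^ s := (one_mul _).symm
    _ ≤ (ENNReal.ofReal a⁻¹ * regenTime u X) ^ (p₀ - s) * regenTime u X ^ s :=
        mul_le_mul_left (le_trans (ENNReal.one_rpow (p₀ - s)).ge (ENNReal.rpow_le_rpow h1 (by linarith))) _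
    _ = _ := by
        rw [ENNReal.mul_rpow_of_nonneg _ _ (by linarith), mul_assoc,
          ← ENNReal.rpow_add _ _ h0 hX, ← h2, ENNReal.ofReal_rpow_of_nonneg (by positivity)
          (by linarith)]

theorem lintegral_indicator_regenTime_le (hP : HasRegenSecondMoment P u) {p₀ s a : ℝ} (hs : s ≤ p₀)
    (ha : 0 < a) :
    ∫⁻ y, {y : Env d × Path d | ENNReal.ofReal a ≤ regenTime u y.2}.indicator
        (fun y => regenTime u y.2 ^ s) y ∂condJoint P u
      ≤ ENNReal.ofReal (a⁻¹ ^ (p₀ - s)) * ∫⁻ y, regenTime u y.2 ^ p₀ ∂condJoint P u := by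
  rw [← lintegral_const_mul _ ((measurable_regenTime u).pow_const p₀)]
  refine lintegral_mono_ae ?_
  filter_upwards [hP.ae_condJoint_ne_top] with y hy
  rw [firstTime_zero] at hy
  by_cases h : ENNReal.ofReal a ≤ regenTime u y.2
  · rw [Set.indicator_of_mem (by exact h)]
    exact indicator_regenTime_le hs ha hy h
  · rw [Set.indicator_of_notMem (by exact h)]
    exact zero_le

section variation

/-- The walk has been at least `l` above its position at time `m`. -/
def fellBack (u : Site d) (l m : ℕ) : Set (Env d × Path d) :=
  {y | ∃ i ≤ m, y.2 m ⬝ᵥ u + l ≤ y.2 i ⬝ᵥ u}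

theorem measurableSet_fellBack (u : Site d) (l m : ℕ) :
    MeasurableSet (fellBack u l m : Set (Env d × Path d)) := by
  have hl : ∀ k, Measurable fun y : Env d × Path d => y.2 k ⬝ᵥ u :=
    fun k => (measurable_level u k).comp measurable_snd
  refine measurableSet_setOfPred.2 (Measurable.exists fun i => ?_)
  exact measurableSet_setOfPred.1 ((MeasurableSet.const _).inter
    (measurableSet_le ((hl m).add measurable_const) (hl i)))

/-- Off `fellBack` no site visited up to time `m` is at level `X_m + l` or higher. The environment
there is independent of the path, and by shift invariance `f` has its mean under `P`. -/
theorem lintegral_seen_le_add (hP : IsIIDProduct P) {f : Env d → ℝ≥0∞} (hf : Measurable f)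
    (hf1 : ∀ ω, f ω ≤ 1) {l : ℕ} (hcut : ∀ ω, f (cut u l ω) = f ω) (m : ℕ) :
    ∫⁻ y, seen f m y ∂joint P ≤ ∫⁻ ω, f ω ∂P + ∫⁻ y, (fellBack u l m).indicator 1 y ∂joint P := by
  have := isProbabilityMeasure_of_isIIDProduct hP
  have hS := measurableSet_fellBack (d := d) u l m
  have hdep : ∀ ω X X', (∀ i ≤ m, X i = X' i) →
      (fellBack u l m)ᶜ.indicator (1 : Env d × Path d → ℝ≥0∞) (ω, X)
        = (fellBack u l m)ᶜ.indicator 1 (ω, X') := by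
    intro ω X X' hX
    refine indicator_one_congr ?_
    simp only [fellBack, Set.mem_compl_iff, Set.mem_ofPred_eq, not_exists, not_and]
    refine forall₂_congr fun i hi => ?_
    rw [hX i hi, hX m le_rfl]
  have hone := lintegral_joint_theta P m (measurable_one.indicator hS.compl)
    (measurable_const (a := (1 : ℝ≥0∞))) hdep
  have hdec := lintegral_joint_theta P m (measurable_one.indicator hS.compl)
    (hf.comp measurable_fst) hdep
  simp only [mul_one, lintegral_const, measure_univ, Function.comp] at hone hdec
  have hfac : ∫⁻ y, (fellBack u l m)ᶜ.indicator 1 y * f (theta m y).1 ∂joint P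
      = (∫⁻ y, (fellBack u l m)ᶜ.indicator 1 y ∂joint P) * ∫⁻ ω, f ω ∂P := by
    rw [hdec, hone, ← ENNReal.tsum_mul_right]
    refine tsum_congr fun a => ?_
    rw [← lintegral_shift hP (extend a m) hf]
    have hdisj : Disjoint {x : Site d | x ⬝ᵥ u < extend a m ⬝ᵥ u + l}
        (halfSpace u (l + extend a m ⬝ᵥ u)) := by
      rw [Set.disjoint_left]
      intro x hx hx'
      rw [mem_halfSpace] at hx'
      have hx : x ⬝ᵥ u < extend a m ⬝ᵥ u + l := hx
      omega
    refine lintegral_envOn_mul hP hdisj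
      (((measurable_one.indicator hS.compl).comp measurable_prodMk_right).mul
        (measurable_quenched_cyl _ _)) (hf.comp (measurable_shift _)) ?_ ?_
    · intro ω
      by_cases h : ∃ i ≤ m, extend a m ⬝ᵥ u + l ≤ extend a i ⬝ᵥ u
      · have h' : ∀ ω' : Env d, (fellBack u l m)ᶜ.indicator (1 : Env d × Path d → ℝ≥0∞)
            (ω', extend a) = 0 := fun ω' => Set.indicator_of_notMem (s := (fellBack u l m)ᶜ)
            (fun hn => hn (by exact h)) _
        rw [h', h', zero_mul, zero_mul]
      · have h' : ∀ ω' : Env d, (fellBack u l m)ᶜ.indicator (1 : Env d × Path d → ℝ≥0∞)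
            (ω', extend a) = 1 := fun ω' => Set.indicator_of_mem (s := (fellBack u l m)ᶜ)
            (fun hn => h (by exact hn)) _
        push Not at h
        rw [h', h', quenched_cyl_congr fun i hi => envOn_of_mem (by exact h i hi.le) ω]
    · intro ω
      show f (shift (extend a m) _) = f (shift (extend a m) _)
      rw [← hcut, cut_shift, cut_cut u le_rfl, ← cut_shift, hcut]
  have hle : ∀ y, seen f m y ≤ (fellBack u l m)ᶜ.indicator 1 y * f (theta m y).1
      + (fellBack u l m).indicator 1 y := by
    intro y
    by_cases h : y ∈ fellBack u l m
    · rw [Set.indicator_of_mem h]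
      exact (hf1 _).trans le_add_self
    · rw [Set.indicator_of_mem (s := (fellBack u l m)ᶜ) h, Set.indicator_of_notMem h, Pi.one_apply,
        one_mul, add_zero]
      rfl
  refine (lintegral_mono hle).trans ?_
  rw [lintegral_add_right _ (measurable_one.indicator hS), hfac]
  gcongr
  refine mul_le_of_le_one_left' ((lintegral_mono fun y => Set.indicator_le_self' (by simp) y).trans ?_)
  simp

/-- Under `condJoint` the walk is nonnegative and gains at most `c` levels per step, so having
fallen back by `l` before `τ₁` forces `τ₁ ≥ l / c`. The block sum is therefore at most `τ₁` on that
event and zero elsewhere. -/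
theorem lintegral_le_add_of_cut (hP : HasRegenSecondMoment P u) (hQ : IsAverageLimit P u Q)
    (hb : ∀ᵐ ω ∂P, ω ∈ boundedEnv d M) (hc1 : 1 ≤ c)
    (hc : ∀ z : Site d, euclNorm z ≤ M → |z ⬝ᵥ u| ≤ c) {p₀ : ℝ} (hp₀ : 1 ≤ p₀)
    {f : Env d → ℝ≥0∞} (hf : Measurable f) (hf1 : ∀ ω, f ω ≤ 1) {l : ℕ} (hl : 1 ≤ l)
    (hcut : ∀ ω, f (cut u l ω) = f ω) :
    ∫⁻ ω, f ω ∂Q ≤ ∫⁻ ω, f ω ∂P + ENNReal.ofReal (((l : ℝ) / c)⁻¹ ^ (p₀ - 1))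
      * ∫⁻ y, regenTime u y.2 ^ p₀ ∂condJoint P u := by
  have hprob := hP.isProbabilityMeasure
  have hc0 : (0 : ℝ) < c := by exact_mod_cast hc1
  have hl0 : (0 : ℝ) < l := by exact_mod_cast hl
  refine (le_lintegral_blockSum hP (V := fun m => (fellBack u l m).indicator 1)
    (fun m => measurable_one.indicator (measurableSet_fellBack u l m)) (fun m ω X _ => rfl) ?_
    ENNReal.one_ne_top (fun m y => Set.indicator_le_self' (by simp) y) (e := ∫⁻ ω, f ω ∂P)
    (a := fun N => ∑ n ∈ Finset.range N, ∫⁻ y, seen f n y ∂joint P) ?_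
    (hQ f l hf hf1 hcut)).trans ?_
  · intro n m y hn hnm
    by_cases h : y ∈ fellBack u l m
    · obtain ⟨i, hi, h1⟩ := h
      have h2 : theta n y ∈ fellBack u l (m - n) := by
        -- Before the regeneration `n` the walk was below `X_n`, hence below `X_m`; the high point
        -- comes later.
        have h3 : n ≤ i := by
          by_contra hlt
          have h4 := hn.2.1 i (by omega)
          have h5 := hn.2.2 m hnm
          omega
        refine ⟨i - n, by omega, ?_⟩
        simp only [theta, pathShift, sub_dotProduct]
        rw [Nat.add_sub_cancel' hnm, Nat.add_sub_cancel' h3]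
        omega
      rw [Set.indicator_of_mem h2]
      exact Set.indicator_le_self' (by simp) y
    · rw [Set.indicator_of_notMem h]
      exact zero_le
  · intro N
    refine (Finset.sum_le_sum fun n _ => lintegral_seen_le_add hP.iid hf hf1 hcut n).trans ?_
    rw [Finset.sum_add_distrib, Finset.sum_const, Finset.card_range, nsmul_eq_mul]
  · refine add_le_add_right (le_trans (lintegral_mono_ae ?_)
      (lintegral_indicator_regenTime_le hP (s := 1) hp₀ (a := (l : ℝ) / c) (by positivity))) _
    filter_upwards [hP.ae_condJoint_ne_top, ae_condJoint_stays P u, ae_condJoint_slow hb hc]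
      with y hy hs hslow
    rw [firstTime_zero] at hy
    by_cases h : ENNReal.ofReal (l / c) ≤ regenTime u y.2
    · rw [Set.indicator_of_mem (by exact h), ENNReal.rpow_one]
      refine (blockSum_le_mul hy (W := 1) fun m _ => Set.indicator_le_self' (by simp) y).trans ?_
      rw [mul_one]
    · refine (blockSum_le_mul hy (W := 0) fun m hm => ?_).trans (by simp)
      rw [Set.indicator_of_notMem]
      rintro ⟨i, hi, h1⟩
      refine h (le_trans ?_ hm.le)
      rw [← ENNReal.ofReal_natCast]
      refine ENNReal.ofReal_le_ofReal ?_
      rw [div_le_iff₀ hc0]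
      have h2 := hs m
      have h3 := (abs_le.1 (abs_level_le hslow i)).2
      have h4 : (c : ℤ) * i ≤ c * m := by gcongr
      have h5 : (l : ℤ) ≤ m * c := by linarith
      exact_mod_cast h5

/-- The measurable sets unchanged by the cut form a σ-algebra, and it contains the generators. -/
theorem cut_mem_iff {l : ℤ} {A : Set (Env d)} (hA : MeasurableSet[levelSigma u l] A) (ω : Env d) :
    cut u l ω ∈ A ↔ ω ∈ A := by
  have h : levelSigma u l ≤ MeasurableSpace.invariants (cut u l) := by
    refine iSup₂_le fun x hx => ?_
    rintro _ ⟨t, ht, rfl⟩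
    refine MeasurableSpace.measurableSet_invariants.2 ⟨measurable_pi_apply x ht, ?_⟩
    ext ω
    simp only [Set.mem_preimage]
    rw [cut, envOn_of_mem hx]
  have h2 := (MeasurableSpace.measurableSet_invariants.1 (h A hA)).2
  exact Set.ext_iff.1 h2 ω

end variation

end RWRE

/-! ### Backtracking under the limit law. -/

namespace RWRE

variable {d : ℕ} {P Q : Measure (Env d)} {u : Site d} {M : ℝ} {c : ℕ}

theorem lintegral_averaged (μ : Measure (Env d)) [SFinite μ] {h : Path d → ℝ≥0∞}
    (hh : Measurable h) : ∫⁻ X, h X ∂averaged μ 0 = ∫⁻ y, h y.2 ∂joint μ := by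
  rw [averaged_eq_map, lintegral_map hh measurable_snd]

/-- Under the limit law, means of path functionals are bounded by means over one block. -/
theorem lintegral_averaged_le_blockSum [IsProbabilityMeasure Q] (hP : HasRegenSecondMoment P u)
    (hQ : IsAverageLimit P u Q) (hb : ∀ᵐ ω ∂P, ω ∈ boundedEnv d M)
    (hc : ∀ z : Site d, euclNorm z ≤ M → |z ⬝ᵥ u| ≤ c) {h : Path d → ℝ≥0∞} (hh : Measurable h)
    {C : ℝ≥0∞} (hC : C ≠ ⊤) (hC0 : C ≠ 0) (hhC : ∀ X, h X ≤ C) {K : ℕ}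
    (hK : ∀ X X', (∀ i ≤ K, X i = X' i) → h X = h X') :
    ∫⁻ X, h X ∂averaged Q 0
      ≤ ∫⁻ y, blockSum u (fun m y => h (pathShift m y.2)) y ∂condJoint P u := by
  have := hP.isProbabilityMeasure
  rw [lintegral_averaged Q hh]
  have hlim := hQ.tendsto_joint hb hc (H := fun y => h y.2) (hh.comp measurable_snd) hC hC0
    (fun y => hhC y.2) (K := K) (r := 0) (fun ω X X' hX => hK X X' hX) fun _ _ _ => rfl
  have := le_lintegral_blockSum hP (V := fun m y => h (pathShift m y.2))
    (fun m => hh.comp ((measurable_pathShift m).comp measurable_snd)) (fun _ _ _ _ => rfl)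
    (fun n m y _ hnm => ?_) hC (fun m y => hhC _) (e := 0) (fun N => ?_) hlim
  · simpa only [zero_add] using this
  · show h (theta m y).2 ≤ h (theta (m - n) (theta n y)).2
    rw [theta_theta, Nat.add_sub_cancel' hnm]
  · rw [mul_zero, zero_add]
    exact le_rfl

section backtracking

/-- How far the walk falls below level `0` in its first `K` steps. -/
def dip (u : Site d) (K : ℕ) (X : Path d) : ℕ :=
  (Finset.range (K + 1)).sup fun i => (-(X i ⬝ᵥ u)).toNat

theorem measurable_dip (u : Site d) (K : ℕ) : Measurable (dip u K) := by
  have h : dip u K = fun X => (Finset.range (K + 1)).sup' Finset.nonempty_range_add_one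
      fun i => (-(X i ⬝ᵥ u)).toNat := funext fun X => (Finset.sup'_eq_sup _ _).symm
  rw [h]
  exact Finset.measurable_range_sup'' fun i _ =>
    (measurable_of_countable fun z : ℤ => (-z).toNat).comp (measurable_level u i)

theorem dip_mono (u : Site d) (X : Path d) : Monotone fun K => dip u K X := fun _ _ h =>
  Finset.sup_mono (Finset.range_mono (Nat.succ_le_succ h))

theorem le_dip {K i : ℕ} (h : i ≤ K) (u : Site d) (X : Path d) : -(dip u K X : ℤ) ≤ X i ⬝ᵥ u := by
  have := Finset.le_sup (f := fun i => (-(X i ⬝ᵥ u)).toNat) (Finset.mem_range_succ_iff.2 h)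
  change _ ≤ dip u K X at this
  omega

theorem dip_le {K N : ℕ} {X : Path d} (h : ∀ i, -(N : ℤ) ≤ X i ⬝ᵥ u) : dip u K X ≤ N :=
  Finset.sup_le fun i _ => by
    have := h i
    omega

theorem dip_le_of_slow {X : Path d} (h : X ∈ slowPaths u c) (K : ℕ) : dip u K X ≤ c * K :=
  Finset.sup_le fun i hi => by
    have h1 := (abs_le.1 (abs_level_le h i)).1
    have h2 : (c : ℤ) * i ≤ c * K := by
      gcongr
      exact_mod_cast Finset.mem_range_succ_iff.1 hi
    have h3 : ((c * K : ℕ) : ℤ) = c * K := by push_cast; rfl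
    omega

/-- Since `X 0 = 0` the infimum is at most zero, so its absolute value is a depth below level zero.
-/
theorem backtrack_le_iSup_dip {X : Path d} (h0 : X 0 = 0) :
    backtrack u X ≤ ⨆ K, (dip u K X : ℝ≥0∞) := by
  by_cases hS : ⨆ K, (dip u K X : ℝ≥0∞) = ⊤
  · rw [hS]
    exact le_top
  set s := (⨆ K, (dip u K X : ℝ≥0∞)).toReal with hs
  have h1 : ∀ n, -s ≤ ((X n ⬝ᵥ u : ℤ) : ℝ) := fun n => by
    have h2 : ((dip u n X : ℕ) : ℝ) ≤ s := by
      have := ENNReal.toReal_mono hS (le_iSup (fun K => (dip u K X : ℝ≥0∞)) n)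
      simpa using this
    have h3 : -((dip u n X : ℕ) : ℝ) ≤ ((X n ⬝ᵥ u : ℤ) : ℝ) := by
      exact_mod_cast le_dip le_rfl u X
    linarith
  have hlow : ((-s : ℝ) : EReal) ≤ ⨅ n : ℕ, (((X n ⬝ᵥ u : ℤ) : ℝ) : EReal) :=
    le_iInf fun n => by exact_mod_cast h1 n
  have hup : (⨅ n : ℕ, (((X n ⬝ᵥ u : ℤ) : ℝ) : EReal)) ≤ ((0 : ℝ) : EReal) :=
    (iInf_le _ 0).trans (by simp [h0])
  rw [← ENNReal.ofReal_toReal hS, ← hs, backtrack]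
  generalize (⨅ n : ℕ, (((X n ⬝ᵥ u : ℤ) : ℝ) : EReal)) = I at *
  induction I with
  | bot => simp at hlow
  | top => simp at hup
  | coe x =>
    rw [EReal.abs_def]
    refine ENNReal.ofReal_le_ofReal (abs_le.2 ⟨by exact_mod_cast hlow, ?_⟩)
    have hx : x ≤ 0 := by exact_mod_cast hup
    exact hx.trans ENNReal.toReal_nonneg

/-- Under `condJoint` the walk never goes below zero, so after a time `m < τ₁` it falls by at most
`X_m · u ≤ c * m`. The block sum is thus at most `τ₁ * (c * τ₁) ^ q`, which explains the exponent `q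
+ 1`. -/
theorem lintegral_backtrack_rpow_le [IsProbabilityMeasure Q] (hP : HasRegenSecondMoment P u)
    (hQ : IsAverageLimit P u Q) (hb : ∀ᵐ ω ∂P, ω ∈ boundedEnv d M)
    (hc : ∀ z : Site d, euclNorm z ≤ M → |z ⬝ᵥ u| ≤ c) {q : ℝ} (hq : 0 < q) :
    ∫⁻ X, backtrack u X ^ q ∂averaged Q 0
      ≤ (c : ℝ≥0∞) ^ q * ∫⁻ y, regenTime u y.2 ^ (q + 1) ∂condJoint P u := by
  have hprob := hP.isProbabilityMeasure
  have hbQ := hQ.ae_mem_boundedEnv hb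
  -- The cap `c * K` makes the functional bounded, as the block bound requires; almost surely it has
  -- no effect.
  let h : ℕ → Path d → ℝ≥0∞ := fun K X => ((min (dip u K X) (c * K) : ℕ) : ℝ≥0∞) ^ q
  have hh : ∀ K, Measurable (h K) := fun K => by
    exact (measurable_of_countable fun n : ℕ => ((min n (c * K) : ℕ) : ℝ≥0∞) ^ q).comp
      (measurable_dip u K)
  have hmono : Monotone h := fun K L hKL X => by
    refine ENNReal.rpow_le_rpow ?_ hq.le
    have h1 : min (dip u K X) (c * K) ≤ min (dip u L X) (c * L) :=
      min_le_min (dip_mono u X hKL) (Nat.mul_le_mul_left c hKL)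
    exact_mod_cast h1
  have hslow : ∀ᵐ X ∂averaged Q 0, X ∈ slowPaths u c := by
    rw [averaged_eq_map]
    exact (ae_map_iff measurable_snd.aemeasurable (measurableSet_slowPaths u c)).2
      (ae_joint_slow hc Q hbQ)
  calc ∫⁻ X, backtrack u X ^ q ∂averaged Q 0 ≤ ∫⁻ X, ⨆ K, h K X ∂averaged Q 0 := by
        refine lintegral_mono_ae ?_
        filter_upwards [hslow] with X hX
        have h1 : ⨆ K, h K X = (⨆ K, (dip u K X : ℝ≥0∞)) ^ q := by
          have h2 := (ENNReal.orderIsoRpow q hq).map_iSup fun K => (dip u K X : ℝ≥0∞)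
          simp only [ENNReal.orderIsoRpow_apply] at h2
          rw [h2]
          refine iSup_congr fun K => ?_
          simp only [h]
          rw [min_eq_left (dip_le_of_slow hX K)]
        rw [h1]
        exact ENNReal.rpow_le_rpow (backtrack_le_iSup_dip hX.1) hq.le
    _ = ⨆ K, ∫⁻ X, h K X ∂averaged Q 0 := lintegral_iSup hh hmono
    _ ≤ _ := iSup_le fun K => ?_
  refine (lintegral_averaged_le_blockSum hP hQ hb hc (hh K)
    (C := ((c * K : ℕ) : ℝ≥0∞) ^ q + 1) ?_ (by simp) ?_ (K := K) ?_).trans ?_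
  · exact ENNReal.add_ne_top.2 ⟨ENNReal.rpow_ne_top_of_nonneg hq.le (ENNReal.natCast_ne_top _),
      ENNReal.one_ne_top⟩
  · refine fun X => le_trans (ENNReal.rpow_le_rpow ?_ hq.le) le_self_add
    exact_mod_cast min_le_right _ _
  · intro X X' hX
    have : dip u K X = dip u K X' := Finset.sup_congr rfl fun i hi => by
      rw [hX i (Finset.mem_range_succ_iff.1 hi)]
    simp only [h, this]
  · rw [← lintegral_const_mul _ ((measurable_regenTime u).pow_const _)]
    refine lintegral_mono_ae ?_
    filter_upwards [hP.ae_condJoint_ne_top, ae_condJoint_stays P u, ae_condJoint_slow hb hc]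
      with y hy hs hX
    rw [firstTime_zero] at hy
    have h0 : regenTime u y.2 ≠ 0 := (lt_of_lt_of_le zero_lt_one (one_le_regenTime u y.2)).ne'
    refine (blockSum_le_mul hy (W := (c * regenTime u y.2) ^ q) fun m hm => ?_).trans_eq ?_
    · refine ENNReal.rpow_le_rpow ?_ hq.le
      have h1 : dip u K (pathShift m y.2) ≤ c * m := by
        refine dip_le fun i => ?_
        have h2 := (abs_le.1 (abs_level_le hX m)).2
        have h3 := hs (m + i)
        simp only [pathShift, sub_dotProduct]
        push_cast
        linarith
      calc ((min (dip u K (pathShift m y.2)) (c * K) : ℕ) : ℝ≥0∞) ≤ ((c * m : ℕ) : ℝ≥0∞) := by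
            exact_mod_cast (min_le_left _ _).trans h1
        _ ≤ _ := by
            push_cast
            gcongr
    · rw [ENNReal.mul_rpow_of_nonneg _ _ hq.le, ENNReal.rpow_add _ _ h0 hy, ENNReal.rpow_one]
      ring

end backtracking

end RWRE

/-! ### Slow progress under the limit law. -/

namespace RWRE

variable {d : ℕ} {P Q : Measure (Env d)} {u : Site d} {M : ℝ} {c : ℕ}

/-- Integration over the first regeneration time and the future after it. -/
theorem lintegral_le_add_of_isFirst {ρ : Measure (Env d × Path d)} (hρ : IsRegenerative P u ρ)
    (hfin : ∀ᵐ y ∂ρ, firstTime u 0 0 y.2 ≠ ⊤)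
    {G A Ψ : Env d × Path d → ℝ≥0∞} {φ : ℝ≥0∞ → ℝ≥0∞} (hA : Measurable A) (hΨ : Measurable Ψ)
    (hcut : ∀ ω X, X ∈ stays u → Ψ (cut u 0 ω, X) = Ψ (ω, X))
    (h : ∀ᵐ y ∂ρ, ∀ s : ℕ, IsFirst u 0 0 s y.2 → G y ≤ A y + φ s * Ψ (theta s y)) :
    ∫⁻ y, G y ∂ρ ≤ ∫⁻ y, A y ∂ρ
      + (∫⁻ y, φ (regenTime u y.2) ∂ρ) * ∫⁻ y, Ψ y ∂condJoint P u := by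
  rw [lintegral_isFirst hfin G, lintegral_isFirst hfin A,
    lintegral_isFirst hfin fun y => φ (regenTime u y.2), ← ENNReal.tsum_mul_right,
    ← ENNReal.tsum_add]
  refine ENNReal.tsum_le_tsum fun s => ?_
  have hS := measurableSet_isFirst (d := d) u 0 0 s
  have h1 : ∫⁻ y in {y : Env d × Path d | IsFirst u 0 0 s y.2}, φ (regenTime u y.2) ∂ρ
      = φ s * ρ {y | IsFirst u 0 0 s y.2} := by
    rw [← setLIntegral_const]
    refine setLIntegral_congr_fun hS fun y hy => ?_
    have hy : IsFirst u 0 0 s y.2 := hy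
    rw [← firstTime_zero, hy.firstTime_eq]
  have h2 : ∫⁻ y in {y | IsFirst u 0 0 s y.2}, φ s * Ψ (theta s y) ∂ρ
      = φ s * ρ {y | IsFirst u 0 0 s y.2} * ∫⁻ y, Ψ y ∂condJoint P u := by
    rw [lintegral_const_mul (φ s) (f := fun y => Ψ (theta s y)) (hΨ.comp (measurable_theta s)),
      hρ.setLIntegral_isFirst_future 0 0 s hΨ hcut, mul_assoc]
  rw [h1, ← h2, ← lintegral_add_left hA]
  refine lintegral_mono_ae ?_
  rw [ae_restrict_iff' hS]
  filter_upwards [h] with y hy hs using hy s hs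

/-- The walk is below level `k` at some time after `k * t`. -/
def staysLow (u : Site d) (t : ℝ) (k : ℕ) : Set (Env d × Path d) :=
  {y | ∃ j : ℕ, k * t ≤ j ∧ y.2 j ⬝ᵥ u < k}

theorem measurableSet_staysLow (u : Site d) (t : ℝ) (k : ℕ) :
    MeasurableSet (staysLow u t k : Set (Env d × Path d)) := by
  refine measurableSet_setOfPred.2 (Measurable.exists fun j => measurableSet_setOfPred.1 ?_)
  exact (MeasurableSet.const _).inter
    (measurableSet_lt ((measurable_level u j).comp measurable_snd) measurable_const)

theorem IsFirst.level_lt {n : ℕ} {X : Path d} (h : IsFirst u 0 0 n X) {k : ℕ} (hk : k < n) :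
    X k ⬝ᵥ u < X n ⬝ᵥ u := h.1.1.2.1 k hk

/-- Each regeneration gains at least one level. If `τ₁ < t`, the restarted walk has at most `k` of
the `k + 1` levels left to gain and at least `k * t` time units; induction turns this into a union
bound over `k` gaps. -/
theorem lintegral_staysLow_le (hP : HasRegenSecondMoment P u) {t : ℝ} (k : ℕ) :
    ∫⁻ y, (staysLow u t k).indicator 1 y ∂condJoint P u
      ≤ k * ∫⁻ y, {y : Env d × Path d | ENNReal.ofReal t ≤ regenTime u y.2}.indicator 1 y
        ∂condJoint P u := by
  have hprob := hP.isProbabilityMeasure_condJoint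
  have hm : MeasurableSet {y : Env d × Path d | ENNReal.ofReal t ≤ regenTime u y.2} :=
    measurableSet_le measurable_const (measurable_regenTime u)
  induction k with
  | zero =>
    rw [Nat.cast_zero, zero_mul, nonpos_iff_eq_zero, lintegral_eq_zero_iff
      (measurable_one.indicator (measurableSet_staysLow u t 0))]
    filter_upwards [ae_condJoint_stays P u] with y hy
    refine Set.indicator_of_notMem ?_ _
    rintro ⟨j, -, hj⟩
    have := hy j
    simp at hj
    omega
  | succ k ih =>
    have h := lintegral_le_add_of_isFirst (isRegenerative_condJoint hP.iid u)
      hP.ae_condJoint_ne_top (G := (staysLow u t (k + 1)).indicator 1)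
      (A := {y : Env d × Path d | ENNReal.ofReal t ≤ regenTime u y.2}.indicator 1)
      (Ψ := (staysLow u t k).indicator 1) (φ := fun _ => 1) (measurable_one.indicator hm)
      (measurable_one.indicator (measurableSet_staysLow u t k)) (fun _ _ _ => rfl) ?_
    · refine h.trans ?_
      rw [lintegral_const, measure_univ, one_mul, one_mul, Nat.cast_succ, add_mul, one_mul, add_comm]
      gcongr
    · filter_upwards [ae_condJoint_stays P u] with y hy s hs
      by_cases h1 : y ∈ staysLow u t (k + 1)
      swap
      · rw [Set.indicator_of_notMem h1]
        exact zero_le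
      by_cases h2 : ENNReal.ofReal t ≤ regenTime u y.2
      · rw [Set.indicator_of_mem h1, Set.indicator_of_mem (by exact h2)]
        exact le_self_add
      refine le_add_of_le_right ?_
      rw [one_mul, Set.indicator_of_mem h1, Set.indicator_of_mem]
      · exact le_rfl
      rw [← firstTime_zero, hs.firstTime_eq, not_le, ← ENNReal.ofReal_natCast] at h2
      have h3 := (ENNReal.ofReal_lt_ofReal_iff_of_nonneg (Nat.cast_nonneg s)).1 h2
      obtain ⟨j, hj, hjk⟩ := h1
      push_cast at hj hjk
      have hkt : 0 ≤ (k : ℝ) * t := by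
        have : (0 : ℝ) ≤ s := Nat.cast_nonneg s
        have : (0 : ℝ) ≤ t := by linarith
        positivity
      have hsj : s ≤ j := by
        have : (s : ℝ) ≤ j := by linarith
        exact_mod_cast this
      refine ⟨j - s, ?_, ?_⟩
      · rw [Nat.cast_sub hsj]
        linarith
      · have h4 := hs.level_lt hs.1.1.1
        have h5 := hy 0
        simp only [theta, pathShift, sub_dotProduct]
        rw [Nat.add_sub_cancel' hsj]
        omega

/-- In the block sum, either `τ₁ ≥ n / 2`, which is estimated by the moment of `τ₁`, or the walk
restarted at `τ₁` is still below level `ρ` after more than `n / 2` steps. The latter event is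
independent of `τ₁` and requires one of `ρ` gaps to be at least `t`. Since `ρ` is of order `√n` and
so is `t`, its probability is of order `n ^ ((1 - p₀) / 2)`. -/
theorem averaged_slow_le [IsProbabilityMeasure Q] (hP : HasRegenSecondMoment P u)
    (hQ : IsAverageLimit P u Q) (hb : ∀ᵐ ω ∂P, ω ∈ boundedEnv d M)
    (hc : ∀ z : Site d, euclNorm z ≤ M → |z ⬝ᵥ u| ≤ c) {p₀ : ℝ} (hp₀ : 1 ≤ p₀) {n : ℕ}
    (hn : 1 ≤ n) :
    averaged Q 0 {X | ((X n ⬝ᵥ u : ℤ) : ℝ) ≤ Real.sqrt n}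
      ≤ ENNReal.ofReal ((n : ℝ) ^ (-((p₀ - 1) / 2)))
        * (ENNReal.ofReal (2 ^ (p₀ - 1)) * ∫⁻ y, regenTime u y.2 ^ p₀ ∂condJoint P u
          + (∫⁻ y, regenTime u y.2 ^ p₀ ∂condJoint P u) * (ENNReal.ofReal (2 * 4 ^ p₀)
            * ∫⁻ y, regenTime u y.2 ^ p₀ ∂condJoint P u)) := by
  set T := ∫⁻ y, regenTime u y.2 ^ p₀ ∂condJoint P u
  have hn0 : (0 : ℝ) < n := by exact_mod_cast hn
  have hn1 : (1 : ℝ) ≤ n := by exact_mod_cast hn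
  -- The least integer strictly above `√n`; `t` below is chosen so that `ρ * t = n / 2`.
  set ρ : ℕ := Nat.sqrt n + 1 with hρ
  have hρ0 : (0 : ℝ) < ρ := by positivity
  have hsq1 : 1 ≤ Real.sqrt n := Real.one_le_sqrt.2 hn1
  have hsq0 : 0 < Real.sqrt n := by linarith
  have hρ2 : (ρ : ℝ) ≤ 2 * Real.sqrt n := by
    have h1 : ((Nat.sqrt n : ℕ) : ℝ) ≤ Real.sqrt n := Real.nat_sqrt_le_real_sqrt
    rw [hρ]
    push_cast
    linarith
  have hρ3 : Real.sqrt n < ρ := by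
    rw [hρ]
    push_cast
    exact Real.real_sqrt_lt_nat_sqrt_succ
  set t : ℝ := n / (2 * ρ) with ht
  have ht0 : 0 < t := by positivity
  have hρt : ρ * t = n / 2 := by
    rw [ht]
    field_simp
  set S : Set (Path d) := {X | ((X n ⬝ᵥ u : ℤ) : ℝ) ≤ Real.sqrt n} with hSdef
  have hS : MeasurableSet S :=
    ((measurable_of_countable fun z : ℤ => (z : ℝ)).comp (measurable_level u n))
      measurableSet_Iic
  have hlow := measurableSet_staysLow u t ρ
  have hE : ∫⁻ y, (staysLow u t ρ).indicator 1 y ∂condJoint P u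
      ≤ ENNReal.ofReal ((n : ℝ) ^ (-((p₀ - 1) / 2))) * (ENNReal.ofReal (2 * 4 ^ p₀) * T) := by
    have h1 := lintegral_indicator_regenTime_le hP (s := 0) (p₀ := p₀) (by linarith) ht0
    simp only [ENNReal.rpow_zero, sub_zero] at h1
    refine (lintegral_staysLow_le hP ρ).trans ((mul_le_mul_right h1 _).trans ?_)
    rw [← mul_assoc, ← mul_assoc, ← ENNReal.ofReal_natCast, ← ENNReal.ofReal_mul (by positivity),
      ← ENNReal.ofReal_mul (by positivity)]
    refine mul_le_mul_left (ENNReal.ofReal_le_ofReal ?_) _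
    have h2 : t⁻¹ ≤ 4 * (Real.sqrt n)⁻¹ := by
      rw [ht, inv_div, div_le_iff₀ hn0]
      have h3 : (Real.sqrt n)⁻¹ * n = Real.sqrt n := by
        rw [inv_mul_eq_div, Real.div_sqrt]
      rw [mul_assoc, h3]
      linarith
    calc (ρ : ℝ) * t⁻¹ ^ p₀ ≤ (2 * Real.sqrt n) * (4 * (Real.sqrt n)⁻¹) ^ p₀ := by gcongr
      _ = _ := by
        rw [Real.mul_rpow (by norm_num) (by positivity), Real.sqrt_eq_rpow, ← Real.rpow_neg hn0.le,
          ← Real.rpow_mul hn0.le, show -((p₀ - 1) / 2) = 1 / 2 + -(1 / 2) * p₀ by ring,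
          Real.rpow_add hn0]
        ring
  have hτ : ∫⁻ y, regenTime u y.2 ∂condJoint P u ≤ T := lintegral_mono fun y => by
    simpa using ENNReal.rpow_le_rpow_of_exponent_le (one_le_regenTime u y.2) hp₀
  have hA : ∫⁻ y, {y : Env d × Path d | ENNReal.ofReal (n / 2) ≤ regenTime u y.2}.indicator
        (fun y => regenTime u y.2 ^ (1 : ℝ)) y ∂condJoint P u
      ≤ ENNReal.ofReal ((n : ℝ) ^ (-((p₀ - 1) / 2))) * (ENNReal.ofReal (2 ^ (p₀ - 1)) * T) := by
    refine (lintegral_indicator_regenTime_le hP hp₀ (by positivity)).trans ?_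
    rw [← mul_assoc, ← ENNReal.ofReal_mul (by positivity)]
    refine mul_le_mul_left (ENNReal.ofReal_le_ofReal ?_) _
    rw [inv_div, Real.div_rpow (by norm_num) hn0.le, div_eq_mul_inv, ← Real.rpow_neg hn0.le, mul_comm]
    gcongr
    linarith
  have hmain := lintegral_averaged_le_blockSum hP hQ hb hc (h := S.indicator 1)
    (measurable_one.indicator hS) ENNReal.one_ne_top one_ne_zero
    (fun X => Set.indicator_le_self' (by simp) X) (K := n) fun X X' hX =>
      indicator_one_congr (by simp only [hSdef, Set.mem_ofPred_eq]; rw [hX n le_rfl])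
  rw [lintegral_indicator_one hS] at hmain
  refine hmain.trans ((lintegral_le_add_of_isFirst (isRegenerative_condJoint hP.iid u)
      hP.ae_condJoint_ne_top
    (A := {y : Env d × Path d | ENNReal.ofReal (n / 2) ≤ regenTime u y.2}.indicator
      (fun y => regenTime u y.2 ^ (1 : ℝ)))
    (Ψ := (staysLow u t ρ).indicator 1) (φ := fun x => x)
    (((measurable_regenTime u).pow_const _).indicator
      (measurableSet_le measurable_const (measurable_regenTime u)))
    (measurable_one.indicator hlow) (fun _ _ _ => rfl) ?_).trans ?_)
  · refine ae_of_all _ fun y s hs => ?_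
    have hreg : regenTime u y.2 = s := by rw [← firstTime_zero, hs.firstTime_eq]
    have hy : regenTime u y.2 ≠ ⊤ := by simp [hreg]
    by_cases h1 : ENNReal.ofReal (n / 2) ≤ regenTime u y.2
    · rw [Set.indicator_of_mem (by exact h1), ENNReal.rpow_one]
      refine le_add_of_le_left ((blockSum_le_mul hy (W := 1) fun m _ =>
        Set.indicator_le_self' (by simp) _).trans ?_)
      rw [mul_one]
    refine le_add_of_le_right ?_
    refine (blockSum_le_mul hy (W := (staysLow u t ρ).indicator 1 (theta s y)) fun m hm => ?_).trans
      (by rw [hreg])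
    rw [hreg] at hm h1
    by_cases h2 : pathShift m y.2 ∈ S
    swap
    · rw [Set.indicator_of_notMem h2]
      exact zero_le
    rw [Set.indicator_of_mem (s := staysLow u t ρ)]
    · exact Set.indicator_le_self' (by simp) _
    have hms : m < s := by exact_mod_cast hm
    rw [not_le, ← ENNReal.ofReal_natCast] at h1
    have h3 := (ENNReal.ofReal_lt_ofReal_iff_of_nonneg (Nat.cast_nonneg s)).1 h1
    have hsn : s ≤ m + n := by
      have : (s : ℝ) < n := by linarith
      have : s < n := by exact_mod_cast this
      omega
    -- The time `m + n` of the slow walk, counted from the regeneration `s < n / 2`. Its level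
    -- relative to `X_s` is even lower than relative to `X_m`.
    refine ⟨m + n - s, ?_, ?_⟩
    · rw [Nat.cast_sub hsn, hρt]
      push_cast
      have : (0 : ℝ) ≤ m := Nat.cast_nonneg m
      linarith
    · have h4 : (pathShift m y.2 n ⬝ᵥ u) < (ρ : ℤ) := by
        have : ((pathShift m y.2 n ⬝ᵥ u : ℤ) : ℝ) < ρ := lt_of_le_of_lt h2 hρ3
        exact_mod_cast this
      have h5 := hs.level_lt hms
      simp only [theta, pathShift, sub_dotProduct] at h4 ⊢
      rw [Nat.add_sub_cancel' hsn]
      omega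
  · refine (add_le_add hA (mul_le_mul' hτ hE)).trans_eq ?_
    ring

end RWRE

/-! ### Residual waiting times and ergodicity. -/

namespace RWRE

variable {d : ℕ} {P Q : Measure (Env d)} {u : Site d} {M : ℝ} {c : ℕ}

/-- The time from `m` to the next regeneration more than `r` above level `X_m`. -/
noncomputable def residualTime (u : Site d) (r m : ℕ) (y : Env d × Path d) : ℝ≥0∞ :=
  firstTime u m r y.2 - m

theorem measurable_residualTime (u : Site d) (r m : ℕ) :
    Measurable (residualTime u r m : Env d × Path d → ℝ≥0∞) :=
  (measurable_firstTime u m r).sub_const _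

/-- The monotonicity that lets the residual time serve as `V` in `sum_lintegral_joint_le`. -/
theorem residualTime_le_shift {r n m : ℕ} {y : Env d × Path d} (h : IsRegeneration u y.2 n)
    (hnm : n ≤ m) : residualTime u r m y ≤ residualTime u r (m - n) (theta n y) := by
  have h1 := firstTime_le_add (m := m) (m' := m - n) (r := r) (r' := r) h
    (by rw [Nat.add_sub_cancel' hnm])
  have h2 : (m : ℝ≥0∞) = n + (m - n : ℕ) := by
    rw [← Nat.cast_add, Nat.add_sub_cancel' hnm]
  rw [residualTime, residualTime, tsub_le_iff_right, h2]
  refine h1.trans ?_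
  rw [add_comm (n : ℝ≥0∞), add_comm (n : ℝ≥0∞), ← add_assoc]
  exact add_le_add_left le_tsub_add _

theorem blockSum_residualTime_le {r s : ℕ} {y : Env d × Path d} (h : IsFirst u 0 0 s y.2) :
    blockSum u (residualTime u r) y
      ≤ regenTime u y.2 ^ 2 + s * firstTime u 0 r (theta s y).2 := by
  have hreg : regenTime u y.2 = s := by rw [← firstTime_zero, h.firstTime_eq]
  refine (blockSum_le_mul (by simp [hreg])
    (W := s + firstTime u 0 r (theta s y).2) fun m hm => ?_).trans_eq ?_
  · refine tsub_le_self.trans (firstTime_le_add h.1.1 ?_)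
    rw [hreg, Nat.cast_lt] at hm
    have := h.level_lt hm
    rw [add_zero]
    omega
  · rw [hreg]
    ring

/-- A block contributes `τ₁` terms, each at most `τ₁` plus an independent integrable time. Here the
second moment of `τ₁` is needed. -/
theorem lintegral_blockSum_residualTime_ne_top (hP : HasRegenSecondMoment P u)
    {ρ : Measure (Env d × Path d)} (hρ : IsRegenerative P u ρ)
    (hfin : ∀ᵐ y ∂ρ, firstTime u 0 0 y.2 ≠ ⊤) (h2 : ∫⁻ y, regenTime u y.2 ^ 2 ∂ρ ≠ ⊤) (r : ℕ) :
    ∫⁻ y, blockSum u (residualTime u r) y ∂ρ ≠ ⊤ := by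
  refine ne_top_of_le_ne_top ?_ (lintegral_le_add_of_isFirst hρ hfin (φ := fun x => x)
    ((measurable_regenTime u).pow_const 2) (measurable_firstTime u 0 r) (fun _ _ _ => rfl)
    (ae_of_all _ fun y s hs => blockSum_residualTime_le hs))
  exact ENNReal.add_ne_top.2 ⟨h2, ENNReal.mul_ne_top
    (ne_top_of_le_ne_top h2 (lintegral_mono fun y => regenTime_le_sq u y.2))
    (hP.lintegral_firstTime_condJoint r)⟩

/-- Decorrelation of local functionals under the limit law, up to an error bounded in time. -/
theorem exists_lintegral_mul_sum_seen_le [IsProbabilityMeasure Q] (hP : HasRegenSecondMoment P u)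
    (hQ : IsAverageLimit P u Q) (hb : ∀ᵐ ω ∂P, ω ∈ boundedEnv d M)
    (hc : ∀ z : Site d, euclNorm z ≤ M → |z ⬝ᵥ u| ≤ c) {f : Env d → ℝ≥0∞} (hf : Measurable f)
    (hf1 : ∀ ω, f ω ≤ 1) {r : ℕ}
    (hfdep : ∀ ω ω' : Env d, (∀ x, x ⬝ᵥ u < r → ω x = ω' x) → f ω = f ω')
    (hfcut : ∀ ω, f (cut u (-r) ω) = f ω) :
    ∃ E : ℝ≥0∞, E ≠ ⊤ ∧ ∀ N : ℕ, ∫⁻ y, f y.1 * ∑ n ∈ Finset.range N, seen f n y ∂joint Q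
      ≤ (∫⁻ ω, f ω ∂Q) * ∑ j ∈ Finset.range N, ∫⁻ y, visit u f r j y ∂condJoint P u + E := by
  have hprob := hP.isProbabilityMeasure
  set D₀ := ∫⁻ y, blockSum u (residualTime u r) y ∂joint P with hD₀
  set D := ∫⁻ y, blockSum u (residualTime u r) y ∂condJoint P u with hD
  set F := ∫⁻ y, firstTime u 0 r y.2 ∂condJoint P u with hF
  have hD₀top : D₀ ≠ ⊤ := lintegral_blockSum_residualTime_ne_top hP (isRegenerative_joint hP.iid u)
    hP.ae_joint_ne_top hP.sq r
  have hDtop : D ≠ ⊤ := lintegral_blockSum_residualTime_ne_top hP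
    (isRegenerative_condJoint hP.iid u) hP.ae_condJoint_ne_top
    (hP.lintegral_condJoint_ne_top hP.sq) r
  refine ⟨D + F, ENNReal.add_ne_top.2 ⟨hDtop, hP.lintegral_firstTime_condJoint r⟩, fun N => ?_⟩
  set b := ∑ j ∈ Finset.range N, ∫⁻ y, visit u f r j y ∂condJoint P u
  have hbtop : b ≠ ⊤ := by
    have := hP.isProbabilityMeasure_condJoint
    refine ENNReal.sum_ne_top.2 fun j _ => ne_top_of_le_ne_top ENNReal.one_ne_top ?_
    refine (lintegral_mono (g := fun _ => 1) fun y =>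
      (visit_le_seen u f r j y).trans (hf1 _)).trans ?_
    simp
  have hlim := hQ.tendsto_joint hb hc (H := fun y => f y.1 * ∑ n ∈ Finset.range N, seen f n y)
    ((hf.comp measurable_fst).mul (Finset.measurable_sum _ fun n _ => measurable_seen hf n))
    (C := N + 1) (by simp) (by simp) (fun y => ?_) (K := N) (r := r + c * N)
    (fun ω X X' hX => ?_) fun ω X hX => ?_
  -- Decorrelation is applied from every starting time `m < K` and averaged over `m`. The left side
  -- tends to the mean under `Q`, and the residual times contribute at most `D` on average.
  · have h1 : Tendsto (fun K : ℕ => (∑ m ∈ Finset.range K, ∫⁻ y, seen f m y ∂joint P) / K * b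
        + (D₀ / K + (D + F))) atTop (nhds ((∫⁻ ω, f ω ∂Q) * b + (0 + (D + F)))) :=
      (ENNReal.Tendsto.mul_const (hQ f _ hf hf1 hfcut) (Or.inr hbtop)).add
        ((tendsto_const_div_natCast hD₀top).add_const _)
    rw [zero_add] at h1
    refine le_of_tendsto_of_tendsto hlim h1 ?_
    filter_upwards [eventually_gt_atTop 0] with K hK
    have hK0 : (K : ℝ≥0∞) ≠ 0 := by exact_mod_cast hK.ne'
    have hKtop : (K : ℝ≥0∞) ≠ ⊤ := ENNReal.natCast_ne_top K
    have h2 : ∑ m ∈ Finset.range K, ∫⁻ y, f (theta m y).1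
        * ∑ n ∈ Finset.range N, seen f n (theta m y) ∂joint P
        ≤ (∑ m ∈ Finset.range K, ∫⁻ y, seen f m y ∂joint P) * b + (D₀ + K * (D + F)) := by
      have h3 := sum_lintegral_joint_le hP (measurable_residualTime u r) (fun _ _ _ _ => rfl)
        (fun n m y hn hnm => residualTime_le_shift hn hnm) K
      calc _ ≤ ∑ m ∈ Finset.range K, ((∫⁻ y, seen f m y ∂joint P) * b
            + ∫⁻ y, residualTime u r m y ∂joint P + F) := by
            simp only [seen_theta]
            exact Finset.sum_le_sum fun m _ =>
              lintegral_seen_mul_sum_le hP hf hf1 hf hf1 hfdep hfcut m N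
        _ ≤ (∑ m ∈ Finset.range K, ∫⁻ y, seen f m y ∂joint P) * b + (D₀ + K * D) + K * F := by
            rw [Finset.sum_add_distrib, Finset.sum_add_distrib, Finset.sum_const,
              Finset.card_range, nsmul_eq_mul, ← Finset.sum_mul]
            gcongr
        _ = _ := by ring
    calc _ ≤ ((∑ m ∈ Finset.range K, ∫⁻ y, seen f m y ∂joint P) * b + (D₀ + K * (D + F))) / K :=
          ENNReal.div_le_div_right h2 _
      _ = _ := by
          rw [ENNReal.add_div, ENNReal.add_div, mul_comm (K : ℝ≥0∞),
            ENNReal.mul_div_cancel_right hK0 hKtop, div_eq_mul_inv, div_eq_mul_inv, mul_right_comm]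
          rfl
  · refine (mul_le_of_le_one_left' (hf1 _)).trans (le_trans (Finset.sum_le_sum
      (g := fun _ => (1 : ℝ≥0∞)) fun n _ => hf1 _) ?_)
    simp
  · simp only
    congr 1
    refine Finset.sum_congr rfl fun n hn => ?_
    simp only [seen]
    rw [hX n (Finset.mem_range.1 hn).le]
  · simp only
    have h1 : f (cut u (-(r + c * N : ℕ)) ω) = f ω := by
      rw [← hfcut, cut_cut u (by push_cast; nlinarith), hfcut]
    rw [h1]
    congr 1
    refine Finset.sum_congr rfl fun n hn => seen_cut hfcut ω ?_
    have h2 := (abs_le.1 (abs_level_le hX n)).1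
    have h3 : (c : ℤ) * n ≤ c * N := by
      gcongr
      exact_mod_cast (Finset.mem_range.1 hn).le
    push_cast
    linarith

/-- If `μ` is invariant for the environment chain, then environment and path seen from the walk
form a stationary sequence. -/
theorem map_theta_one_joint {μ : Measure (Env d)} [SFinite μ]
    (hμ : Kernel.Invariant (envKernel d) μ) : (joint μ).map (theta 1) = joint μ := by
  have h1 : ∀ f : Env d → ℝ≥0∞, Measurable f → ∫⁻ y, seen f 1 y ∂joint μ = ∫⁻ ω, f ω ∂μ := by
    intro f hf
    conv_rhs => rw [← hμ.def, Measure.lintegral_bind (envKernel d).aemeasurable hf.aemeasurable]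
    rw [lintegral_joint μ (measurable_seen hf 1)]
    refine lintegral_congr fun ω => ?_
    exact (lintegral_map hf ((measurable_theta_aux 1).comp measurable_prodMk_left)).symm
  refine Measure.ext_of_lintegral _ fun H hH => ?_
  rw [lintegral_map hH (measurable_theta 1), lintegral_joint_markov μ hH,
    h1 _ (measurable_lintegral_quenched hH), ← lintegral_joint μ hH]

theorem ae_joint_theta_zero (μ : Measure (Env d)) [SFinite μ] : ∀ᵐ y ∂joint μ, theta 0 y = y := by
  have h0 : ∀ᵐ y ∂joint μ, y.2 0 = 0 :=
    ae_joint μ (((measurable_pi_apply 0).comp measurable_snd) (measurableSet_singleton 0))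
      (ae_of_all _ fun ω => quenched_ae_zero ω)
  filter_upwards [h0] with y hy
  refine Prod.ext (funext fun x => ?_) (funext fun k => ?_)
  · simp only [theta, shift, hy, add_zero]
  · simp only [theta, pathShift, hy, sub_zero, zero_add]

theorem map_theta_joint {μ : Measure (Env d)} [SFinite μ]
    (hμ : Kernel.Invariant (envKernel d) μ) (n : ℕ) : (joint μ).map (theta n) = joint μ := by
  induction n with
  | zero =>
    exact (Measure.map_congr (ae_joint_theta_zero μ)).trans Measure.map_id
  | succ n ih =>
    have h : theta (d := d) (n + 1) = theta 1 ∘ theta n := funext fun y => (theta_theta n 1 y).symm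
    rw [h, ← Measure.map_map (measurable_theta 1) (measurable_theta n), ih, map_theta_one_joint hμ]

/-- A path that starts in an invariant set `A` stays in it, so `Q A` is the probability of being in
`A` at both times `0` and `n`. Averaged over `n`, decorrelation bounds this by `(Q A)²` up to the
error of approximating `A` by a local event. -/
theorem IsAverageLimit.isErgodicFor [IsProbabilityMeasure Q] (hP : HasRegenSecondMoment P u)
    (hQ : IsAverageLimit P u Q)
    (hblock : ∀ (f : Env d → ℝ≥0∞) (r : ℕ), Measurable f → (∀ ω, f (cut u (-r) ω) = f ω) →
      ∫⁻ ω, f ω ∂Q = ∫⁻ ω, f ω ∂blockMeasure P u r)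
    (hb : ∀ᵐ ω ∂P, ω ∈ boundedEnv d M)
    (hc : ∀ z : Site d, euclNorm z ≤ M → |z ⬝ᵥ u| ≤ c) : IsErgodicFor (envKernel d) Q := by
  have hprob := hP.isProbabilityMeasure
  intro A hA hinv
  have hQinv := hQ.invariant hb hc
  have hstep : ∀ᵐ y ∂joint Q, y.1 ∈ A → (theta 1 y).1 ∈ A := by
    have hm : MeasurableSet {y : Env d × Path d | y.1 ∈ A → (theta 1 y).1 ∈ A} := by
      refine measurableSet_setOfPred.2 (Measurable.imp (measurableSet_setOfPred.1
        (measurable_fst hA)) (measurableSet_setOfPred.1 ((measurable_theta_aux 1) hA)))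
    refine ae_joint Q hm (hinv.mono fun ω hω => ?_)
    by_cases h : ω ∈ A
    · rw [Set.indicator_of_mem h, Pi.one_apply] at hω
      have hmeas : Measurable fun X : Path d => shift (X 1) ω :=
        (measurable_theta_aux 1).comp measurable_prodMk_left
      change (quenched ω 0).map (fun X => shift (X 1) ω) A = 1 at hω
      rw [Measure.map_apply hmeas hA] at hω
      filter_upwards [(prob_compl_eq_zero_iff (hmeas hA)).2 hω |> compl_mem_ae_iff.2] with X hX _
      change shift (X 1) ω ∈ A
      simpa using hX
    · exact ae_of_all _ fun X hX => absurd hX h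
  have hinA : ∀ n, ∀ᵐ y ∂joint Q, y.1 ∈ A → (theta n y).1 ∈ A := by
    intro n
    induction n with
    | zero =>
      filter_upwards [ae_joint_theta_zero Q] with y hy h
      rwa [hy]
    | succ n ih =>
      have h1 := ae_of_ae_map (measurable_theta n).aemeasurable
        (by rw [map_theta_joint hQinv n]; exact hstep)
      filter_upwards [ih, h1] with y hy hy1 h
      rw [theta_theta] at hy1
      exact hy1 (hy h)
  have key : ∀ ε : ℝ, 0 < ε → Q A ≤ (Q A + ENNReal.ofReal ε) * (Q A + ENNReal.ofReal ε)
      + (ENNReal.ofReal ε + ENNReal.ofReal ε) := by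
    intro ε hε
    -- Cylinder events are dense, and decorrelation is available only for them. By stationarity the
    -- approximation costs at most `ε` at each of the two times.
    obtain ⟨B, hB, hAB⟩ := (Measure.MeasureDense.of_generateFrom_isSetAlgebra_finite (μ := Q)
      isSetAlgebra_measurableCylinders (generateFrom_measurableCylinders).symm).approx A hA
      (measure_ne_top _ _) ε hε
    have hBm := MeasurableSet.of_mem_measurableCylinders hB
    obtain ⟨r, hr, hr'⟩ := exists_radius hB u
    set f : Env d → ℝ≥0∞ := B.indicator 1 with hf
    have hfm : Measurable f := measurable_one.indicator hBm
    have hf1 : ∀ ω, f ω ≤ 1 := fun ω => Set.indicator_le_self' (by simp) ω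
    have hQf : ∫⁻ ω, f ω ∂Q = Q B := lintegral_indicator_one hBm
    have hBA : Q B ≤ Q A + ENNReal.ofReal ε := by
      refine (measure_mono (t := A ∪ symmDiff A B) fun ω h => ?_).trans
        ((measure_union_le _ _).trans (add_le_add_right hAB.le _))
      by_cases h' : ω ∈ A
      · exact Or.inl h'
      · exact Or.inr (Or.inr ⟨h, h'⟩)
    set g : Env d → ℝ≥0∞ := (A \ B).indicator 1 with hg
    have hgm : Measurable g := measurable_one.indicator (hA.diff hBm)
    have hQg : ∫⁻ ω, g ω ∂Q ≤ ENNReal.ofReal ε := by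
      rw [hg, lintegral_indicator_one (hA.diff hBm)]
      exact (measure_mono fun ω h => Or.inl h).trans hAB.le
    have hn : ∀ n, Q A ≤ ∫⁻ y, f y.1 * seen f n y ∂joint Q
        + (ENNReal.ofReal ε + ENNReal.ofReal ε) := by
      intro n
      have h1 : ∫⁻ y, g (theta n y).1 ∂joint Q = ∫⁻ ω, g ω ∂Q := by
        have h2 := lintegral_map (μ := joint Q) (hgm.comp measurable_fst) (measurable_theta n)
        rw [map_theta_joint hQinv n, Function.comp_def] at h2
        rw [← h2, lintegral_joint_fst Q hgm]
      calc Q A = ∫⁻ y, A.indicator 1 y.1 ∂joint Q := by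
            rw [lintegral_joint_fst Q (measurable_one.indicator hA), lintegral_indicator_one hA]
        _ ≤ ∫⁻ y, (f y.1 * seen f n y + (g y.1 + g (theta n y).1)) ∂joint Q := by
            refine lintegral_mono_ae ?_
            filter_upwards [hinA n] with y hy
            by_cases h : y.1 ∈ A
            swap
            · rw [Set.indicator_of_notMem h]
              exact zero_le
            rw [Set.indicator_of_mem h, Pi.one_apply]
            by_cases hB0 : y.1 ∈ B
            · by_cases hBn : (theta n y).1 ∈ B
              · refine le_add_of_le_left (le_of_eq ?_)
                change 1 = f y.1 * f (theta n y).1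
                rw [hf, Set.indicator_of_mem hB0, Set.indicator_of_mem hBn]
                simp
              · refine le_add_of_le_right (le_add_of_le_right (le_of_eq ?_))
                rw [hg, Set.indicator_of_mem (show _ ∈ A \ B from ⟨hy h, hBn⟩)]
                rfl
            · refine le_add_of_le_right (le_add_of_le_left (le_of_eq ?_))
              rw [hg, Set.indicator_of_mem (show _ ∈ A \ B from ⟨h, hB0⟩)]
              rfl
        _ ≤ _ := by
            have hg1 : Measurable fun y : Env d × Path d => g y.1 := hgm.comp measurable_fst
            have hg2 : Measurable fun y : Env d × Path d => g (theta n y).1 :=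
              hgm.comp (measurable_fst.comp (measurable_theta n))
            rw [lintegral_add_right (g := fun y : Env d × Path d => g y.1 + g (theta n y).1) _ (hg1.add hg2),
              lintegral_add_left hg1, h1,
              lintegral_joint_fst Q hgm]
            gcongr
    obtain ⟨E, hE, hbound⟩ := exists_lintegral_mul_sum_seen_le hP hQ hb hc hfm hf1 hr' hr
    -- By `hblock` the average number of visits under `condJoint` tends to `Q B`, which gives the
    -- second factor of `Q B * Q B`.
    have hlim : Tendsto (fun N : ℕ => Q B * ((∑ j ∈ Finset.range N,
        ∫⁻ y, visit u f r j y ∂condJoint P u) / N) + E / N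
        + (ENNReal.ofReal ε + ENNReal.ofReal ε)) atTop
        (nhds (Q B * Q B + 0 + (ENNReal.ofReal ε + ENNReal.ofReal ε))) := by
      have h1 := tendsto_sum_visit_div hP hfm hf1 hr
      rw [← hblock f r hfm hr, hQf] at h1
      exact ((ENNReal.Tendsto.const_mul h1 (Or.inr (measure_ne_top _ _))).add
        (tendsto_const_div_natCast hE)).add_const _
    have hle := ge_of_tendsto hlim (b := Q A) ?_
    · refine hle.trans ?_
      rw [add_zero]
      gcongr
    filter_upwards [eventually_gt_atTop 0] with N hN
    have hN0 : (N : ℝ≥0∞) ≠ 0 := by exact_mod_cast hN.ne'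
    have hNtop : (N : ℝ≥0∞) ≠ ⊤ := ENNReal.natCast_ne_top N
    have h2 : N * Q A ≤ Q B * ∑ j ∈ Finset.range N, ∫⁻ y, visit u f r j y ∂condJoint P u + E
        + N * (ENNReal.ofReal ε + ENNReal.ofReal ε) := by
      have h3 := Finset.sum_le_sum fun n (_ : n ∈ Finset.range N) => hn n
      rw [Finset.sum_const, Finset.sum_add_distrib, Finset.sum_const, Finset.card_range,
        nsmul_eq_mul, nsmul_eq_mul] at h3
      refine h3.trans (add_le_add_left ?_ _)
      rw [← hQf]
      refine le_trans (le_of_eq ?_) (hbound N)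
      simp only [Finset.mul_sum]
      exact (lintegral_finsetSum _ fun n _ =>
        (hfm.comp measurable_fst).mul (measurable_seen hfm n)).symm
    calc Q A = N * Q A / N := by rw [mul_comm, ENNReal.mul_div_cancel_right hN0 hNtop]
      _ ≤ _ := ENNReal.div_le_div_right h2 _
      _ = _ := by
          rw [ENNReal.add_div, ENNReal.add_div, mul_comm (N : ℝ≥0∞),
            ENNReal.mul_div_cancel_right hN0 hNtop, mul_div_assoc]
  have hAtop := measure_ne_top Q A
  set a := (Q A).toReal with ha
  have ha1 : a ≤ 1 := ENNReal.toReal_mono ENNReal.one_ne_top prob_le_one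
  have ha0 : 0 ≤ a := ENNReal.toReal_nonneg
  have hQa : Q A = ENNReal.ofReal a := (ENNReal.ofReal_toReal hAtop).symm
  have hreal : ∀ ε : ℝ, 0 < ε → a ≤ (a + ε) * (a + ε) + (ε + ε) := fun ε hε => by
    have h := key ε hε
    rw [hQa, ← ENNReal.ofReal_add ha0 hε.le, ← ENNReal.ofReal_mul (by positivity),
      ← ENNReal.ofReal_add hε.le hε.le, ← ENNReal.ofReal_add (by positivity) (by positivity)] at h
    exact (ENNReal.ofReal_le_ofReal_iff (by positivity)).1 h
  -- Let `ε` tend to zero.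
  have hsq : a ≤ a * a := by
    have hcont : Tendsto (fun ε : ℝ => (a + ε) * (a + ε) + (ε + ε)) (nhdsWithin 0 (Set.Ioi 0))
        (nhds (a * a)) := by
      have : Continuous fun ε : ℝ => (a + ε) * (a + ε) + (ε + ε) := by fun_prop
      have h := (this.tendsto 0).mono_left (nhdsWithin_le_nhds (s := Set.Ioi 0))
      simpa using h
    exact ge_of_tendsto hcont (eventually_mem_nhdsWithin.mono fun ε hε => hreal ε hε)
  rcases eq_or_lt_of_le ha0 with h | h
  · left
    rw [hQa, ← h, ENNReal.ofReal_zero]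
  · right
    have : a = 1 := le_antisymm ha1 (by nlinarith)
    rw [hQa, this, ENNReal.ofReal_one]

end RWRE

/-! ### Moment conditions, real-valued bounds, and conclusion. -/

namespace RWRE

variable {d : ℕ} {P Q : Measure (Env d)} {u : Site d} {M : ℝ} {c : ℕ}

theorem measurable_of_measurable_comp_snd {α β γ : Type*} [MeasurableSpace α] [MeasurableSpace β]
    [MeasurableSpace γ] (a : α) {g : β → γ} (h : Measurable fun y : α × β => g y.2) :
    Measurable g :=
  h.comp (measurable_prodMk_left (x := a))

theorem lintegral_regenTime_rpow_ne_top [IsProbabilityMeasure P] {p₀ : ℝ}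
    (hT : RegenMoment P u p₀) : ∫⁻ y, regenTime u y.2 ^ p₀ ∂joint P ≠ ⊤ := by
  have hm : Measurable (regenTime u : Path d → ℝ≥0∞) := measurable_of_measurable_comp_snd
    (fun _ : Site d => PMF.pure 0) (measurable_regenTime u)
  rw [← lintegral_averaged P (hm.pow_const p₀)]
  exact ne_of_lt hT

theorem hasRegenSecondMoment_of_regenMoment (hP : IsIIDProduct P) {p₀ : ℝ} (hp₀ : 2 ≤ p₀)
    (hT : RegenMoment P u p₀) : HasRegenSecondMoment P u := by
  have := isProbabilityMeasure_of_isIIDProduct hP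
  refine ⟨hP, ne_top_of_le_ne_top (lintegral_regenTime_rpow_ne_top hT) (lintegral_mono fun y => ?_)⟩
  rw [← ENNReal.rpow_natCast]
  exact ENNReal.rpow_le_rpow_of_exponent_le (one_le_regenTime u y.2) (by exact_mod_cast hp₀)

/-- In dimension zero every level is zero, so transience fails; in dimension at least one, `p₀ > 5`.
-/
theorem two_le_of_transient [IsProbabilityMeasure P] (htrans : TransientInDirection P u) {p₀ : ℝ}
    (hp₀ : 4 * (d : ℝ) + 1 < p₀) : 2 ≤ p₀ := by
  rcases Nat.eq_zero_or_pos d with rfl | hd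
  · have hprob : IsProbabilityMeasure (averaged P 0) := by
      rw [averaged_eq_map]
      exact Measure.isProbabilityMeasure_map measurable_snd.aemeasurable
    obtain ⟨X, hX⟩ := htrans.exists
    obtain ⟨n, hn⟩ := (hX.eventually_ge_atTop 1).exists
    simp [dotProduct] at hn
  · have : (1 : ℝ) ≤ d := by exact_mod_cast hd
    linarith

theorem varDist_trim_le [IsProbabilityMeasure P] [IsProbabilityMeasure Q]
    (hP : HasRegenSecondMoment P u) (hQ : IsAverageLimit P u Q)
    (hb : ∀ᵐ ω ∂P, ω ∈ boundedEnv d M) (hc1 : 1 ≤ c)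
    (hc : ∀ z : Site d, euclNorm z ≤ M → |z ⬝ᵥ u| ≤ c) {p₀ : ℝ} (hp₀ : 1 ≤ p₀)
    (hT : ∫⁻ y, regenTime u y.2 ^ p₀ ∂condJoint P u ≠ ⊤) {l : ℕ} (hl : 1 ≤ l) :
    varDist (Q.trim (levelSigma_le u l)) (P.trim (levelSigma_le u l))
      ≤ (c : ℝ) ^ (p₀ - 1) * (∫⁻ y, regenTime u y.2 ^ p₀ ∂condJoint P u).toReal
        * (l : ℝ) ^ (1 - p₀) := by
  have hc0 : (0 : ℝ) < c := by exact_mod_cast hc1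
  have hl0 : (0 : ℝ) < l := by exact_mod_cast hl
  have hne : Nonempty {A : Set (Env d) // MeasurableSet[levelSigma u l] A} :=
    ⟨⟨∅, @MeasurableSet.empty _ (levelSigma u l)⟩⟩
  refine ciSup_le fun A => ?_
  have hA := levelSigma_le u l A.1 A.2
  have hmain := lintegral_le_add_of_cut hP hQ hb hc1 hc hp₀ (f := A.1.indicator 1)
    (measurable_one.indicator hA) (fun ω => Set.indicator_le_self' (by simp) ω) hl
    fun ω => indicator_one_congr (cut_mem_iff A.2 ω)
  rw [lintegral_indicator_one hA, lintegral_indicator_one hA] at hmain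
  have htop : ENNReal.ofReal (((l : ℝ) / c)⁻¹ ^ (p₀ - 1))
      * ∫⁻ y, regenTime u y.2 ^ p₀ ∂condJoint P u ≠ ⊤ := ENNReal.mul_ne_top ENNReal.ofReal_ne_top hT
  have hreal := ENNReal.toReal_mono (ENNReal.add_ne_top.2 ⟨measure_ne_top P A.1, htop⟩) hmain
  rw [ENNReal.toReal_add (measure_ne_top _ _) htop, ENNReal.toReal_mul,
    ENNReal.toReal_ofReal (by positivity)] at hreal
  have hpow : ((l : ℝ) / c)⁻¹ ^ (p₀ - 1) = (c : ℝ) ^ (p₀ - 1) * (l : ℝ) ^ (1 - p₀) := by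
    rw [inv_div, Real.div_rpow hc0.le hl0.le, div_eq_mul_inv, ← Real.rpow_neg hl0.le, neg_sub]
  rw [hpow] at hreal
  simp only [measureReal_def]
  rw [trim_measurableSet_eq _ A.2, trim_measurableSet_eq _ A.2]
  linarith

end RWRE

theorem theorem4p1 {d : ℕ} (P : Measure (RWRE.Env d)) (u : RWRE.Site d) (M p₀ : ℝ)
    (hprod : RWRE.IsIIDProduct P)
    (htrans : RWRE.TransientInDirection P u)
    (hM : 0 < M) (hS : RWRE.BoundedSteps P M)
    (hp₀ : 4 * (d : ℝ) + 1 < p₀) (hT : RWRE.RegenMoment P u p₀) :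
    ∃ Pinf : Measure (RWRE.Env d), IsProbabilityMeasure Pinf ∧
      (∀ᵐ ω ∂Pinf, ∀ x z : RWRE.Site d, M < RWRE.euclNorm z → ω x z = 0) ∧
      Kernel.Invariant (RWRE.envKernel d) Pinf ∧
      RWRE.IsErgodicFor (RWRE.envKernel d) Pinf ∧
      ∃ C : ℝ,
        (∀ l : ℕ, 1 ≤ l →
          RWRE.varDist (Pinf.trim (RWRE.levelSigma_le u l)) (P.trim (RWRE.levelSigma_le u l))
            ≤ C * (l : ℝ) ^ (1 - p₀)) ∧
        (∀ p : ℝ, 1 ≤ p → p ≤ p₀ - 1 →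
          ∫⁻ X, RWRE.backtrack u X ^ p ∂(RWRE.averaged Pinf 0) ≤ ENNReal.ofReal C) ∧
        (∀ p : ℝ, 1 ≤ p → p ≤ (p₀ - 1) / 2 → ∀ n : ℕ, 1 ≤ n →
          (RWRE.averaged Pinf 0).real {X | ((X n ⬝ᵥ u : ℤ) : ℝ) ≤ Real.sqrt n}
            ≤ C * (n : ℝ) ^ (-p)) := by
  open RWRE in
  have hPprob := isProbabilityMeasure_of_isIIDProduct hprod
  have h2 := two_le_of_transient htrans hp₀
  have hP := hasRegenSecondMoment_of_regenMoment hprod h2 hT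
  have hb := ae_mem_boundedEnv hprod hS
  obtain ⟨c, hc1, hc⟩ := exists_level_bound u M
  obtain ⟨Q, hQprob, hQ, hblock⟩ := exists_isAverageLimit hP
  set T := ∫⁻ y, regenTime u y.2 ^ p₀ ∂condJoint P u with hTdef
  have hTtop : T ≠ ⊤ := hP.lintegral_condJoint_ne_top (lintegral_regenTime_rpow_ne_top hT)
  have hTr : T = ENNReal.ofReal T.toReal := (ENNReal.ofReal_toReal hTtop).symm
  have hT0 : 0 ≤ T.toReal := ENNReal.toReal_nonneg
  have hc0 : (0 : ℝ) < c := by exact_mod_cast hc1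
  refine ⟨Q, hQprob, hQ.ae_mem_boundedEnv hb, hQ.invariant hb hc,
    hQ.isErgodicFor hP hblock hb hc, ?_⟩
  set C₁ : ℝ := (c : ℝ) ^ (p₀ - 1) * T.toReal with hC₁
  set C₂ : ℝ := 2 ^ (p₀ - 1) * T.toReal + T.toReal * (2 * 4 ^ p₀ * T.toReal) with hC₂
  have hC₁0 : 0 ≤ C₁ := by positivity
  have hC₂0 : 0 ≤ C₂ := by positivity
  -- `C₁` serves the variation distance and the moment of order `p₀ - 1`, and `C₂` the slow
  -- progress. The summand `1` comes from `x ^ p ≤ 1 + x ^ (p₀ - 1)`, which makes the moment bound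
  -- uniform in `p`.
  refine ⟨1 + C₁ + C₂, fun l hl => ?_, fun p hp hpq => ?_, fun p hp hpq n hn => ?_⟩
  · refine (varDist_trim_le hP hQ hb hc1 hc (by linarith) hTtop hl).trans ?_
    rw [← hTdef, ← hC₁]
    gcongr
    linarith
  · have hd := lintegral_backtrack_rpow_le hP hQ hb hc (q := p₀ - 1) (by linarith)
    rw [sub_add_cancel, ← hTdef, hTr, ← ENNReal.ofReal_natCast,
      ENNReal.ofReal_rpow_of_pos hc0, ← ENNReal.ofReal_mul (by positivity)] at hd
    have hprob : IsProbabilityMeasure (averaged Q 0) := by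
      rw [averaged_eq_map]
      exact Measure.isProbabilityMeasure_map measurable_snd.aemeasurable
    calc ∫⁻ X, backtrack u X ^ p ∂averaged Q 0
        ≤ ∫⁻ X, (1 + backtrack u X ^ (p₀ - 1)) ∂averaged Q 0 := by
          refine lintegral_mono fun X => ?_
          rcases le_total (backtrack u X) 1 with h | h
          · exact le_add_of_le_left (ENNReal.rpow_le_one h (by linarith))
          · exact le_add_of_le_right (ENNReal.rpow_le_rpow_of_exponent_le h hpq)
      _ = 1 + ∫⁻ X, backtrack u X ^ (p₀ - 1) ∂averaged Q 0 := by
          rw [lintegral_add_left measurable_const]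
          simp
      _ ≤ ENNReal.ofReal 1 + ENNReal.ofReal C₁ := by
          rw [ENNReal.ofReal_one]
          gcongr
      _ ≤ _ := by
          rw [← ENNReal.ofReal_add zero_le_one hC₁0]
          exact ENNReal.ofReal_le_ofReal (by linarith)
  · have he := averaged_slow_le hP hQ hb hc (p₀ := p₀) (by linarith) hn
    rw [← hTdef, hTr, ← ENNReal.ofReal_mul (by positivity), ← ENNReal.ofReal_mul (by positivity),
      ← ENNReal.ofReal_mul (by positivity), ← ENNReal.ofReal_add (by positivity) (by positivity),
      ← ENNReal.ofReal_mul (by positivity), ← hC₂] at he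
    refine (ENNReal.toReal_le_of_le_ofReal (by positivity) he).trans ?_
    rw [mul_comm]
    gcongr
    · linarith
    · exact_mod_cast hn
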